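/- Let $(N^3,g)$ be an oriented smooth Riemannian $3$-manifold with Riemannian volume element $\Omega$, let $U\subset\mathbb{R}^2$ be open (for instance a domain), with coordinates $(u,v)$, and let $f\colon U\to N^3$ be a frontal with unit normal vector field $\nu$; that is, $f$ is a $C^\infty$-map and $\nu$ is a $C^\infty$ unit vector field of $N^3$ along $f$ with $g(f_*w,\nu)=0$ for all $w\in TU$. Put $\lambda:=\Omega(f_u,f_v,\nu)$, and let $p\in U$ be a non-degenerate singular point of $f$, that is, $\lambda(p)=0$ and $d\lambda(p)\neq 0$. Let $\gamma\colon(-\varepsilon,\varepsilon)\to U$ ($\varepsilon>0$) be a singular curve through $p$, that is, a regular $C^\infty$-curve with $\gamma(0)=p$ and $\lambda(\gamma(t))=0$ for all $t$, and let $\eta(t)$ be a null vector field along $\gamma$, that is, a $C^\infty$ nowhere vanishing field $\eta(t)\in T_{\gamma(t)}U$ with $df_{\gamma(t)}(\eta(t))=0$ for all $t$. Set $$\psi(t):=\Omega\bigl(\tilde\gamma'(t),\,D^f_{\eta(t)}\nu,\,\nu(\gamma(t))\bigr),\qquad \tilde\gamma:=f\circ\gamma,\quad {}'=\frac{d}{dt},$$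 where $D^f$ is the covariant derivative along the map $f$ induced from the Levi-Civita connection of $(N^3,g)$. Then the germ of $f$ at $p$ is a cuspidal cross cap if and only if the following two conditions hold: (i) $\eta(0)$ is transversal to $\gamma'(0)$, i.e. $\eta(0)$ and $\gamma'(0)$ are linearly independent; (ii) $\psi(0)=0$ and $\psi'(0)\neq 0$. Here the germ of $f$ at $p$ is called a cuspidal cross cap if it is $\mathcal{A}$-equivalent to the germ at $(0,0)$ of $f_{\mathrm{CCR}}\colon\mathbb{R}^2\to\mathbb{R}^3$, $f_{\mathrm{CCR}}(u,v)=(u,v^2,uv^3)$; that is, if there are a $C^\infty$ local diffeomorphism $\varphi$ from a neighbourhood of $p$ in $\mathbb{R}^2$ to a neighbourhood of $(0,0)$ in $\mathbb{R}^2$ with $\varphi(p)=(0,0)$, and a $C^\infty$ local diffeomorphism $\Phi$ from a neighbourhood of $f(p)$ in $N^3$ to a neighbourhood of the origin in $\mathbb{R}^3$ with $\Phi(f(p))=(0,0,0)$, such that $f_{\mathrm{CCR}}\circ\varphi=\Phi\circ f$ near $p$. -/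

import Mathlib

open Set Filter Topology Bundle Manifold
open scoped ContDiff

noncomputable section

namespace CuspidalCrossCap

/-- The Euclidean plane `ℝ²`. -/
abbrev E2 : Type := EuclideanSpace ℝ (Fin 2)

/-- Euclidean space `ℝ³`, the model space of `3`-manifolds. -/
abbrev E3 : Type := EuclideanSpace ℝ (Fin 3)

/-- The standard basis vectors of `ℝⁿ`. -/
abbrev stdVec {n : ℕ} (i : Fin n) : EuclideanSpace ℝ (Fin n) := EuclideanSpace.single i 1

/-! ### Germs of maps up to diffeomorphisms of source and target -/

section AEquivalence

variable {N N' : Type*} [TopologicalSpace N] [ChartedSpace E3 N]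
  [TopologicalSpace N'] [ChartedSpace E3 N']

/-- The germ of `f` at `p` is `𝒜`-equivalent (right-left equivalent) to the germ of `g` at `q`:
there are a local diffeomorphism `φ` of the plane with `φ p = q` and a local diffeomorphism `Φ`
of the target manifolds with `Φ (f p) = g q`, such that `g ∘ φ = Φ ∘ f` near `p`. -/
def AEquivalentAt (f : E2 → N) (p : E2) (g : E2 → N') (q : E2) : Prop :=
  ∃ (φ : E2 → E2) (Φ : N → N'),
    IsLocalDiffeomorphAt (𝓡 2) (𝓡 2) ∞ φ p ∧ φ p = q ∧
    IsLocalDiffeomorphAt (𝓡 3) (𝓡 3) ∞ Φ (f p) ∧ Φ (f p) = g q ∧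
    ∀ᶠ x in 𝓝 p, g (φ x) = Φ (f x)

/-- The standard cuspidal cross cap `(u, v) ↦ (u, v², u v³)`. -/
def fCCR (x : E2) : E3 := !₂[x 0, x 1 ^ 2, x 0 * x 1 ^ 3]

/-- The germ of `f` at `p` is a cuspidal cross cap. -/
def IsCuspidalCrossCapAt (f : E2 → N) (p : E2) : Prop :=
  AEquivalentAt f p fCCR 0

end AEquivalence

variable {N : Type*} [TopologicalSpace N] [ChartedSpace E3 N] [IsManifold (𝓡 3) ∞ N]

/-! ### Coordinates on a `3`-manifold -/

/-- The components, with respect to the coordinate frame of the chart at `y₀`, of a tangent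
vector `v` at the point `y`. The trivialization of the tangent bundle at `y₀` is the differential
of the chart at `y₀`. -/
def coordComp (y₀ y : N) (v : TangentSpace (𝓡 3) y) : E3 :=
  (trivializationAt E3 (TangentSpace (𝓡 3)) y₀).continuousLinearMapAt ℝ y v

/-- The coordinate vector field `∂/∂xⁱ` of the chart at `y₀`, at the point `y` of its domain. -/
def coordVec (y₀ y : N) (i : Fin 3) : TangentSpace (𝓡 3) y :=
  (trivializationAt E3 (TangentSpace (𝓡 3)) y₀).symmL ℝ y (stdVec i)

/-! ### Orientations and the Riemannian volume element -/

variable (N) in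
/-- An orientation of a `3`-manifold: an orientation of each tangent space which, in the
coordinates of a chart, is locally constant. -/
structure ManifoldOrientation where
  /-- The orientation of the tangent space at `y`. -/
  at' (y : N) : Orientation ℝ (TangentSpace (𝓡 3) y) (Fin 3)
  locally_constant : ∀ y₀ : N, ∃ o₀ : Orientation ℝ E3 (Fin 3), ∀ᶠ y in 𝓝 y₀,
    ∀ hy : y ∈ (trivializationAt E3 (TangentSpace (𝓡 3)) y₀).baseSet,
      Orientation.map (Fin 3)
        ((trivializationAt E3 (TangentSpace (𝓡 3)) y₀).linearEquivAt ℝ y hy) (at' y) = o₀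

instance finrank_tangentSpace (y : N) :
    Fact (Module.finrank ℝ (TangentSpace (𝓡 3) y) = 3) :=
  ⟨by
    change Module.finrank ℝ E3 = 3
    simp⟩

variable [RiemannianBundle (fun y : N => TangentSpace (𝓡 3) y)]

/-- The Riemannian volume element of an oriented Riemannian `3`-manifold, at the point `y`. -/
def volumeElement (o : ManifoldOrientation N) (y : N) (a b c : TangentSpace (𝓡 3) y) : ℝ :=
  (o.at' y).volumeForm ![a, b, c]

/-! ### The Levi-Civita connection and the covariant derivative along a map -/

/-- The matrix `(g_{ij})` of the Riemannian metric in the chart at `y₀`, as a function of the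
coordinates `x ∈ ℝ³`. -/
def metricMatrix (y₀ : N) (x : E3) : Matrix (Fin 3) (Fin 3) ℝ :=
  Matrix.of fun i j =>
    inner ℝ (coordVec y₀ ((extChartAt (𝓡 3) y₀).symm x) i)
      (coordVec y₀ ((extChartAt (𝓡 3) y₀).symm x) j)

/-- The partial derivative `∂g_{jl}/∂xⁱ` in the chart at `y₀`. -/
def metricDeriv (y₀ : N) (x : E3) (i j l : Fin 3) : ℝ :=
  fderiv ℝ (fun z => metricMatrix y₀ z j l) x (stdVec i)

/-- The Christoffel symbols `Γ_{ij}^k` of the Levi-Civita connection in the chart at `y₀`. -/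
def christoffel (y₀ : N) (x : E3) (i j k : Fin 3) : ℝ :=
  1 / 2 * ∑ l, (metricMatrix y₀ x)⁻¹ k l *
    (metricDeriv y₀ x i j l + metricDeriv y₀ x j i l - metricDeriv y₀ x l i j)

/-- The covariant derivative `D^f_w X` at `q` of a vector field `X` along `f`, in the direction of
`w ∈ T_q ℝ²`, induced from the Levi-Civita connection: in coordinates, with `X = ∑ ξᵏ ∂/∂xᵏ`,
it is `∑ₖ (dξᵏ(w) + ∑ᵢⱼ (Γ_{ij}^k ∘ f) ξʲ dfⁱ(w)) ∂/∂xᵏ`. The chart at `f q` is used; the result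
does not depend on this choice. -/
def covDerivAlong (f : E2 → N) (X : ∀ q : E2, TangentSpace (𝓡 3) (f q)) (q w : E2) :
    TangentSpace (𝓡 3) (f q) :=
  ∑ k, (fderiv ℝ (fun q' => coordComp (f q) (f q') (X q') k) q w +
      ∑ i, ∑ j, christoffel (f q) (extChartAt (𝓡 3) (f q) (f q)) i j k *
        coordComp (f q) (f q) (X q) j *
          fderiv ℝ (fun q' => extChartAt (𝓡 3) (f q) (f q') i) q w) •
    coordVec (f q) (f q) k

/-! ### Frontals and their singular points -/

/-- `f : U → N` is a (smooth) frontal with smooth unit normal vector field `ν`. -/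
structure IsFrontalOn (f : E2 → N) (ν : ∀ q : E2, TangentSpace (𝓡 3) (f q)) (U : Set E2) :
    Prop where
  smooth : ContMDiffOn (𝓡 2) (𝓡 3) ∞ f U
  smooth_normal : ContMDiffOn (𝓡 2) (𝓡 3).tangent ∞
    (fun q => (⟨f q, ν q⟩ : TangentBundle (𝓡 3) N)) U
  unit : ∀ q ∈ U, inner ℝ (ν q) (ν q) = 1
  normal : ∀ q ∈ U, ∀ w : E2, inner ℝ (mfderiv (𝓡 2) (𝓡 3) f q w) (ν q) = 0

/-- The signed area density function `λ = Ω(f_u, f_v, ν)`. -/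
def signedAreaDensity (o : ManifoldOrientation N) (f : E2 → N)
    (ν : ∀ q : E2, TangentSpace (𝓡 3) (f q)) (q : E2) : ℝ :=
  volumeElement o (f q) (mfderiv (𝓡 2) (𝓡 3) f q (stdVec 0 : E2))
    (mfderiv (𝓡 2) (𝓡 3) f q (stdVec 1 : E2)) (ν q)

/-- `p` is a non-degenerate singular point: `λ(p) = 0` and `dλ(p) ≠ 0`. -/
def IsNondegenerateSingularPoint (o : ManifoldOrientation N) (f : E2 → N)
    (ν : ∀ q : E2, TangentSpace (𝓡 3) (f q)) (p : E2) : Prop :=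
  signedAreaDensity o f ν p = 0 ∧ fderiv ℝ (signedAreaDensity o f ν) p ≠ 0

/-- `γ : (-ε, ε) → U` is a smooth regular parametrization of the singular curve with
`γ(0) = p`. -/
structure IsSingularCurve (o : ManifoldOrientation N) (f : E2 → N)
    (ν : ∀ q : E2, TangentSpace (𝓡 3) (f q)) (U : Set E2) (p : E2) (ε : ℝ) (γ : ℝ → E2) :
    Prop where
  pos : 0 < ε
  smooth : ContDiffOn ℝ ∞ γ (Ioo (-ε) ε)
  maps_to : ∀ t ∈ Ioo (-ε) ε, γ t ∈ U
  regular : ∀ t ∈ Ioo (-ε) ε, deriv γ t ≠ 0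
  base : γ 0 = p
  singular : ∀ t ∈ Ioo (-ε) ε, signedAreaDensity o f ν (γ t) = 0

/-- `η` is a smooth vector field of null directions along the curve `γ : (-ε, ε) → ℝ²`. -/
structure IsNullField {N : Type*} [TopologicalSpace N] [ChartedSpace E3 N]
    (f : E2 → N) (ε : ℝ) (γ η : ℝ → E2) : Prop where
  smooth : ContDiffOn ℝ ∞ η (Ioo (-ε) ε)
  ne_zero : ∀ t ∈ Ioo (-ε) ε, η t ≠ 0
  null : ∀ t ∈ Ioo (-ε) ε, mfderiv (𝓡 2) (𝓡 3) f (γ t) (η t) = 0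

/-- The function `ψ(t) = Ω(γ̃'(t), D^f_{η(t)} ν, ν)` along `γ`, where `γ̃ = f ∘ γ`. -/
def psi (o : ManifoldOrientation N) (f : E2 → N) (ν : ∀ q : E2, TangentSpace (𝓡 3) (f q))
    (γ η : ℝ → E2) (t : ℝ) : ℝ :=
  volumeElement o (f (γ t)) (mfderiv 𝓘(ℝ, ℝ) (𝓡 3) (fun s => f (γ s)) t (1 : ℝ))
    (covDerivAlong f ν (γ t) (η t)) (ν (γ t))

end CuspidalCrossCap

end

noncomputable section

namespace CuspidalCrossCap

/-! ### Smooth dependence of integrals on parameters -/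

section ParametricIntegral

open MeasureTheory

variable {α : Type*} [MeasurableSpace α] {μ : Measure α}

/-! The proof rests on the normal form `cuspidalForm b`, that is (u, v) ↦ (u, v², v³ b(u, v²)), and
on the fact that ψ reads off the coefficient b along the axis v = 0.

Passage to ℝ³. In the chart at f(p), λ and ψ become the determinants `areaDensity` and `flatPsi` of
the coordinate expressions, multiplied by the volume of the coordinate frame. For ψ this uses that η
is null: the Christoffel terms of D^f_η ν carry a factor df(η) = 0 (`coordComp_covDerivAlong`). The
volume factor is continuous and nonzero, so it does not affect the existence of a simple zero
(`simpleZero_iff_of_eventuallyEq_mul`).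

Normal form (`exists_cuspidalForm`). If η is transversal to γ', there are coordinates in which γ
runs in v = 0, the null direction along it is ∂_v, and the first component of the map is u. The
other two components then have the form (function of u) + v² · (smooth function). Since dλ ≠ 0, the
second v-derivative is nonzero, and after a rotation of the target the second component can be made
equal to v². The third becomes v² s(u, v). Whitney's theorem writes s = k(u, v²) + v l(u, v²), and a
shear of the target removes v² k. Whitney's theorem itself comes from Fourier inversion: cos x and
(sin x)/x are smooth functions of x² all of whose derivatives are bounded on the half-line x² ≥ 0.

Reading off b (`flatPsi_simpleZero_iff`). If F is equivalent to `cuspidalForm b`, the null field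
forces γ into the axis, transversally to η. Pairing the normal with the image of the standard frame
gives ψ(t) = ρ(t) b(φ(γ(t))) with ρ(0) ≠ 0. Hence condition (ii) means b(0) = 0 and b_u(0) ≠ 0, and
then b can serve as a new first coordinate, which yields `fCCR`
(`aEquivalentAt_fCCR_of_cuspidalForm`). Conversely `fCCR` is `cuspidalForm` with b = u, so the same
formula gives (i) and (ii) for a cuspidal cross cap. -/

theorem contDiff_nat_integral_of_dominated {V : Type} [NormedAddCommGroup V] [NormedSpace ℝ V]
    (n : ℕ) : ∀ {W : Type} [NormedAddCommGroup W] [NormedSpace ℝ W] [CompleteSpace W]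
    (g : V → α → W) (_ : ∀ a, ContDiff ℝ ∞ fun x => g x a)
    (_ : ∀ (m : ℕ) (x : V), AEStronglyMeasurable (fun a => iteratedFDeriv ℝ m (fun y => g y a) x) μ)
    (_ : ∀ (m : ℕ) (R : ℝ), ∃ B : α → ℝ, Integrable B μ ∧
      ∀ᵐ a ∂μ, ∀ x, ‖x‖ ≤ R → ‖iteratedFDeriv ℝ m (fun y => g y a) x‖ ≤ B a),
    ContDiff ℝ n fun x => ∫ a, g x a ∂μ := by
  have meas0 : ∀ {W : Type} [NormedAddCommGroup W] [NormedSpace ℝ W] (g : V → α → W)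
      (_ : ∀ (m : ℕ) (x : V),
        AEStronglyMeasurable (fun a => iteratedFDeriv ℝ m (fun y => g y a) x) μ) (x : V),
      AEStronglyMeasurable (g x) μ := by
    intro W _ _ g h x
    have h0 := (continuousMultilinearCurryFin0 ℝ V W).continuous.comp_aestronglyMeasurable (h 0 x)
    refine h0.congr (Eventually.of_forall fun a => ?_)
    simp [iteratedFDeriv_zero_eq_comp]
  have key : ∀ {W : Type} [NormedAddCommGroup W] [NormedSpace ℝ W] [CompleteSpace W]
      (g : V → α → W) (_ : ∀ a, ContDiff ℝ ∞ fun x => g x a)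
      (_ : ∀ (m : ℕ) (x : V),
        AEStronglyMeasurable (fun a => iteratedFDeriv ℝ m (fun y => g y a) x) μ)
      (_ : ∀ (m : ℕ) (x : V),
        AEStronglyMeasurable (fun a => iteratedFDeriv ℝ m (fderiv ℝ fun y => g y a) x) μ)
      (_ : ∀ (m : ℕ) (R : ℝ), ∃ B : α → ℝ, Integrable B μ ∧
        ∀ᵐ a ∂μ, ∀ x, ‖x‖ ≤ R → ‖iteratedFDeriv ℝ m (fun y => g y a) x‖ ≤ B a) (x : V),
      HasFDerivAt (fun x => ∫ a, g x a ∂μ) (∫ a, fderiv ℝ (fun y => g y a) x ∂μ) x := by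
    intro W _ _ _ g hg hm hm' hb x
    obtain ⟨B0, hB0, hB0'⟩ := hb 0 ‖x‖
    -- Differentiation under the integral needs a bound on a whole neighbourhood of x; the unit ball
    -- around x lies in the ball of radius ‖x‖ + 1 around 0.
    obtain ⟨B1, hB1, hB1'⟩ := hb 1 (‖x‖ + 1)
    refine hasFDerivAt_integral_of_dominated_of_fderiv_le (bound := B1)
      (F' := fun y a => fderiv ℝ (fun z => g z a) y)
      (Metric.ball_mem_nhds x one_pos) (Eventually.of_forall fun y => meas0 g hm y) ?_
      (meas0 (fun y a => fderiv ℝ (fun z => g z a) y) hm' x) ?_ hB1 ?_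
    · refine hB0.mono' (meas0 g hm x) ?_
      filter_upwards [hB0'] with a ha
      simpa using ha x le_rfl
    · filter_upwards [hB1'] with a ha y hy
      have : ‖y‖ ≤ ‖x‖ + 1 := by
        have h1 : ‖y - x‖ < 1 := by simpa [dist_eq_norm] using hy
        have h2 := norm_add_le x (y - x)
        simp only [add_sub_cancel] at h2
        linarith
      rw [← norm_iteratedFDeriv_one]
      exact ha y this
    · exact Eventually.of_forall fun a y _ =>
        ((hg a).differentiable (by simp) y).hasFDerivAt
  have measd : ∀ {W : Type} [NormedAddCommGroup W] [NormedSpace ℝ W] (g : V → α → W)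
      (_ : ∀ (m : ℕ) (x : V),
        AEStronglyMeasurable (fun a => iteratedFDeriv ℝ m (fun y => g y a) x) μ)
      (m : ℕ) (x : V),
      AEStronglyMeasurable (fun a => iteratedFDeriv ℝ m (fderiv ℝ fun y => g y a) x) μ := by
    intro W _ _ g h m x
    have h0 := (continuousMultilinearCurryRightEquiv' ℝ m V W).continuous.comp_aestronglyMeasurable
      (h (m + 1) x)
    refine h0.congr (Eventually.of_forall fun a => ?_)
    simp only [iteratedFDeriv_succ_eq_comp_right, Function.comp]
    simp
  -- The derivative of the integral is the integral of the derivative, and the family of derivatives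
  -- satisfies the same hypotheses with m shifted by one. Its values lie in `V →L[ℝ] W`, so `W` has
  -- to stay universally quantified in the induction.
  induction n with
  | zero =>
    intro W _ _ _ g hg hm hb
    refine contDiff_zero.2 (continuous_iff_continuousAt.2 fun x => ?_)
    exact (key g hg hm (measd g hm) hb x).continuousAt
  | succ n ih =>
    intro W _ _ _ g hg hm hb
    have hd := key g hg hm (measd g hm) hb
    rw [show ((n + 1 : ℕ) : ℕ∞ω) = (n : ℕ∞ω) + 1 by simp, contDiff_succ_iff_fderiv]
    refine ⟨fun x => (hd x).differentiableAt, by simp, ?_⟩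
    have : (fderiv ℝ fun x => ∫ a, g x a ∂μ) = fun x => ∫ a, fderiv ℝ (fun y => g y a) x ∂μ :=
      funext fun x => (hd x).fderiv
    rw [this]
    refine ih _ (fun a => (hg a).fderiv_right (by simp)) (measd g hm) fun m R => ?_
    obtain ⟨B, hB, hB'⟩ := hb (m + 1) R
    refine ⟨B, hB, ?_⟩
    filter_upwards [hB'] with a ha x hx
    have := ha x hx
    rwa [← norm_iteratedFDeriv_fderiv] at this

/-- The m-th derivative of the integrand is φ(a) times the m-th derivative of K at L_a x, with L_a
inserted in every slot. It is therefore dominated by C ‖L_a‖^m |φ(a)|, so the moments of φ pay for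
the growth of L. This serves both Hadamard's lemma (L a segment, compact domain) and Fourier
integrals (φ rapidly decreasing). -/
theorem contDiff_integral_smul_comp {V V' W : Type} [NormedAddCommGroup V] [NormedSpace ℝ V]
    [NormedAddCommGroup V'] [NormedSpace ℝ V'] [NormedAddCommGroup W] [NormedSpace ℝ W]
    [CompleteSpace W] [TopologicalSpace α] [SecondCountableTopology α] [OpensMeasurableSpace α]
    {φ : α → ℝ} {L : α → V →L[ℝ] V'} {K : V' → W} (hL : Continuous L) (hK : ContDiff ℝ ∞ K)
    (hφm : AEStronglyMeasurable φ μ)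
    (hφ : ∀ n : ℕ, Integrable (fun a => ‖L a‖ ^ n * ‖φ a‖) μ)
    (hb : ∀ (n : ℕ) (R : ℝ), ∃ C, ∀ᵐ a ∂μ, ∀ x, ‖x‖ ≤ R → ‖iteratedFDeriv ℝ n K (L a x)‖ ≤ C) :
    ContDiff ℝ ∞ fun x => ∫ a, φ a • K (L a x) ∂μ := by
  have hKL : ∀ a, ContDiff ℝ ∞ fun x => K (L a x) := fun a => hK.comp (L a).contDiff
  have hit : ∀ (m : ℕ) (a : α) (x : V), iteratedFDeriv ℝ m (fun y => φ a • K (L a y)) x =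
      φ a • (iteratedFDeriv ℝ m K (L a x)).compContinuousLinearMap fun _ => L a := by
    intro m a x
    have h1 : iteratedFDeriv ℝ m (K ∘ L a) x =
        (iteratedFDeriv ℝ m K (L a x)).compContinuousLinearMap fun _ => L a :=
      (L a).iteratedFDeriv_comp_right hK x (mod_cast le_top)
    have := iteratedFDeriv_const_smul_apply (𝕜 := ℝ) (i := m) (a := φ a) (f := fun y => K (L a y))
      (x := x) ((hKL a).of_le (mod_cast le_top)).contDiffAt
    rw [← h1]; exact this
  refine contDiff_infty.2 fun n => contDiff_nat_integral_of_dominated n _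
    (fun a => (hKL a).const_smul (φ a)) (fun m x => ?_) fun m R => ?_
  · simp only [hit]
    refine hφm.smul (Continuous.aestronglyMeasurable ?_)
    have hc : Continuous fun a => ContinuousMultilinearMap.compContinuousLinearMapContinuousMultilinear
        ℝ (fun _ : Fin m => V) (fun _ : Fin m => V') W (fun _ => L a) :=
      (ContinuousMultilinearMap.cont _).comp (continuous_pi fun _ => hL)
    have hc' : Continuous fun a => iteratedFDeriv ℝ m K (L a x) :=
      (hK.continuous_iteratedFDeriv (mod_cast le_top)).comp (hL.clm_apply continuous_const)
    exact hc.clm_apply hc'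
  · obtain ⟨C, hC⟩ := hb m R
    refine ⟨fun a => C * (‖L a‖ ^ m * ‖φ a‖), (hφ m).const_mul C, ?_⟩
    filter_upwards [hC] with a ha x hx
    rw [hit, norm_smul]
    have h1 := (iteratedFDeriv ℝ m K (L a x)).norm_compContinuousLinearMap_le fun _ => L a
    simp only [Finset.prod_const, Finset.card_univ, Fintype.card_fin] at h1
    calc _ ≤ ‖φ a‖ * (C * ‖L a‖ ^ m) := by
          gcongr
          exact h1.trans (by gcongr; exact ha x hx)
      _ = _ := by ring

end ParametricIntegral

/-- A first order Taylor formula in the direction of the range of a projection `id - P`. -/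
theorem exists_hadamard {V : Type} [NormedAddCommGroup V] [NormedSpace ℝ V]
    [FiniteDimensional ℝ V] (P Q : V →L[ℝ] V) (ℓ : V →L[ℝ] ℝ) (e : V)
    (hPQ : ∀ x, P x + Q x = x) (hQ : ∀ x, Q x = ℓ x • e) {h : V → ℝ} (hh : ContDiff ℝ ∞ h) :
    ∃ k : V → ℝ, ContDiff ℝ ∞ k ∧ ∀ x, h x = h (P x) + ℓ x * k x := by
  let L : ℝ → V →L[ℝ] V := fun τ => P + τ • Q
  have hL : Continuous L := by fun_prop
  have hK : ContDiff ℝ ∞ fun x => fderiv ℝ h x e :=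
    (hh.fderiv_right (by simp)).clm_apply contDiff_const
  -- `L τ x` runs along the segment from `P x` to `x`, with velocity `ℓ x • e`; the fundamental
  -- theorem of calculus on this segment gives the formula.
  refine ⟨fun x => ∫ τ in Icc (0 : ℝ) 1, (1 : ℝ) • fderiv ℝ h (L τ x) e, ?_, fun x => ?_⟩
  · refine contDiff_integral_smul_comp hL hK MeasureTheory.aestronglyMeasurable_const (fun n => ?_)
      fun n R => ?_
    · exact (((hL.norm.pow n).mul continuous_const).continuousOn.integrableOn_compact
        isCompact_Icc)
    · have hc : IsCompact ((fun p : ℝ × V => L p.1 p.2) ''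
          (Icc (0 : ℝ) 1 ×ˢ Metric.closedBall (0 : V) R)) :=
        (isCompact_Icc.prod (isCompact_closedBall 0 R)).image
          ((hL.comp continuous_fst).clm_apply continuous_snd)
      obtain ⟨C, hC⟩ := hc.exists_bound_of_continuousOn
        (hK.continuous_iteratedFDeriv (m := n) (mod_cast le_top)).continuousOn
      refine ⟨C, (MeasureTheory.ae_restrict_mem measurableSet_Icc).mono fun τ hτ y hy => ?_⟩
      exact hC _ ⟨(τ, y), ⟨hτ, by simpa using hy⟩, rfl⟩
  · have hd : ∀ τ : ℝ, HasDerivAt (fun τ => h (L τ x)) (ℓ x * fderiv ℝ h (L τ x) e) τ := by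
      intro τ
      have h1 : HasDerivAt (fun τ => L τ x) (Q x) τ := by
        have : HasDerivAt (fun τ : ℝ => P x + τ • Q x) (0 + (1 : ℝ) • Q x) τ :=
          (hasDerivAt_const τ (P x)).add ((hasDerivAt_id τ).smul_const (Q x))
        simpa [L] using this
      have h2 := ((hh.differentiable (by simp) (L τ x)).hasFDerivAt).comp_hasDerivAt τ h1
      simpa [hQ, Function.comp_def] using h2
    have hcont : Continuous fun τ => fderiv ℝ h (L τ x) e :=
      hK.continuous.comp (hL.clm_apply continuous_const)
    have := intervalIntegral.integral_eq_sub_of_hasDerivAt (a := 0) (b := 1) (fun τ _ => hd τ)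
      (by exact (continuous_const.mul hcont).intervalIntegrable _ _)
    rw [intervalIntegral.integral_const_mul, intervalIntegral.integral_of_le zero_le_one,
      ← MeasureTheory.integral_Icc_eq_integral_Ioc] at this
    simp only [one_smul]
    rw [this]
    simp [L, hPQ]

/-! ### Whitney's theorem on even functions -/

/-- `f` is smooth, and each of its iterated derivatives is bounded. -/
structure HasBoundedDerivs {V W : Type*} [NormedAddCommGroup V] [NormedSpace ℝ V]
    [NormedAddCommGroup W] [NormedSpace ℝ W] (f : V → W) : Prop where
  smooth : ContDiff ℝ ∞ f
  bounded : ∀ n : ℕ, ∃ C, ∀ x, ‖iteratedFDeriv ℝ n f x‖ ≤ C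

theorem HasBoundedDerivs.mul {V : Type*} [NormedAddCommGroup V] [NormedSpace ℝ V] {f g : V → ℝ}
    (hf : HasBoundedDerivs f) (hg : HasBoundedDerivs g) :
    HasBoundedDerivs fun x => f x * g x := by
  refine ⟨hf.smooth.mul hg.smooth, fun n => ?_⟩
  choose A hA using hf.bounded
  choose B hB using hg.bounded
  refine ⟨∑ i ∈ Finset.range (n + 1), (n.choose i : ℝ) * A i * B (n - i), fun x => ?_⟩
  refine (norm_iteratedFDeriv_mul_le hf.smooth hg.smooth x (mod_cast le_top)).trans ?_
  gcongr with i _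
  · exact mul_nonneg (Nat.cast_nonneg _) ((norm_nonneg _).trans (hA i x))
  · exact hA i x
  · exact hB _ x

theorem HasBoundedDerivs.comp_clm {V V' W : Type*} [NormedAddCommGroup V] [NormedSpace ℝ V]
    [NormedAddCommGroup V'] [NormedSpace ℝ V'] [NormedAddCommGroup W] [NormedSpace ℝ W]
    {f : V' → W} (hf : HasBoundedDerivs f) (L : V →L[ℝ] V') :
    HasBoundedDerivs fun x => f (L x) := by
  refine ⟨hf.smooth.comp L.contDiff, fun n => ?_⟩
  obtain ⟨A, hA⟩ := hf.bounded n
  refine ⟨A * ‖L‖ ^ n, fun x => ?_⟩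
  have h1 : iteratedFDeriv ℝ n (f ∘ L) x =
      (iteratedFDeriv ℝ n f (L x)).compContinuousLinearMap fun _ => L :=
    L.iteratedFDeriv_comp_right hf.smooth x (mod_cast le_top)
  have h2 := (iteratedFDeriv ℝ n f (L x)).norm_compContinuousLinearMap_le fun _ => L
  simp only [Finset.prod_const, Finset.card_univ, Fintype.card_fin] at h2
  change ‖iteratedFDeriv ℝ n (f ∘ L) x‖ ≤ _
  rw [h1]
  exact h2.trans (by gcongr; exact hA _)

theorem hasBoundedDerivs_iff_iteratedDeriv {f : ℝ → ℝ} (hf : ContDiff ℝ ∞ f) :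
    HasBoundedDerivs f ↔ ∀ n : ℕ, ∃ C, ∀ x, |iteratedDeriv n f x| ≤ C := by
  constructor
  · intro h n
    obtain ⟨C, hC⟩ := h.bounded n
    exact ⟨C, fun x => by
      rw [← Real.norm_eq_abs, ← norm_iteratedFDeriv_eq_norm_iteratedDeriv]; exact hC x⟩
  · intro h
    refine ⟨hf, fun n => ?_⟩
    obtain ⟨C, hC⟩ := h n
    exact ⟨C, fun x => by
      rw [norm_iteratedFDeriv_eq_norm_iteratedDeriv, Real.norm_eq_abs]; exact hC x⟩

theorem hasBoundedDerivs_cos : HasBoundedDerivs Real.cos := by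
  refine (hasBoundedDerivs_iff_iteratedDeriv Real.contDiff_cos).2 fun n => ⟨1, fun x => ?_⟩
  exact Real.abs_iteratedDeriv_cos_le_one n x

theorem hasBoundedDerivs_sin : HasBoundedDerivs Real.sin := by
  refine (hasBoundedDerivs_iff_iteratedDeriv Real.contDiff_sin).2 fun n => ⟨1, fun x => ?_⟩
  exact Real.abs_iteratedDeriv_sin_le_one n x

/-- There is an entire function `c` with `c (x²) = cos x`. -/
theorem exists_contDiff_comp_sq_eq_cos :
    ∃ c : ℝ → ℝ, ContDiff ℝ ∞ c ∧ ∀ x, c (x ^ 2) = Real.cos x := by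
  let a : ℕ → ℝ := fun n => (-1) ^ n / ((2 * n).factorial : ℝ)
  let P := FormalMultilinearSeries.ofScalars ℝ a
  have hr : P.radius = ⊤ := by
    refine FormalMultilinearSeries.ofScalars_radius_eq_top_of_tendsto ℝ a
      (Eventually.of_forall fun n => ?_) ?_
    · exact div_ne_zero (pow_ne_zero _ (by norm_num)) (by positivity)
    · have : (fun n : ℕ => ‖a n.succ‖ / ‖a n‖) =
          fun n : ℕ => 1 / ((2 * (n : ℝ) + 2) * (2 * n + 1)) := by
        funext n
        have h1 : (((2 * n.succ).factorial : ℕ) : ℝ) =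
            (2 * (n : ℝ) + 2) * ((2 * n + 1) * (2 * n).factorial) := by
          rw [show 2 * n.succ = (2 * n + 1) + 1 by omega, Nat.factorial_succ, Nat.factorial_succ]
          push_cast; ring
        have h2 : ((2 * n).factorial : ℝ) ≠ 0 := by positivity
        simp only [a, norm_div, norm_pow, norm_neg, norm_one, one_pow, h1, norm_mul,
          Real.norm_natCast]
        have h3 : ‖(2 : ℝ) * n + 2‖ = 2 * n + 2 := Real.norm_of_nonneg (by positivity)
        have h4 : ‖(2 : ℝ) * n + 1‖ = 2 * n + 1 := Real.norm_of_nonneg (by positivity)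
        rw [h3, h4]
        field_simp
      rw [this]
      refine squeeze_zero (fun n => by positivity) (fun n => ?_) tendsto_one_div_add_atTop_nhds_zero_nat
      exact one_div_le_one_div_of_le (by positivity) (by nlinarith [(Nat.cast_nonneg n : (0:ℝ) ≤ n)])
  have hP := P.hasFPowerSeriesOnBall (by rw [hr]; exact ENNReal.zero_lt_top)
  rw [hr] at hP
  refine ⟨P.sum, ?_, fun x => ?_⟩
  · have : AnalyticOnNhd ℝ P.sum univ := fun x _ => hP.analyticOnNhd x (by simp)
    exact this.contDiff
  · rw [Real.cos_eq_tsum]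
    refine (FormalMultilinearSeries.ofScalars_sum_eq a (x ^ 2)).trans (tsum_congr fun n => ?_)
    simp only [a, smul_eq_mul, ← pow_mul]
    ring

/-! ### The function cos √s and bounds for its derivatives -/

section SqrtCos

variable {c : ℝ → ℝ}

theorem mul_deriv_sq_of_comp_sq_eq_cos (hc : ContDiff ℝ ∞ c)
    (hcos : ∀ x, c (x ^ 2) = Real.cos x) (x : ℝ) : x * (-2 * deriv c (x ^ 2)) = Real.sin x := by
  have h1 : HasDerivAt (fun x => c (x ^ 2)) (deriv c (x ^ 2) * (2 * x)) x := by
    have := (hc.differentiable (by simp) (x ^ 2)).hasDerivAt.comp x (hasDerivAt_pow 2 x)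
    simpa [Function.comp_def] using this
  have h2 : HasDerivAt (fun x => c (x ^ 2)) (-Real.sin x) x := by
    simp only [hcos]; exact Real.hasDerivAt_cos x
  have := h1.unique h2
  linarith

theorem hasDerivAt_iteratedDeriv (hc : ContDiff ℝ ∞ c) (n : ℕ) (s : ℝ) :
    HasDerivAt (iteratedDeriv n c) (iteratedDeriv (n + 1) c s) s := by
  rw [iteratedDeriv_succ]
  exact ((hc.differentiable_iteratedDeriv n (mod_cast WithTop.coe_lt_top _)) s).hasDerivAt

/-- Differentiating c(x²) = cos x twice gives 4s c'' + 2c' + c = 0 at s = x²; each further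
differentiation in s raises the middle coefficient by 4. Positivity of s gives a square root to
start from and an open set on which the identity can be differentiated. -/
theorem ode_of_comp_sq_eq_cos (hc : ContDiff ℝ ∞ c) (hcos : ∀ x, c (x ^ 2) = Real.cos x) (n : ℕ) :
    ∀ s : ℝ, 0 < s → 4 * s * iteratedDeriv (n + 2) c s +
      (4 * n + 2) * iteratedDeriv (n + 1) c s + iteratedDeriv n c s = 0 := by
  induction n with
  | zero =>
    intro s hs
    have hd : ∀ x, x * (-2 * iteratedDeriv 1 c (x ^ 2)) = Real.sin x := fun x => by
      rw [iteratedDeriv_one]; exact mul_deriv_sq_of_comp_sq_eq_cos hc hcos x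
    set x := √s with hx
    have hxs : x ^ 2 = s := Real.sq_sqrt hs.le
    have h1 : HasDerivAt (fun x => x * (-2 * iteratedDeriv 1 c (x ^ 2)))
        (1 * (-2 * iteratedDeriv 1 c (x ^ 2)) +
          x * (-2 * (iteratedDeriv 2 c (x ^ 2) * (2 * x)))) x := by
      have h := (hasDerivAt_iteratedDeriv hc 1 (x ^ 2)).comp x (hasDerivAt_pow 2 x)
      have h' : HasDerivAt (fun x => iteratedDeriv 1 c (x ^ 2))
        (iteratedDeriv 2 c (x ^ 2) * (2 * x)) x := by
        simpa [Function.comp_def] using h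
      exact (hasDerivAt_id x).mul (h'.const_mul (-2))
    have h2 : HasDerivAt (fun x => x * (-2 * iteratedDeriv 1 c (x ^ 2))) (Real.cos x) x := by
      simp only [hd]; exact Real.hasDerivAt_sin x
    have h3 := h1.unique h2
    rw [← hcos, hxs] at h3
    simp only [iteratedDeriv_zero, Nat.cast_zero]
    have h4 : x * (-2 * (iteratedDeriv 2 c s * (2 * x))) = -4 * s * iteratedDeriv 2 c s := by
      rw [← hxs]; ring
    rw [h4] at h3
    simp only [zero_add]
    linarith
  | succ n ih =>
    intro s hs
    have h1 : HasDerivAt (fun s => 4 * s * iteratedDeriv (n + 2) c s +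
        (4 * n + 2) * iteratedDeriv (n + 1) c s + iteratedDeriv n c s)
        (4 * 1 * iteratedDeriv (n + 2) c s + 4 * s * iteratedDeriv (n + 3) c s +
          (4 * n + 2) * iteratedDeriv (n + 2) c s + iteratedDeriv (n + 1) c s) s :=
      (((((hasDerivAt_id s).const_mul 4).mul (hasDerivAt_iteratedDeriv hc (n + 2) s)).add
        ((hasDerivAt_iteratedDeriv hc (n + 1) s).const_mul _)).add
        (hasDerivAt_iteratedDeriv hc n s))
    have h2 : HasDerivAt (fun s => 4 * s * iteratedDeriv (n + 2) c s +
        (4 * n + 2) * iteratedDeriv (n + 1) c s + iteratedDeriv n c s) 0 s :=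
      (hasDerivAt_const s (0 : ℝ)).congr_of_eventuallyEq
        ((eventually_gt_nhds hs).mono fun t ht => ih t ht)
    have := h1.unique h2
    push_cast
    rw [show n + 1 + 2 = n + 3 by omega, show n + 1 + 1 = n + 2 by omega]
    linarith

/-- An energy argument: with c_n the n-th derivative, the quantity 4s c_{n+1}² + c_n² has derivative
-8n c_{n+1}² ≤ 0 by the differential equation. It is thus at most its value c_n(0)² at s = 0. -/
theorem abs_iteratedDeriv_le_of_comp_sq_eq_cos (hc : ContDiff ℝ ∞ c)
    (hcos : ∀ x, c (x ^ 2) = Real.cos x) (n : ℕ) {s : ℝ} (hs : 0 ≤ s) :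
    |iteratedDeriv n c s| ≤ |iteratedDeriv n c 0| := by
  let e : ℝ → ℝ := fun s => 4 * s * iteratedDeriv (n + 1) c s ^ 2 + iteratedDeriv n c s ^ 2
  have hd : ∀ s, HasDerivAt e (4 * 1 * iteratedDeriv (n + 1) c s ^ 2 +
      4 * s * ((2 : ℕ) * iteratedDeriv (n + 1) c s ^ (2 - 1) * iteratedDeriv (n + 2) c s) +
      (2 : ℕ) * iteratedDeriv n c s ^ (2 - 1) * iteratedDeriv (n + 1) c s) s := fun s =>
    ((((hasDerivAt_id s).const_mul 4).mul ((hasDerivAt_iteratedDeriv hc (n + 1) s).pow 2)).add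
      ((hasDerivAt_iteratedDeriv hc n s).pow 2))
  have hanti : AntitoneOn e (Ici 0) := by
    refine antitoneOn_of_deriv_nonpos (convex_Ici 0)
      (fun s _ => (hd s).continuousAt.continuousWithinAt)
      (fun s _ => (hd s).differentiableAt.differentiableWithinAt) fun s hs => ?_
    rw [interior_Ici] at hs
    have h := ode_of_comp_sq_eq_cos hc hcos n s hs
    rw [(hd s).deriv]
    have h2 : iteratedDeriv n c s = -(4 * s * iteratedDeriv (n + 2) c s +
      (4 * n + 2) * iteratedDeriv (n + 1) c s) := by linarith
    rw [h2]
    have : 0 ≤ (n : ℝ) * iteratedDeriv (n + 1) c s ^ 2 := by positivity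
    norm_num
    nlinarith
  have h1 := hanti (mem_Ici.2 le_rfl) (mem_Ici.2 hs) hs
  simp only [e, mul_zero, zero_mul, zero_add] at h1
  refine sq_le_sq.1 (le_trans ?_ h1)
  have : 0 ≤ 4 * s * iteratedDeriv (n + 1) c s ^ 2 := by positivity
  linarith

end SqrtCos

/-- On s < 0 the entire function cos √s is cosh √(-s), which is unbounded. Only s = x² ≥ 0 matters,
so it is cut off to vanish for s < -2 while remaining unchanged for s > -1. The companion for the
sine is S = -2C', obtained by differentiating C(x²) = cos x. -/
theorem exists_hasBoundedDerivs_comp_sq :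
    ∃ C S : ℝ → ℝ, HasBoundedDerivs C ∧ HasBoundedDerivs S ∧
      (∀ x, C (x ^ 2) = Real.cos x) ∧ ∀ x, x * S (x ^ 2) = Real.sin x := by
  obtain ⟨c, hc, hcos⟩ := exists_contDiff_comp_sq_eq_cos
  let C : ℝ → ℝ := fun s => Real.smoothTransition (s + 2) * c s
  have hC : ContDiff ℝ ∞ C :=
    (Real.smoothTransition.contDiff.comp (contDiff_id.add contDiff_const)).mul hc
  have heq : ∀ s, -1 < s → C =ᶠ[𝓝 s] c := fun s hs =>
    (eventually_gt_nhds hs).mono fun t ht => by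
      simp [C, Real.smoothTransition.one_of_one_le (by linarith : 1 ≤ t + 2)]
  have hCcos : ∀ x, C (x ^ 2) = Real.cos x := fun x => by
    rw [← hcos]; exact (heq (x ^ 2) (by nlinarith [sq_nonneg x])).self_of_nhds
  have hCb : HasBoundedDerivs C := by
    refine (hasBoundedDerivs_iff_iteratedDeriv hC).2 fun n => ?_
    obtain ⟨B, hB⟩ := (isCompact_Icc (a := (-2 : ℝ)) (b := 0)).exists_bound_of_continuousOn
      (hC.continuous_iteratedDeriv n (mod_cast le_top)).continuousOn
    refine ⟨max B |iteratedDeriv n c 0|, fun s => ?_⟩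
    rcases le_or_gt 0 s with h0 | h0
    · rw [(heq s (by linarith)).iteratedDeriv_eq n]
      exact (abs_iteratedDeriv_le_of_comp_sq_eq_cos hc hcos n h0).trans (le_max_right _ _)
    · rcases lt_or_ge s (-2) with h2 | h2
      · have : C =ᶠ[𝓝 s] fun _ => 0 := (eventually_lt_nhds h2).mono fun t ht => by
          simp [C, Real.smoothTransition.zero_of_nonpos (by linarith : t + 2 ≤ 0)]
        rw [this.iteratedDeriv_eq n, iteratedDeriv_const]
        simp only [ite_self, abs_zero]
        exact le_max_of_le_right (abs_nonneg _)
      · exact (hB s ⟨h2, h0.le⟩).trans (le_max_left _ _)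
  refine ⟨C, fun s => -2 * deriv C s, hCb, ?_, hCcos,
    fun x => mul_deriv_sq_of_comp_sq_eq_cos hC hCcos x⟩
  have hC' : ContDiff ℝ ∞ (deriv C) := (contDiff_infty_iff_deriv.1 hC).2
  refine (hasBoundedDerivs_iff_iteratedDeriv (contDiff_const.mul hC')).2 fun n => ?_
  obtain ⟨B, hB⟩ := (hasBoundedDerivs_iff_iteratedDeriv hC).1 hCb (n + 1)
  refine ⟨2 * B, fun s => ?_⟩
  have : iteratedDeriv n (fun s => -2 * deriv C s) s = -2 * iteratedDeriv (n + 1) C s := by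
    rw [iteratedDeriv_succ', iteratedDeriv_const_mul_field]
  rw [this, abs_mul, abs_neg, abs_two]
  exact mul_le_mul_of_nonneg_left (hB s) zero_le_two

theorem abs_apply_le_norm {n : ℕ} (x : EuclideanSpace ℝ (Fin n)) (i : Fin n) : |x i| ≤ ‖x‖ := by
  simpa using PiLp.norm_apply_le x i

open MeasureTheory in
-- The second variable enters through (2πw₁)², so the linear maps in x grow only quadratically in
-- the frequency w, and the moments of φ absorb this growth.
theorem contDiff_integral_fourier_kernel {K : ℝ × ℝ → ℝ} (hK : HasBoundedDerivs K) {φ : E2 → ℝ}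
    (hφc : Continuous φ) (hφ : ∀ n : ℕ, Integrable fun w => ‖w‖ ^ n * ‖φ w‖) :
    ContDiff ℝ ∞ fun x : E2 =>
      ∫ w : E2, φ w • K (2 * Real.pi * w 0 * x 0, (2 * Real.pi * w 1) ^ 2 * x 1) := by
  let p : Fin 2 → E2 →L[ℝ] ℝ := fun i => EuclideanSpace.proj i
  let L : E2 → E2 →L[ℝ] ℝ × ℝ := fun w =>
    ((2 * Real.pi * w 0) • p 0).prod ((2 * Real.pi * w 1) ^ 2 • p 1)
  have hL : Continuous L := by
    have h1 : Continuous fun w : E2 => (2 * Real.pi * w 0) • p 0 := by fun_prop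
    have h2 : Continuous fun w : E2 => (2 * Real.pi * w 1) ^ 2 • p 1 := by fun_prop
    exact (ContinuousLinearMap.prodₗᵢ ℝ (𝕜 := ℝ) (E := E2) (F := ℝ) (G := ℝ)).continuous.comp
      (h1.prodMk h2)
  set M : ℝ := ‖p 0‖ + ‖p 1‖ with hM
  have hM0 : 0 ≤ M := by positivity
  set D : ℝ := (2 * Real.pi + (2 * Real.pi) ^ 2) * M with hD
  have hπ : 0 < 2 * Real.pi := Real.two_pi_pos
  have hLn : ∀ w, ‖L w‖ ≤ D * (1 + ‖w‖ ^ 2) := by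
    intro w
    have h0 := abs_apply_le_norm w 0
    have h1 := abs_apply_le_norm w 1
    rw [ContinuousLinearMap.opNorm_prod, Prod.norm_def]
    simp only [norm_smul, norm_pow, norm_mul, Real.norm_eq_abs, abs_of_pos Real.pi_pos, abs_two]
    refine max_le ?_ ?_
    · calc 2 * Real.pi * |w 0| * ‖p 0‖ ≤ 2 * Real.pi * (1 + ‖w‖ ^ 2) * M := by
            gcongr
            · nlinarith [sq_nonneg (‖w‖ - 1), norm_nonneg w]
            · rw [hM]; exact le_add_of_nonneg_right (norm_nonneg _)
        _ ≤ _ := by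
            rw [hD]
            have : 0 ≤ (2 * Real.pi) ^ 2 * M * (1 + ‖w‖ ^ 2) := by positivity
            nlinarith
    · calc (2 * Real.pi * |w 1|) ^ 2 * ‖p 1‖ ≤ (2 * Real.pi) ^ 2 * (1 + ‖w‖ ^ 2) * M := by
            rw [mul_pow]
            gcongr
            · nlinarith [abs_nonneg (w 1), norm_nonneg w]
            · rw [hM]; exact le_add_of_nonneg_left (norm_nonneg _)
        _ ≤ _ := by
            rw [hD]
            have : 0 ≤ (2 * Real.pi) * M * (1 + ‖w‖ ^ 2) := by positivity
            nlinarith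
  have hD0 : 0 ≤ D := by positivity
  refine contDiff_integral_smul_comp (L := L) hL hK.smooth hφc.aestronglyMeasurable (fun n => ?_)
    fun n R => ?_
  -- The dominating function comes from (1 + ‖w‖²)^n ≤ 2^(n-1) (1 + ‖w‖^(2n)); for n = 0 the
  -- truncated exponent is 0 and the bound still holds.
  · have hi : Integrable fun w : E2 => D ^ n * 2 ^ (n - 1) * (‖w‖ ^ 0 * ‖φ w‖ +
      ‖w‖ ^ (2 * n) * ‖φ w‖) := ((hφ 0).add (hφ (2 * n))).const_mul _
    refine hi.mono' ((hL.norm.pow n).mul hφc.norm).aestronglyMeasurable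
      (Eventually.of_forall fun w => ?_)
    rw [norm_mul, norm_pow, norm_norm, norm_norm]
    have h1 : (1 + ‖w‖ ^ 2) ^ n ≤ 2 ^ (n - 1) * (1 ^ n + (‖w‖ ^ 2) ^ n) :=
      add_pow_le zero_le_one (by positivity) n
    calc ‖L w‖ ^ n * ‖φ w‖ ≤ (D * (1 + ‖w‖ ^ 2)) ^ n * ‖φ w‖ := by gcongr; exact hLn w
      _ ≤ D ^ n * (2 ^ (n - 1) * (1 ^ n + (‖w‖ ^ 2) ^ n)) * ‖φ w‖ := by
          rw [mul_pow]; gcongr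
      _ = _ := by rw [one_pow, pow_zero, ← pow_mul]; ring
  · obtain ⟨C, hC⟩ := hK.bounded n
    exact ⟨C, Eventually.of_forall fun w x _ => hC _⟩

open MeasureTheory FourierTransform in
/-- Whitney's theorem on even functions, with a parameter, for a compactly supported function
split into its even and its odd part. -/
theorem exists_whitney_even_odd {h : E2 → ℝ} (hh : ContDiff ℝ ∞ h) (hc : HasCompactSupport h) :
    ∃ k l : E2 → ℝ, ContDiff ℝ ∞ k ∧ ContDiff ℝ ∞ l ∧
      ∀ x : E2, h x = k !₂[x 0, x 1 ^ 2] + x 1 * l !₂[x 0, x 1 ^ 2] := by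
  obtain ⟨C, S, hC, hS, hCc, hSs⟩ := exists_hasBoundedDerivs_comp_sq
  have hcc : HasCompactSupport fun x => (h x : ℂ) := hc.comp_left (g := ((↑) : ℝ → ℂ)) (by simp)
  let H : SchwartzMap E2 ℂ := hcc.toSchwartzMap (Complex.ofRealCLM.contDiff.comp hh)
  let G : SchwartzMap E2 ℂ := 𝓕 H
  have hinv : ∀ x, (h x : ℂ) = ∫ w : E2,
      Complex.exp ((↑(2 * Real.pi * inner ℝ w x) * Complex.I)) • G w := by
    intro x
    have h1 : (𝓕⁻ G : SchwartzMap E2 ℂ) = H := FourierTransform.fourierInv_fourier_eq H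
    have h2 : 𝓕⁻ (G : E2 → ℂ) x = H x := by rw [← SchwartzMap.fourierInv_coe, h1]
    rw [Real.fourierInv_eq'] at h2
    exact h2.symm
  let A : E2 → ℝ := fun w => (G w).re
  let B : E2 → ℝ := fun w => (G w).im
  have hGc := G.continuous
  have hAc : Continuous A := Complex.continuous_re.comp hGc
  have hBc : Continuous B := Complex.continuous_im.comp hGc
  have hA : ∀ n : ℕ, Integrable fun w => ‖w‖ ^ n * ‖A w‖ := fun n =>
    (G.integrable_pow_mul volume n).mono' (by fun_prop) (Eventually.of_forall fun w => by
      rw [norm_mul, norm_pow, norm_norm, norm_norm]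
      gcongr; exact Complex.abs_re_le_norm _)
  have hB : ∀ n : ℕ, Integrable fun w => ‖w‖ ^ n * ‖B w‖ := fun n =>
    (G.integrable_pow_mul volume n).mono' (by fun_prop) (Eventually.of_forall fun w => by
      rw [norm_mul, norm_pow, norm_norm, norm_norm]
      gcongr; exact Complex.abs_im_le_norm _)
  have hmul : ∀ φ : E2 → ℝ, Continuous φ → (∀ n : ℕ, Integrable fun w => ‖w‖ ^ n * ‖φ w‖) →
      ∀ n : ℕ, Integrable fun w => ‖w‖ ^ n * ‖2 * Real.pi * w 1 * φ w‖ := by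
    intro φ hφc hφ n
    refine ((hφ (n + 1)).const_mul (2 * Real.pi)).mono' (by fun_prop)
      (Eventually.of_forall fun w => ?_)
    have h1 := abs_apply_le_norm w 1
    simp only [norm_mul, norm_pow, Real.norm_eq_abs, abs_of_pos Real.pi_pos, abs_two,
      abs_norm, abs_abs]
    calc ‖w‖ ^ n * (2 * Real.pi * |w 1| * |φ w|) ≤ ‖w‖ ^ n * (2 * Real.pi * ‖w‖ * |φ w|) := by
          gcongr
      _ = _ := by ring
  have ker : ∀ f g : ℝ → ℝ, HasBoundedDerivs f → HasBoundedDerivs g →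
      HasBoundedDerivs fun p : ℝ × ℝ => f p.1 * g p.2 := fun f g hf hg =>
    (hf.comp_clm (ContinuousLinearMap.fst ℝ ℝ ℝ)).mul
      (hg.comp_clm (ContinuousLinearMap.snd ℝ ℝ ℝ))
  have bdd : ∀ (K : ℝ × ℝ → ℝ), HasBoundedDerivs K → ∀ φ : E2 → ℝ, Continuous φ →
      (∀ n : ℕ, Integrable fun w => ‖w‖ ^ n * ‖φ w‖) → ∀ x : E2,
      Integrable fun w : E2 =>
        φ w • K (2 * Real.pi * w 0 * x 0, (2 * Real.pi * w 1) ^ 2 * x 1) := by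
    intro K hK φ hφc hφ x
    obtain ⟨D, hD⟩ := hK.bounded 0
    have hKc := hK.smooth.continuous
    refine ((hφ 0).mul_const D).mono' (by fun_prop) (Eventually.of_forall fun w => ?_)
    rw [norm_smul, pow_zero, one_mul]
    gcongr
    simpa using hD (2 * Real.pi * w 0 * x 0, (2 * Real.pi * w 1) ^ 2 * x 1)
  have kcC := ker _ _ hasBoundedDerivs_cos hC
  have ksC := ker _ _ hasBoundedDerivs_sin hC
  have kcS := ker _ _ hasBoundedDerivs_cos hS
  have ksS := ker _ _ hasBoundedDerivs_sin hS
  have hA1c : Continuous fun w : E2 => 2 * Real.pi * w 1 * A w := by fun_prop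
  have hB1c : Continuous fun w : E2 => 2 * Real.pi * w 1 * B w := by fun_prop
  -- With α = 2πw₀x₀ and β = 2πw₁x₁, the real part of exp(i(α + β)) (A + iB) is A cos(α + β) - B
  -- sin(α + β). Expanding, and writing cos β = C(β²) and sin β = β S(β²), the terms in C form the
  -- even part k. Those in S carry the factor x₁ and the weight 2πw₁, and form l.
  refine ⟨_, _, (contDiff_integral_fourier_kernel kcC hAc hA).sub
    (contDiff_integral_fourier_kernel ksC hBc hB),
    ((contDiff_integral_fourier_kernel ksS hA1c (hmul A hAc hA)).add
    (contDiff_integral_fourier_kernel kcS hB1c (hmul B hBc hB))).neg, fun x => ?_⟩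
  set y : E2 := !₂[x 0, x 1 ^ 2] with hy
  have i1 := bdd _ kcC A hAc hA y
  have i2 := bdd _ ksC B hBc hB y
  have i3 := bdd _ ksS _ hA1c (hmul A hAc hA) y
  have i4 := bdd _ kcS _ hB1c (hmul B hBc hB) y
  have hre : h x = ∫ w : E2,
      (Complex.exp ((↑(2 * Real.pi * inner ℝ w x) * Complex.I)) • G w).re := by
    have hint : Integrable fun w : E2 =>
        Complex.exp ((↑(2 * Real.pi * inner ℝ w x) * Complex.I)) • G w := by
      refine (G.integrable (μ := volume)).norm.mono' (by fun_prop) (Eventually.of_forall fun w => ?_)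
      rw [norm_smul, Complex.norm_exp_ofReal_mul_I, one_mul]
    rw [← Complex.ofReal_re (h x), hinv x]
    exact (integral_re hint).symm
  rw [hre, ← integral_sub i1 i2, ← integral_add i3 i4, ← integral_neg, ← integral_const_mul]
  refine Eq.trans ?_ (integral_add (i1.sub i2) ((i3.add i4).neg.const_mul (x 1)))
  refine integral_congr_ae (Eventually.of_forall fun w => ?_)
  have hin : 2 * Real.pi * inner ℝ w x = 2 * Real.pi * w 0 * x 0 + 2 * Real.pi * w 1 * x 1 := by
    simp [PiLp.inner_apply, Fin.sum_univ_two]; ring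
  have hsq : (2 * Real.pi * w 1) ^ 2 * y 1 = (2 * Real.pi * w 1 * x 1) ^ 2 := by
    simp [hy]; ring
  have hy0 : y 0 = x 0 := by simp [hy]
  simp only [hin, hsq, hy0, hCc, smul_eq_mul, Complex.mul_re, Complex.exp_ofReal_mul_I_re,
    Complex.exp_ofReal_mul_I_im, Real.cos_add, Real.sin_add]
  rw [← hSs (2 * Real.pi * w 1 * x 1)]
  simp only [A, B]
  ring

/-! ### Germs of smooth maps and of diffeomorphisms -/

section SmoothNear

variable {V W X : Type*} [NormedAddCommGroup V] [NormedSpace ℝ V]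
  [NormedAddCommGroup W] [NormedSpace ℝ W] [NormedAddCommGroup X] [NormedSpace ℝ X]

/-- `f` is smooth on a neighbourhood of `x`. -/
def SmoothNear (f : V → W) (x : V) : Prop := ∀ᶠ y in 𝓝 x, ContDiffAt ℝ ∞ f y

theorem _root_.ContDiff.smoothNear {f : V → W} (hf : ContDiff ℝ ∞ f) (x : V) : SmoothNear f x :=
  Eventually.of_forall fun _ => hf.contDiffAt

namespace SmoothNear

variable {f g : V → W} {x : V}

theorem contDiffAt (hf : SmoothNear f x) : ContDiffAt ℝ ∞ f x := hf.self_of_nhds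

theorem differentiableAt (hf : SmoothNear f x) : DifferentiableAt ℝ f x :=
  hf.contDiffAt.differentiableAt (by simp)

theorem continuousAt (hf : SmoothNear f x) : ContinuousAt f x := hf.contDiffAt.continuousAt

theorem eventually (hf : SmoothNear f x) : ∀ᶠ y in 𝓝 x, SmoothNear f y :=
  eventually_eventually_nhds.2 hf

theorem comp {h : W → X} (x : V) (hh : SmoothNear h (f x)) (hf : SmoothNear f x) :
    SmoothNear (fun y => h (f y)) x := by
  filter_upwards [hf, hf.continuousAt.eventually hh] with y hy hy'
  exact hy'.comp y hy

theorem fderiv (hf : SmoothNear f x) : SmoothNear (fderiv ℝ f) x :=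
  hf.mono fun _ hy => hy.fderiv_right (by simp)

theorem fderiv_apply (hf : SmoothNear f x) {v : V → V} (hv : SmoothNear v x) :
    SmoothNear (fun y => _root_.fderiv ℝ f y (v y)) x := by
  filter_upwards [hf.fderiv, hv] with y h1 h2
  exact h1.clm_apply h2

theorem add (hf : SmoothNear f x) (hg : SmoothNear g x) : SmoothNear (fun y => f y + g y) x := by
  filter_upwards [hf, hg] with y h1 h2 using h1.add h2

theorem sub (hf : SmoothNear f x) (hg : SmoothNear g x) : SmoothNear (fun y => f y - g y) x := by
  filter_upwards [hf, hg] with y h1 h2 using h1.sub h2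

theorem mul {f g : V → ℝ} (hf : SmoothNear f x) (hg : SmoothNear g x) :
    SmoothNear (fun y => f y * g y) x := by
  filter_upwards [hf, hg] with y h1 h2 using h1.mul h2

theorem pow {f : V → ℝ} (hf : SmoothNear f x) (n : ℕ) : SmoothNear (fun y => f y ^ n) x :=
  hf.mono fun _ h => h.pow n

theorem smul {c : V → ℝ} (hc : SmoothNear c x) (hf : SmoothNear f x) :
    SmoothNear (fun y => c y • f y) x := by
  filter_upwards [hc, hf] with y h1 h2 using h1.smul h2

theorem clm_apply {A : V → W →L[ℝ] X} (hA : SmoothNear A x) (hf : SmoothNear f x) :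
    SmoothNear (fun y => A y (f y)) x := by
  filter_upwards [hA, hf] with y h1 h2 using h1.clm_apply h2

theorem const (w : W) (x : V) : SmoothNear (fun _ : V => w) x := contDiff_const.smoothNear x

theorem id (x : V) : SmoothNear (fun y : V => y) x := contDiff_id.smoothNear x

end SmoothNear

theorem smoothNear_euclidean {n : ℕ} {f : V → EuclideanSpace ℝ (Fin n)} {x : V} :
    SmoothNear f x ↔ ∀ i, SmoothNear (fun y => f y i) x := by
  simp only [SmoothNear, contDiffAt_euclidean, eventually_all]

theorem smoothNear_coord {n : ℕ} (i : Fin n) (x : EuclideanSpace ℝ (Fin n)) :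
    SmoothNear (fun y : EuclideanSpace ℝ (Fin n) => y i) x :=
  smoothNear_euclidean.1 (SmoothNear.id x) i

theorem SmoothNear.vec2 {f g : V → ℝ} {x : V} (hf : SmoothNear f x) (hg : SmoothNear g x) :
    SmoothNear (fun y => (!₂[f y, g y] : E2)) x := by
  refine smoothNear_euclidean.2 fun i => ?_
  fin_cases i
  · exact hf
  · exact hg

theorem SmoothNear.vec3 {f g h : V → ℝ} {x : V} (hf : SmoothNear f x) (hg : SmoothNear g x)
    (hh : SmoothNear h x) : SmoothNear (fun y => (!₂[f y, g y, h y] : E3)) x := by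
  refine smoothNear_euclidean.2 fun i => ?_
  fin_cases i
  · exact hf
  · exact hg
  · exact hh

/-- A germ of a smooth function extends to a compactly supported smooth function. -/
theorem SmoothNear.exists_hasCompactSupport [FiniteDimensional ℝ V] {f : V → ℝ} {x : V}
    (hf : SmoothNear f x) :
    ∃ g : V → ℝ, ContDiff ℝ ∞ g ∧ HasCompactSupport g ∧ f =ᶠ[𝓝 x] g := by
  obtain ⟨r, hr, hball⟩ := Metric.eventually_nhds_iff_ball.1 hf
  let b : ContDiffBump x := ⟨r / 4, r / 2, by linarith, by linarith⟩
  refine ⟨fun y => b y * f y, contDiff_iff_contDiffAt.2 fun y => ?_, b.hasCompactSupport.mul_right,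
    ?_⟩
  · by_cases hy : y ∈ Metric.ball x r
    · exact b.contDiffAt.mul (hball y hy)
    · have hy' : y ∉ tsupport b := by
        rw [b.tsupport_eq]
        simp only [Metric.mem_ball, not_lt, Metric.mem_closedBall, not_le] at hy ⊢
        change r / 2 < _
        linarith
      have h0 : (fun y => b y * f y) =ᶠ[𝓝 y] fun _ => 0 := by
        filter_upwards [(notMem_tsupport_iff_eventuallyEq.1 hy')] with z hz
        rw [hz]; simp
      exact contDiffAt_const.congr_of_eventuallyEq h0
  · filter_upwards [b.eventuallyEq_one] with y hy
    simp [hy]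

end SmoothNear

/-! ### Local diffeomorphisms of a normed space -/

section LocalDiffeo

variable {E : Type*} [NormedAddCommGroup E] [NormedSpace ℝ E]

theorem IsLocalDiffeomorphAt.smoothNear {φ : E → E} {p : E}
    (h : IsLocalDiffeomorphAt 𝓘(ℝ, E) 𝓘(ℝ, E) ∞ φ p) : SmoothNear φ p := by
  obtain ⟨Ψ, hp, heq⟩ := h
  have h1 : ContDiffOn ℝ ∞ Ψ Ψ.source := contMDiffOn_iff_contDiffOn.1 Ψ.contMDiffOn_toFun
  filter_upwards [Ψ.open_source.mem_nhds hp] with y hy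
  exact (h1.congr heq).contDiffAt (Ψ.open_source.mem_nhds hy)

theorem IsLocalDiffeomorphAt.exists_inverse {φ : E → E} {p : E}
    (h : IsLocalDiffeomorphAt 𝓘(ℝ, E) 𝓘(ℝ, E) ∞ φ p) :
    ∃ ψ : E → E, IsLocalDiffeomorphAt 𝓘(ℝ, E) 𝓘(ℝ, E) ∞ ψ (φ p) ∧ ψ (φ p) = p ∧
      (∀ᶠ x in 𝓝 p, ψ (φ x) = x) ∧ ∀ᶠ y in 𝓝 (φ p), φ (ψ y) = y :=
  ⟨h.localInverse, h.localInverse_isLocalDiffeomorphAt,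
    h.localInverse_left_inv h.localInverse_mem_target, h.localInverse_eventuallyEq_left,
    h.localInverse_eventuallyEq_right⟩

theorem fderiv_comp_inverse {W X : Type*} [NormedAddCommGroup W] [NormedSpace ℝ W]
    [NormedAddCommGroup X] [NormedSpace ℝ X] {φ : W → X} {ψ : X → W} {x : W}
    (hψ : DifferentiableAt ℝ ψ (φ x)) (hφ : DifferentiableAt ℝ φ x)
    (h : ∀ᶠ y in 𝓝 x, ψ (φ y) = y) (v : W) :
    fderiv ℝ ψ (φ x) (fderiv ℝ φ x v) = v := by
  have h1 := hψ.hasFDerivAt.comp x hφ.hasFDerivAt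
  have h2 : HasFDerivAt (ψ ∘ φ) (ContinuousLinearMap.id ℝ W) x :=
    (hasFDerivAt_id x).congr_of_eventuallyEq h
  exact DFunLike.congr_fun (h1.unique h2) v

theorem IsLocalDiffeomorphAt.eventually_fderiv_bijective {φ : E → E} {p : E}
    (h : IsLocalDiffeomorphAt 𝓘(ℝ, E) 𝓘(ℝ, E) ∞ φ p) :
    ∀ᶠ x in 𝓝 p, Function.Bijective (fderiv ℝ φ x) := by
  obtain ⟨ψ, hψ, hψp, hl, hr⟩ := IsLocalDiffeomorphAt.exists_inverse h
  have hφs := IsLocalDiffeomorphAt.smoothNear h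
  have hψs := IsLocalDiffeomorphAt.smoothNear hψ
  filter_upwards [hφs.eventually, hφs.continuousAt.eventually hψs.eventually,
    eventually_eventually_nhds.2 hl,
    hφs.continuousAt.eventually (eventually_eventually_nhds.2 hr)] with x h1 h2 h3 h4
  refine ⟨Function.LeftInverse.injective
    (fderiv_comp_inverse h2.differentiableAt h1.differentiableAt h3), ?_⟩
  have hx : ψ (φ x) = x := h3.self_of_nhds
  have := fderiv_comp_inverse (φ := ψ) (ψ := φ) (x := φ x) (by rw [hx]; exact h1.differentiableAt)
    h2.differentiableAt h4
  rw [hx] at this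
  exact Function.RightInverse.surjective this

/-- The inverse function theorem. -/
theorem isLocalDiffeomorphAt_of_injective_fderiv [FiniteDimensional ℝ E] {φ : E → E} {p : E}
    (hφ : SmoothNear φ p) (hinj : Function.Injective (fderiv ℝ φ p)) :
    IsLocalDiffeomorphAt 𝓘(ℝ, E) 𝓘(ℝ, E) ∞ φ p := by
  have : CompleteSpace E := FiniteDimensional.complete ℝ E
  let A : E ≃L[ℝ] E :=
    (LinearEquiv.ofInjectiveEndo (fderiv ℝ φ p).toLinearMap hinj).toContinuousLinearEquiv
  have hA : (A : E →L[ℝ] E) = fderiv ℝ φ p := by ext v; rfl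
  have hd : HasFDerivAt φ (A : E →L[ℝ] E) p := by
    rw [hA]; exact hφ.differentiableAt.hasFDerivAt
  let e := hφ.contDiffAt.toOpenPartialHomeomorph φ hd (by simp)
  -- The source must shrink to an open set on which φ is smooth with invertible derivative, so that
  -- the inverse is smooth on the whole target and not only at φ(p).
  have hev : ∀ᶠ x in 𝓝 p, ContDiffAt ℝ ∞ φ x ∧ ∃ B : E ≃L[ℝ] E, (B : E →L[ℝ] E) = fderiv ℝ φ x :=
    hφ.and (hφ.fderiv.continuousAt.eventually (by rw [← hA]; exact ContinuousLinearEquiv.nhds A))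
  obtain ⟨S, hS, hSo, hpS⟩ := eventually_nhds_iff.1 hev
  let e' := e.restrOpen S hSo
  have hsrc : e'.source = e.source ∩ S := e.restrOpen_source S hSo
  refine ⟨⟨e'.toPartialEquiv, e'.open_source, e'.open_target, ?_, ?_⟩, ?_, fun x _ => rfl⟩
  · refine contMDiffOn_iff_contDiffOn.2 fun x hx => ?_
    rw [hsrc] at hx
    exact (hS x hx.2).1.contDiffWithinAt
  · refine contMDiffOn_iff_contDiffOn.2 fun y hy => ?_
    have hx := e'.map_target hy
    rw [hsrc] at hx
    obtain ⟨h1, B, hB⟩ := hS _ hx.2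
    refine (e'.contDiffAt_symm (f₀' := B) hy ?_ h1).contDiffWithinAt
    rw [hB]
    exact (h1.differentiableAt (by simp)).hasFDerivAt
  · change p ∈ e'.source
    rw [hsrc]
    exact ⟨hφ.contDiffAt.mem_toOpenPartialHomeomorph_source hd (by simp), hpS⟩

theorem isLocalDiffeomorphAt_id {M : Type*} [TopologicalSpace M] {n : ℕ}
    [ChartedSpace (EuclideanSpace ℝ (Fin n)) M] (x : M) :
    IsLocalDiffeomorphAt (𝓡 n) (𝓡 n) ∞ (id : M → M) x :=
  (Diffeomorph.refl (𝓡 n) M ∞).isLocalDiffeomorph x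

end LocalDiffeo

/-! ### Composition of 𝒜-equivalences -/

section AEquivalence

variable {N N' N'' : Type*} [TopologicalSpace N] [ChartedSpace E3 N]
  [TopologicalSpace N'] [ChartedSpace E3 N'] [TopologicalSpace N''] [ChartedSpace E3 N'']

theorem AEquivalentAt.trans {f : E2 → N} {g : E2 → N'} {h : E2 → N''} {p q r : E2}
    (hfg : AEquivalentAt f p g q) (hgh : AEquivalentAt g q h r) : AEquivalentAt f p h r := by
  obtain ⟨φ, Φ, hφ, hφp, hΦ, hΦp, heq⟩ := hfg
  obtain ⟨φ', Φ', hφ', hφp', hΦ', hΦp', heq'⟩ := hgh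
  have hc : ContinuousAt φ p := hφ.contMDiffAt.continuousAt
  refine ⟨φ' ∘ φ, Φ' ∘ Φ, hφ.comp (𝓡 2) E2 (hφp ▸ hφ'), by simp [hφp, hφp'], hΦ.comp (𝓡 3) N'' (hΦp ▸ hΦ'),
    by simp [hΦp, hΦp'], ?_⟩
  filter_upwards [heq, hc.eventually (hφp ▸ heq')] with x h1 h2
  simp [h2, h1]

theorem aEquivalentAt_of_target {f : E2 → N} {g : E2 → N'} {p : E2} {Φ : N → N'}
    (hΦ : IsLocalDiffeomorphAt (𝓡 3) (𝓡 3) ∞ Φ (f p)) (h : ∀ᶠ x in 𝓝 p, g x = Φ (f x)) :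
    AEquivalentAt f p g p :=
  ⟨id, Φ, isLocalDiffeomorphAt_id p, rfl, hΦ, h.self_of_nhds.symm, h⟩

theorem aEquivalentAt_comp {f : E2 → N} {θ : E2 → E2} {q : E2}
    (hθ : IsLocalDiffeomorphAt (𝓡 2) (𝓡 2) ∞ θ q) :
    AEquivalentAt f (θ q) (fun x => f (θ x)) q := by
  obtain ⟨ψ, hψ, hψp, -, hr⟩ := IsLocalDiffeomorphAt.exists_inverse hθ
  exact ⟨ψ, id, hψ, hψp, isLocalDiffeomorphAt_id _, rfl, by
    filter_upwards [hr] with x hx; simp [hx]⟩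

end AEquivalence

/-! ### Normal forms -/

section Components

variable {V : Type*} [NormedAddCommGroup V] [NormedSpace ℝ V]

theorem fderiv_apply_coord {n : ℕ} {f : V → EuclideanSpace ℝ (Fin n)} {x : V}
    (hf : DifferentiableAt ℝ f x) (v : V) (i : Fin n) :
    fderiv ℝ (fun y => f y i) x v = fderiv ℝ f x v i := by
  have h := (EuclideanSpace.proj (𝕜 := ℝ) i).hasFDerivAt.comp x hf.hasFDerivAt
  exact DFunLike.congr_fun h.fderiv v

theorem fderiv_coord {n : ℕ} (i : Fin n) (x v : EuclideanSpace ℝ (Fin n)) :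
    fderiv ℝ (fun y : EuclideanSpace ℝ (Fin n) => y i) x v = v i := by
  rw [fderiv_apply_coord (f := fun y => y) differentiableAt_id]
  simp

theorem differentiableAt_coord {n : ℕ} (i : Fin n) (x : EuclideanSpace ℝ (Fin n)) :
    DifferentiableAt ℝ (fun y : EuclideanSpace ℝ (Fin n) => y i) x :=
  (smoothNear_coord i x).differentiableAt

theorem differentiableAt_vec2 {f g : V → ℝ} {x : V} (hf : DifferentiableAt ℝ f x)
    (hg : DifferentiableAt ℝ g x) : DifferentiableAt ℝ (fun y => (!₂[f y, g y] : E2)) x := by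
  refine differentiableAt_euclidean.2 fun i => ?_
  fin_cases i
  · exact hf
  · exact hg

theorem fderiv_vec2 {f g : V → ℝ} {x : V} (hf : DifferentiableAt ℝ f x)
    (hg : DifferentiableAt ℝ g x) (v : V) :
    fderiv ℝ (fun y => (!₂[f y, g y] : E2)) x v = !₂[fderiv ℝ f x v, fderiv ℝ g x v] := by
  ext i
  rw [← fderiv_apply_coord (differentiableAt_vec2 hf hg)]
  fin_cases i <;> rfl

theorem differentiableAt_vec3 {f g h : V → ℝ} {x : V} (hf : DifferentiableAt ℝ f x)
    (hg : DifferentiableAt ℝ g x) (hh : DifferentiableAt ℝ h x) :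
    DifferentiableAt ℝ (fun y => (!₂[f y, g y, h y] : E3)) x := by
  refine differentiableAt_euclidean.2 fun i => ?_
  fin_cases i
  · exact hf
  · exact hg
  · exact hh

theorem fderiv_vec3 {f g h : V → ℝ} {x : V} (hf : DifferentiableAt ℝ f x)
    (hg : DifferentiableAt ℝ g x) (hh : DifferentiableAt ℝ h x) (v : V) :
    fderiv ℝ (fun y => (!₂[f y, g y, h y] : E3)) x v =
      !₂[fderiv ℝ f x v, fderiv ℝ g x v, fderiv ℝ h x v] := by
  ext i
  rw [← fderiv_apply_coord (differentiableAt_vec3 hf hg hh)]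
  fin_cases i <;> rfl

theorem fderiv_mul_apply {f g : V → ℝ} {x : V} (hf : DifferentiableAt ℝ f x)
    (hg : DifferentiableAt ℝ g x) (v : V) :
    fderiv ℝ (fun y => f y * g y) x v = f x * fderiv ℝ g x v + g x * fderiv ℝ f x v := by
  rw [fderiv_fun_mul hf hg]; simp

theorem fderiv_pow_apply {f : V → ℝ} {x : V} (hf : DifferentiableAt ℝ f x) (n : ℕ) (v : V) :
    fderiv ℝ (fun y => f y ^ n) x v = n * f x ^ (n - 1) * fderiv ℝ f x v := by
  rw [(hf.hasFDerivAt.pow n).fderiv]; simp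

theorem differentiableAt_comp {W X : Type*} [NormedAddCommGroup W] [NormedSpace ℝ W]
    [NormedAddCommGroup X] [NormedSpace ℝ X] {g : W → X} {f : V → W} {x : V}
    (hg : DifferentiableAt ℝ g (f x)) (hf : DifferentiableAt ℝ f x) :
    DifferentiableAt ℝ (fun y => g (f y)) x := hg.comp x hf

theorem fderiv_comp_apply {W X : Type*} [NormedAddCommGroup W] [NormedSpace ℝ W]
    [NormedAddCommGroup X] [NormedSpace ℝ X] {g : W → X} {f : V → W} {x : V}
    (hg : DifferentiableAt ℝ g (f x)) (hf : DifferentiableAt ℝ f x) (v : V) :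
    fderiv ℝ (fun y => g (f y)) x v = fderiv ℝ g (f x) (fderiv ℝ f x v) :=
  DFunLike.congr_fun (fderiv_comp x hg hf) v

end Components

/-- The fold `(u, v) ↦ (u, v²)`. -/
def fold (x : E2) : E2 := !₂[x 0, x 1 ^ 2]

theorem contDiff_fold : ContDiff ℝ ∞ fold :=
  contDiff_iff_contDiffAt.2 fun x =>
    ((smoothNear_coord 0 x).vec2 ((smoothNear_coord 1 x).pow 2)).contDiffAt

theorem fderiv_fold (x v : E2) : fderiv ℝ fold x v = !₂[v 0, 2 * x 1 * v 1] := by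
  have h1 := differentiableAt_coord (0 : Fin 2) x
  have h2 := differentiableAt_coord (1 : Fin 2) x
  unfold fold
  rw [fderiv_vec2 h1 (h2.fun_pow 2), fderiv_pow_apply h2, fderiv_coord, fderiv_coord]
  simp

@[simp]
theorem fold_zero : fold 0 = 0 := by
  ext i; fin_cases i <;> simp [fold]

/-- The map `(u, v) ↦ (u, v², v³ b(u, v²))`. -/
def cuspidalForm (b : E2 → ℝ) (x : E2) : E3 := !₂[x 0, x 1 ^ 2, x 1 ^ 3 * b (fold x)]

theorem fCCR_eq_cuspidalForm : fCCR = cuspidalForm fun y => y 0 := by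
  funext x
  simp [fCCR, cuspidalForm, fold, mul_comm]

theorem contDiff_cuspidalForm {b : E2 → ℝ} (hb : ContDiff ℝ ∞ b) :
    ContDiff ℝ ∞ (cuspidalForm b) :=
  contDiff_iff_contDiffAt.2 fun x =>
    (SmoothNear.vec3 (smoothNear_coord 0 x) ((smoothNear_coord 1 x).pow 2)
      (((smoothNear_coord 1 x).pow 3).mul ((hb.comp contDiff_fold).smoothNear x))).contDiffAt

theorem fderiv_cuspidalForm {b : E2 → ℝ} (hb : ContDiff ℝ ∞ b) (x v : E2) :
    fderiv ℝ (cuspidalForm b) x v = !₂[v 0, 2 * x 1 * v 1,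
      x 1 ^ 3 * fderiv ℝ b (fold x) (fderiv ℝ fold x v) + b (fold x) * (3 * x 1 ^ 2 * v 1)] := by
  have h1 := differentiableAt_coord (0 : Fin 2) x
  have h2 := differentiableAt_coord (1 : Fin 2) x
  have hb' := hb.differentiable (by simp)
  have hf := contDiff_fold.differentiable (by simp)
  unfold cuspidalForm
  rw [fderiv_vec3 h1 (h2.fun_pow 2) ((h2.fun_pow 3).fun_mul (differentiableAt_comp (hb' _) (hf x))), fderiv_pow_apply h2,
    fderiv_mul_apply (h2.fun_pow 3) (differentiableAt_comp (hb' _) (hf x)), fderiv_comp_apply (hb' _) (hf x),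
    fderiv_pow_apply h2, fderiv_coord, fderiv_coord]
  simp

theorem E2_eq_zero {x : E2} (h0 : x 0 = 0) (h1 : x 1 = 0) : x = 0 := by
  ext i; fin_cases i
  · exact h0
  · exact h1

/-- The function b(u, v²) becomes the new first coordinate, in the source and in the target at once:
it depends only on the first two components of the image point, which are exactly u and v². Both
coordinate changes are local diffeomorphisms because b_u(0) ≠ 0. -/
theorem aEquivalentAt_fCCR_of_cuspidalForm {b : E2 → ℝ} (hb : ContDiff ℝ ∞ b) (hb0 : b 0 = 0)
    (hbu : fderiv ℝ b 0 (stdVec 0) ≠ 0) : AEquivalentAt (cuspidalForm b) 0 fCCR 0 := by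
  have hb' := hb.differentiable (by simp)
  have hf := contDiff_fold.differentiable (by simp)
  let φ : E2 → E2 := fun x => !₂[b (fold x), x 1]
  let Φ : E3 → E3 := fun y => !₂[b !₂[y 0, y 1], y 1, y 2]
  have hstd : ∀ t : ℝ, fderiv ℝ b 0 !₂[t, 0] = t * fderiv ℝ b 0 (stdVec 0) := by
    intro t
    rw [← smul_eq_mul, ← map_smul]
    congr 1
    ext i; fin_cases i <;> simp [stdVec]
  have hφ : IsLocalDiffeomorphAt (𝓡 2) (𝓡 2) ∞ φ 0 := by
    refine isLocalDiffeomorphAt_of_injective_fderiv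
      (SmoothNear.vec2 ((hb.comp contDiff_fold).smoothNear 0) (smoothNear_coord 1 0)) ?_
    refine (injective_iff_map_eq_zero _).2 fun v hv => ?_
    simp only [φ] at hv
    rw [fderiv_vec2 (differentiableAt_comp (hb' _) (hf 0)) (differentiableAt_coord 1 0),
      fderiv_comp_apply (hb' _) (hf 0), fderiv_fold, fderiv_coord, fold_zero] at hv
    have h1 : v 1 = 0 := by simpa using congrArg (fun w : E2 => w 1) hv
    have h0 := congrArg (fun w : E2 => w 0) hv
    simp only [PiLp.zero_apply, mul_zero, zero_mul, hstd] at h0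
    have h0' : v 0 * fderiv ℝ b 0 (stdVec 0) = 0 := by simpa using h0
    exact E2_eq_zero ((mul_eq_zero.1 h0').resolve_right hbu) h1
  have hΦ : IsLocalDiffeomorphAt (𝓡 3) (𝓡 3) ∞ Φ (cuspidalForm b 0) := by
    have hz : cuspidalForm b 0 = 0 := by ext i; fin_cases i <;> simp [cuspidalForm]
    rw [hz]
    have hs : SmoothNear (fun y : E3 => (!₂[y 0, y 1] : E2)) 0 :=
      (smoothNear_coord 0 0).vec2 (smoothNear_coord 1 0)
    have hz2 : (!₂[(0 : E3) 0, (0 : E3) 1] : E2) = 0 := by ext i; fin_cases i <;> simp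
    refine isLocalDiffeomorphAt_of_injective_fderiv
      (SmoothNear.vec3 (SmoothNear.comp (0 : E3) (hb.smoothNear _) hs) (smoothNear_coord 1 0)
        (smoothNear_coord 2 0)) ?_
    refine (injective_iff_map_eq_zero _).2 fun v hv => ?_
    simp only [Φ] at hv
    rw [fderiv_vec3 (differentiableAt_comp (hb' _) hs.differentiableAt) (differentiableAt_coord 1 0)
      (differentiableAt_coord 2 0), fderiv_comp_apply (hb' _) hs.differentiableAt,
      fderiv_vec2 (differentiableAt_coord 0 0) (differentiableAt_coord 1 0), fderiv_coord,
      fderiv_coord, fderiv_coord, hz2] at hv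
    have h1 : v 1 = 0 := by simpa using congrArg (fun w : E3 => w 1) hv
    have h2 : v 2 = 0 := by simpa using congrArg (fun w : E3 => w 2) hv
    have h0 := congrArg (fun w : E3 => w 0) hv
    simp only [h1, hstd] at h0
    have h0' : v 0 * fderiv ℝ b 0 (stdVec 0) = 0 := by simpa using h0
    ext i; fin_cases i
    · exact (mul_eq_zero.1 h0').resolve_right hbu
    · exact h1
    · exact h2
  refine ⟨φ, Φ, hφ, ?_, hΦ, ?_, Eventually.of_forall fun x => ?_⟩
  · ext i; fin_cases i <;> simp [φ, hb0]
  · ext i; fin_cases i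
    · have hz : (!₂[(0 : ℝ), 0] : E2) = 0 := by ext i; fin_cases i <;> simp
      simp [Φ, cuspidalForm, fCCR, hz, hb0]
    · simp [Φ, cuspidalForm, fCCR]
    · simp [Φ, cuspidalForm, fCCR]
  · ext i; fin_cases i
    · simp [φ, Φ, cuspidalForm, fCCR, fold]
    · simp [φ, Φ, cuspidalForm, fCCR, fold]
    · simp [φ, Φ, cuspidalForm, fCCR, fold, mul_comm]

/-- The projection of the plane to the first axis. -/
def axis (x : E2) : E2 := !₂[x 0, 0]

/-- Second order Taylor formula transversally to an axis consisting of critical points. -/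
theorem exists_hadamard_two {h : E2 → ℝ} (hh : SmoothNear h 0)
    (hv : ∀ᶠ x in 𝓝 (0 : E2), fderiv ℝ h (axis x) (stdVec 1) = 0) :
    ∃ h' R : E2 → ℝ, ContDiff ℝ ∞ h' ∧ ContDiff ℝ ∞ R ∧
      (∀ᶠ x in 𝓝 0, h x = h' (axis x) + x 1 ^ 2 * R x) ∧
      fderiv ℝ (fun x => fderiv ℝ h x (stdVec 1)) 0 (stdVec 1) = 2 * R 0 := by
  obtain ⟨h', hh', -, heq⟩ := hh.exists_hasCompactSupport
  let p : Fin 2 → E2 →L[ℝ] ℝ := fun i => EuclideanSpace.proj i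
  let P : E2 →L[ℝ] E2 := (p 0).smulRight (stdVec 0)
  let Q : E2 →L[ℝ] E2 := (p 1).smulRight (stdVec 1)
  have hP : ∀ x, P x = axis x := fun x => by
    ext i; fin_cases i <;> simp [P, p, axis, stdVec]
  have hPQ : ∀ x, P x + Q x = x := fun x => by
    ext i; fin_cases i <;> simp [P, Q, p, stdVec]
  have hp1 : ∀ x, p 1 x = x 1 := fun x => rfl
  obtain ⟨k, hk, hk'⟩ := exists_hadamard P Q (p 1) (stdVec 1) hPQ (fun x => rfl) hh'
  obtain ⟨R, hR, hR'⟩ := exists_hadamard P Q (p 1) (stdVec 1) hPQ (fun x => rfl) hk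
  have hP1 : P (stdVec 1) = 0 := by rw [hP]; ext i; fin_cases i <;> simp [axis, stdVec]
  have hs1 : (stdVec 1 : E2) 1 = 1 := by simp [stdVec]
  have hd : ∀ x, fderiv ℝ h' x (stdVec 1) = k x + x 1 * fderiv ℝ k x (stdVec 1) := by
    intro x
    have e : h' = fun x => h' (P x) + x 1 * k x := funext fun x => hk' x
    have d1 : DifferentiableAt ℝ (fun x => h' (P x)) x :=
      ((hh'.comp P.contDiff).differentiable (by simp)) x
    have d2 := differentiableAt_coord (1 : Fin 2) x
    have d3 : DifferentiableAt ℝ k x := hk.differentiable (by simp) x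
    have := congrArg (fun f => fderiv ℝ f x (stdVec 1)) e
    simp only at this
    rw [this, fderiv_fun_add d1 (d2.fun_mul d3), add_apply,
      fderiv_comp_apply (hh'.differentiable (by simp) _) P.differentiableAt, P.fderiv, hP1,
      fderiv_mul_apply d2 d3, fderiv_coord, hs1]
    simp; ring
  have hax : ContinuousAt axis 0 := by
    have : axis = P := funext fun x => (hP x).symm
    rw [this]; exact P.continuous.continuousAt
  have hax0 : axis 0 = 0 := by rw [← hP]; simp
  -- On the axis the quotient k equals ∂_v h, which vanishes there; so the second application of
  -- Hadamard's formula gives k = v R.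
  have hk0 : ∀ᶠ x in 𝓝 (0 : E2), k (axis x) = 0 := by
    have h1 := hax.eventually (hax0.symm ▸ heq.eventuallyEq_nhds)
    filter_upwards [h1, hv] with x hx hx'
    rw [hx.fderiv_eq, hd] at hx'
    simpa [axis] using hx'
  have hfin : ∀ᶠ x in 𝓝 (0 : E2), h x = h' (axis x) + x 1 ^ 2 * R x := by
    filter_upwards [heq, hk0] with x h1 h2
    rw [h1, hk' x, hR' x, hP, h2, hp1]; ring
  refine ⟨h', R, hh', hR, hfin, ?_⟩
  have e1 : (fun x => fderiv ℝ h x (stdVec 1)) =ᶠ[𝓝 0]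
      fun x => x 1 * R x + x 1 * fderiv ℝ k x (stdVec 1) := by
    filter_upwards [heq.eventuallyEq_nhds, hk0] with x hx hx'
    rw [hx.fderiv_eq, hd, hR' x, hP, hx', hp1, zero_add]
  have d2 := differentiableAt_coord (1 : Fin 2) 0
  have d3 : DifferentiableAt ℝ R 0 := hR.differentiable (by simp) 0
  have d4 : DifferentiableAt ℝ (fun x => fderiv ℝ k x (stdVec 1)) 0 :=
    (((hk.smoothNear 0).fderiv_apply (SmoothNear.const (stdVec 1) 0))).differentiableAt
  have hk1 : fderiv ℝ k 0 (stdVec 1) = R 0 := by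
    have e : k = fun x => k (P x) + x 1 * R x := funext fun x => hR' x
    have d1 : DifferentiableAt ℝ (fun x => k (P x)) 0 :=
      ((hk.comp P.contDiff).differentiable (by simp)) 0
    have := congrArg (fun f => fderiv ℝ f 0 (stdVec 1)) e
    simp only at this
    rw [this, fderiv_fun_add d1 (d2.fun_mul d3), add_apply,
      fderiv_comp_apply (hk.differentiable (by simp) _) P.differentiableAt, P.fderiv, hP1,
      fderiv_mul_apply d2 d3, fderiv_coord, hs1]
    simp
  rw [e1.fderiv_eq, fderiv_fun_add (d2.fun_mul d3) (d2.fun_mul d4), add_apply,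
    fderiv_mul_apply d2 d3, fderiv_mul_apply d2 d4, fderiv_coord, hs1, hk1]
  simp; ring

/-- A composite of two shears of `ℝ³`. -/
def shear (f g k : E2 → ℝ) (y : E3) : E3 :=
  !₂[y 0, y 1 - f !₂[y 0, 0],
    y 2 - g !₂[y 0, 0] - (y 1 - f !₂[y 0, 0]) * k !₂[y 0, y 1 - f !₂[y 0, 0]]]

/-- Shears of `ℝ³` are diffeomorphisms. -/
theorem isLocalDiffeomorphAt_shear {f g k : E2 → ℝ} (hf : ContDiff ℝ ∞ f) (hg : ContDiff ℝ ∞ g)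
    (hk : ContDiff ℝ ∞ k) (y : E3) :
    IsLocalDiffeomorphAt (𝓡 3) (𝓡 3) ∞ (shear f g k) y := by
  let Ψ : E3 → E3 := fun z =>
    !₂[z 0, z 1 + f !₂[z 0, 0], z 2 + g !₂[z 0, 0] + z 1 * k !₂[z 0, z 1]]
  have c := fun (i : Fin 3) (x : E3) => smoothNear_coord i x
  have ax : ∀ x : E3, SmoothNear (fun y : E3 => (!₂[y 0, 0] : E2)) x := fun x =>
    (c 0 x).vec2 (SmoothNear.const 0 x)
  have hfa : ∀ x : E3, SmoothNear (fun y : E3 => f !₂[y 0, 0]) x := fun x =>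
    SmoothNear.comp x (hf.smoothNear _) (ax x)
  have hga : ∀ x : E3, SmoothNear (fun y : E3 => g !₂[y 0, 0]) x := fun x =>
    SmoothNear.comp x (hg.smoothNear _) (ax x)
  let D : Diffeomorph (𝓡 3) (𝓡 3) E3 E3 ∞ :=
    { toFun := shear f g k
      invFun := Ψ
      left_inv := fun y => by ext i; fin_cases i <;> simp [Ψ, shear]; ring
      right_inv := fun y => by ext i; fin_cases i <;> simp [Ψ, shear]; ring
      contMDiff_toFun := by
        refine contMDiff_iff_contDiff.2 (contDiff_iff_contDiffAt.2 fun x => ?_)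
        refine (SmoothNear.vec3 (c 0 x) ((c 1 x).sub (hfa x))
          (((c 2 x).sub (hga x)).sub (((c 1 x).sub (hfa x)).mul ?_))).contDiffAt
        exact SmoothNear.comp x (hk.smoothNear _) ((c 0 x).vec2 ((c 1 x).sub (hfa x)))
      contMDiff_invFun := by
        refine contMDiff_iff_contDiff.2 (contDiff_iff_contDiffAt.2 fun x => ?_)
        refine (SmoothNear.vec3 (c 0 x) ((c 1 x).add (hfa x))
          (((c 2 x).add (hga x)).add ((c 1 x).mul ?_))).contDiffAt
        exact SmoothNear.comp x (hk.smoothNear _) ((c 0 x).vec2 (c 1 x)) }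
  exact D.isLocalDiffeomorph y

theorem SmoothNear.sqrt {V : Type*} [NormedAddCommGroup V] [NormedSpace ℝ V] {R : V → ℝ} {x : V}
    (hR : SmoothNear R x) (h : 0 < R x) : SmoothNear (fun y => √(R y)) x := by
  filter_upwards [hR, hR.continuousAt.eventually (eventually_gt_nhds h)] with y h1 h2
  exact h1.sqrt h2.ne'

theorem SmoothNear.div {V : Type*} [NormedAddCommGroup V] [NormedSpace ℝ V] {R S : V → ℝ} {x : V}
    (hS : SmoothNear S x) (hR : SmoothNear R x) (h : R x ≠ 0) :
    SmoothNear (fun y => S y / R y) x := by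
  filter_upwards [hS, hR, hR.continuousAt.eventually (eventually_ne_nhds h)] with y h1 h2 h3
  exact h1.div h2 h3

/-- Hadamard's formula gives second and third components f(u) + v²R and g(u) + v²S with R(0) > 0.
Replacing v by v√R and shearing off f and g leaves (u, v², v² s) with s = S/R in the new
coordinates. Whitney's splitting s = k(u, v²) + v l(u, v²) leaves v³ l after one more shear, since
v² k(u, v²) is a function of the first two components. -/
theorem exists_cuspidalForm_of_fold {H : E2 → E3} (hH : SmoothNear H 0)
    (hH0 : ∀ᶠ x in 𝓝 (0 : E2), H x 0 = x 0)
    (hv : ∀ᶠ x in 𝓝 (0 : E2), fderiv ℝ H (axis x) (stdVec 1) = 0)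
    (hpos : 0 < fderiv ℝ (fun x => fderiv ℝ H x (stdVec 1)) 0 (stdVec 1) 1) :
    ∃ b, ContDiff ℝ ∞ b ∧ AEquivalentAt H 0 (cuspidalForm b) 0 := by
  have hax : ContinuousAt axis 0 :=
    ((smoothNear_coord 0 0).vec2 (SmoothNear.const 0 0)).continuousAt
  have hax0 : axis 0 = 0 := by ext i; fin_cases i <;> simp [axis]
  have hHi : ∀ i, SmoothNear (fun x => H x i) 0 := smoothNear_euclidean.1 hH
  have hvi : ∀ i, ∀ᶠ x in 𝓝 (0 : E2), fderiv ℝ (fun x => H x i) (axis x) (stdVec 1) = 0 := by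
    intro i
    filter_upwards [hv, hax.eventually (hax0.symm ▸ hH.eventually)] with x h1 h2
    rw [fderiv_apply_coord h2.differentiableAt, h1]; rfl
  obtain ⟨f, R, hf, hR, hfR, hR0⟩ := exists_hadamard_two (hHi 1) (hvi 1)
  obtain ⟨g, S, hg, hS, hgS, -⟩ := exists_hadamard_two (hHi 2) (hvi 2)
  have hRpos : 0 < R 0 := by
    have h1 : (fun x => fderiv ℝ (fun x => H x 1) x (stdVec 1)) =ᶠ[𝓝 0]
        fun x => fderiv ℝ H x (stdVec 1) 1 := by
      filter_upwards [hH.eventually] with x h2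
      rw [fderiv_apply_coord h2.differentiableAt]
    rw [h1.fderiv_eq, fderiv_apply_coord (f := fun x => fderiv ℝ H x (stdVec 1))
      (hH.fderiv_apply (SmoothNear.const _ 0)).differentiableAt] at hR0
    linarith
  have hRs := hR.smoothNear 0
  have hsq := hRs.sqrt hRpos
  -- The new coordinate v√R has square v²R, and R(0) > 0 makes the change invertible at 0.
  let μ : E2 → E2 := fun x => !₂[x 0, x 1 * √(R x)]
  have hμ0 : μ 0 = 0 := by ext i; fin_cases i <;> simp [μ]
  have hμ : IsLocalDiffeomorphAt (𝓡 2) (𝓡 2) ∞ μ 0 := by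
    refine isLocalDiffeomorphAt_of_injective_fderiv
      ((smoothNear_coord 0 0).vec2 ((smoothNear_coord 1 0).mul hsq)) ?_
    refine (injective_iff_map_eq_zero _).2 fun v hv => ?_
    have d1 := differentiableAt_coord (0 : Fin 2) 0
    have d2 := differentiableAt_coord (1 : Fin 2) 0
    simp only [μ] at hv
    rw [fderiv_vec2 d1 (d2.fun_mul hsq.differentiableAt), fderiv_mul_apply d2 hsq.differentiableAt,
      fderiv_coord, fderiv_coord] at hv
    have h0 : v 0 = 0 := by simpa using congrArg (fun w : E2 => w 0) hv
    have h1 := congrArg (fun w : E2 => w 1) hv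
    simp [(Real.sqrt_pos.2 hRpos).ne'] at h1
    exact E2_eq_zero h0 h1
  obtain ⟨κ, hκ, hκμ, hl, -⟩ := IsLocalDiffeomorphAt.exists_inverse hμ
  rw [hμ0] at hκ hκμ
  have hquot : SmoothNear (fun x => S (κ x) / R (κ x)) 0 :=
    SmoothNear.comp (h := fun x => S x / R x) (0 : E2)
      (hκμ.symm ▸ (hS.smoothNear 0).div hRs hRpos.ne') (IsLocalDiffeomorphAt.smoothNear hκ)
  obtain ⟨s, hs, hsc, hseq⟩ := hquot.exists_hasCompactSupport
  obtain ⟨k, l, hk, hl', hkl⟩ := exists_whitney_even_odd hs hsc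
  have hμc : ContinuousAt μ 0 := (IsLocalDiffeomorphAt.smoothNear hμ).continuousAt
  have hRev : ∀ᶠ x in 𝓝 (0 : E2), 0 < R x :=
    hRs.continuousAt.eventually (eventually_gt_nhds hRpos)
  have hall : ∀ᶠ x in 𝓝 (0 : E2), cuspidalForm l (μ x) =
      (shear f g k) (H x) := by
    filter_upwards [hH0, hfR, hgS, hl, hμc.eventually (hμ0.symm ▸ hseq), hRev] with x h0 h1 h2 h3 h4 h5
    have hsq2 : √(R x) ^ 2 = R x := Real.sq_sqrt h5.le
    have hm1 : (μ x) 1 = x 1 * √(R x) := rfl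
    have hm1' : (μ x) 1 ^ 2 = x 1 ^ 2 * R x := by rw [hm1, mul_pow, hsq2]
    have hm0 : (μ x) 0 = x 0 := rfl
    have hfold : fold (μ x) = !₂[x 0, x 1 ^ 2 * R x] := by unfold fold; rw [hm0, hm1']
    have hy1 : H x 1 - f !₂[H x 0, 0] = x 1 ^ 2 * R x := by
      rw [h1, h0]; simp [axis]
    have hy2 : H x 2 - g !₂[H x 0, 0] = x 1 ^ 2 * S x := by
      rw [h2, h0]; simp [axis]
    have hw := hkl (μ x)
    rw [← h4, h3, hm0, hm1', hm1, div_eq_iff h5.ne'] at hw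
    unfold cuspidalForm shear
    rw [hy1, hy2, h0]
    rw [hfold, hm1', hm0, hm1, hw]
    congr 1
    ext i; fin_cases i
    · simp
    · simp
    · have : (x 1 * √(R x)) ^ 3 = x 1 ^ 3 * (R x * √(R x)) := by
        rw [mul_pow, pow_succ (√(R x)) 2, hsq2]
      simp [this]
      ring
  exact ⟨l, hl', μ, _, hμ, hμ0, isLocalDiffeomorphAt_shear hf hg hk _,
    (by simpa only [hμ0] using hall.self_of_nhds.symm), hall⟩

/-! ### Simple zeros -/

section SimpleZero

variable {V : Type*} [NormedAddCommGroup V] [NormedSpace ℝ V]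

/-- No differentiability of c is needed: c h - c(x) h is o(1) · O(y - x), because h vanishes at x.
-/
theorem hasFDerivAt_mul_of_continuousAt {c h : V → ℝ} {x : V} {L : V →L[ℝ] ℝ}
    (hc : ContinuousAt c x) (hh : HasFDerivAt h L x) (h0 : h x = 0) :
    HasFDerivAt (fun y => c y * h y) (c x • L) x := by
  have h1 : (fun y => h y) =O[𝓝 x] fun y => y - x := by
    simpa [h0] using hh.isBigO_sub
  have h2 : (fun y => c y - c x) =o[𝓝 x] fun _ => (1 : ℝ) := by
    rw [Asymptotics.isLittleO_one_iff]
    simpa using hc.tendsto.sub_const (c x)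
  have h3 : (fun y => (c y - c x) * h y) =o[𝓝 x] fun y => y - x := by
    have := h2.mul_isBigO h1.norm_right
    simp only [one_mul] at this
    exact this.of_norm_right
  have h4 : HasFDerivAt (fun y => c x * h y) (c x • L) x := hh.const_mul (c x)
  have h5 : HasFDerivAt (fun y => (c y - c x) * h y) (0 : V →L[ℝ] ℝ) x := by
    refine HasFDerivAt.of_isLittleO ?_
    simpa [h0] using h3
  have h6 := h5.fun_add h4
  simp only [zero_add] at h6
  convert! h6 using 2
  ring

theorem simpleZero_of_eventuallyEq_mul {c g h : V → ℝ} {x : V} (hc : ContinuousAt c x)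
    (hc0 : c x ≠ 0) (hg : ∀ᶠ y in 𝓝 x, g y = c y * h y) (h0 : h x = 0) (h1 : fderiv ℝ h x ≠ 0) :
    g x = 0 ∧ fderiv ℝ g x ≠ 0 := by
  have hd : DifferentiableAt ℝ h x := by
    by_contra hd
    exact h1 (fderiv_zero_of_not_differentiableAt hd)
  refine ⟨by rw [hg.self_of_nhds, h0, mul_zero], ?_⟩
  rw [((hasFDerivAt_mul_of_continuousAt hc hd.hasFDerivAt h0).congr_of_eventuallyEq hg).fderiv]
  exact smul_ne_zero hc0 h1

theorem simpleZero_iff_of_eventuallyEq_mul {c g h : V → ℝ} {x : V} (hc : ContinuousAt c x)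
    (hc0 : c x ≠ 0) (hg : ∀ᶠ y in 𝓝 x, g y = c y * h y) :
    (g x = 0 ∧ fderiv ℝ g x ≠ 0) ↔ (h x = 0 ∧ fderiv ℝ h x ≠ 0) := by
  refine ⟨fun H => ?_, fun H => simpleZero_of_eventuallyEq_mul hc hc0 hg H.1 H.2⟩
  refine simpleZero_of_eventuallyEq_mul (c := fun y => (c y)⁻¹) (hc.inv₀ hc0) (inv_ne_zero hc0) ?_
    H.1 H.2
  filter_upwards [hg, hc.eventually (eventually_ne_nhds hc0)] with y h1 h2
  rw [h1, inv_mul_cancel_left₀ h2]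

theorem fderiv_ne_zero_iff_deriv_ne_zero {f : ℝ → ℝ} {t : ℝ} :
    fderiv ℝ f t ≠ 0 ↔ deriv f t ≠ 0 := by
  rw [not_iff_not]
  constructor
  · intro h; rw [← fderiv_apply_one_eq_deriv, h]; rfl
  · intro h; ext; simp [h]

end SimpleZero

/-! ### Determinants -/

/-- The determinant of three vectors of `ℝ³`. -/
def det3 (a b c : E3) : ℝ :=
  a 0 * (b 1 * c 2 - b 2 * c 1) - a 1 * (b 0 * c 2 - b 2 * c 0) + a 2 * (b 0 * c 1 - b 1 * c 0)

theorem E3_eq_sum (x : E3) : x = x 0 • stdVec 0 + x 1 • stdVec 1 + x 2 • stdVec 2 := by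
  ext i; fin_cases i <;> simp [stdVec]

theorem E2_eq_sum (x : E2) : x = x 0 • stdVec 0 + x 1 • stdVec 1 := by
  ext i; fin_cases i <;> simp [stdVec]

theorem det3_map (A : E3 →L[ℝ] E3) (x y z : E3) : det3 (A x) (A y) (A z) =
    det3 (A (stdVec 0)) (A (stdVec 1)) (A (stdVec 2)) * det3 x y z := by
  have h : ∀ (w : E3) (i : Fin 3),
      A w i = w 0 * A (stdVec 0) i + w 1 * A (stdVec 1) i + w 2 * A (stdVec 2) i := by
    intro w i
    conv_lhs => rw [E3_eq_sum w]
    simp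
  simp only [det3, h x, h y, h z]
  ring

theorem det3_stdVec_ne_zero_of_leftInverse {A B : E3 →L[ℝ] E3} (h : ∀ x, B (A x) = x) :
    det3 (A (stdVec 0)) (A (stdVec 1)) (A (stdVec 2)) ≠ 0 := by
  intro h0
  have h1 := det3_map B (A (stdVec 0)) (A (stdVec 1)) (A (stdVec 2))
  rw [h0, mul_zero, h, h, h] at h1
  simp [det3, stdVec] at h1

theorem det3_map_plane (A : E2 →L[ℝ] E3) (v w : E2) (z : E3) : det3 (A v) (A w) z =
    (v 0 * w 1 - v 1 * w 0) * det3 (A (stdVec 0)) (A (stdVec 1)) z := by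
  have h : ∀ (w : E2) (i : Fin 3), A w i = w 0 * A (stdVec 0) i + w 1 * A (stdVec 1) i := by
    intro w i
    conv_lhs => rw [E2_eq_sum w]
    simp
  simp only [det3, h v, h w]
  ring

theorem fderiv_det3 {V : Type*} [NormedAddCommGroup V] [NormedSpace ℝ V] {a b c : V → E3} {x : V}
    (ha : DifferentiableAt ℝ a x) (hb : DifferentiableAt ℝ b x) (hc : DifferentiableAt ℝ c x)
    (v : V) : fderiv ℝ (fun y => det3 (a y) (b y) (c y)) x v =
      det3 (fderiv ℝ a x v) (b x) (c x) + det3 (a x) (fderiv ℝ b x v) (c x) +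
        det3 (a x) (b x) (fderiv ℝ c x v) := by
  have h : ∀ {f : V → E3}, DifferentiableAt ℝ f x → ∀ i, HasFDerivAt (fun y => f y i)
      ((EuclideanSpace.proj (𝕜 := ℝ) i).comp (fderiv ℝ f x)) x := fun hf i =>
    (EuclideanSpace.proj (𝕜 := ℝ) i).hasFDerivAt.comp x hf.hasFDerivAt
  have a0 := h ha 0
  have a1 := h ha 1
  have a2 := h ha 2
  have b0 := h hb 0
  have b1 := h hb 1
  have b2 := h hb 2
  have c0 := h hc 0
  have c1 := h hc 1
  have c2 := h hc 2
  have key := ((a0.fun_mul ((b1.fun_mul c2).fun_sub (b2.fun_mul c1))).fun_sub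
    (a1.fun_mul ((b0.fun_mul c2).fun_sub (b2.fun_mul c0)))).fun_add
    (a2.fun_mul ((b0.fun_mul c1).fun_sub (b1.fun_mul c0)))
  unfold det3
  rw [key.fderiv]
  simp
  ring

/-- The signed area density of a map with respect to a transversal vector field, in `ℝ³`. -/
def areaDensity (F X : E2 → E3) (q : E2) : ℝ :=
  det3 (fderiv ℝ F q (stdVec 0)) (fderiv ℝ F q (stdVec 1)) (X q)

theorem fderiv_areaDensity {F X : E2 → E3} {q : E2} (hF : SmoothNear F q) (hX : SmoothNear X q)
    (v : E2) : fderiv ℝ (areaDensity F X) q v =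
      det3 (fderiv ℝ (fun y => fderiv ℝ F y (stdVec 0)) q v) (fderiv ℝ F q (stdVec 1)) (X q) +
      det3 (fderiv ℝ F q (stdVec 0)) (fderiv ℝ (fun y => fderiv ℝ F y (stdVec 1)) q v) (X q) +
      det3 (fderiv ℝ F q (stdVec 0)) (fderiv ℝ F q (stdVec 1)) (fderiv ℝ X q v) :=
  fderiv_det3 (hF.fderiv_apply (SmoothNear.const _ q)).differentiableAt
    (hF.fderiv_apply (SmoothNear.const _ q)).differentiableAt hX.differentiableAt v

/-! ### Reduction of a non-degenerate singularity to the cuspidal form -/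

theorem continuousAt_axis : ContinuousAt axis 0 :=
  ((smoothNear_coord 0 0).vec2 (SmoothNear.const 0 0)).continuousAt

@[simp]
theorem axis_zero : axis 0 = 0 := by ext i; fin_cases i <;> simp [axis]

/-- As H_v vanishes along the axis, H_v(0) = H_uv(0) = 0, and the only surviving term of the
derivative of the density at 0 is a multiple of det(H_u, H_vv, Y). Non-degeneracy thus gives w =
H_vv(0) ≠ 0. Its first component is 0 because H₀ = u, so a rotation with scaling in the last two
coordinates makes its second component positive, as `exists_cuspidalForm_of_fold` requires. -/
theorem exists_cuspidalForm_of_axis {H Y : E2 → E3} (hH : SmoothNear H 0) (hY : SmoothNear Y 0)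
    (hH0 : ∀ᶠ x in 𝓝 (0 : E2), H x 0 = x 0)
    (hv : ∀ᶠ x in 𝓝 (0 : E2), fderiv ℝ H (axis x) (stdVec 1) = 0)
    (hdens : fderiv ℝ (areaDensity H Y) 0 ≠ 0) :
    ∃ b, ContDiff ℝ ∞ b ∧ AEquivalentAt H 0 (cuspidalForm b) 0 := by
  set w : E3 := fderiv ℝ (fun y => fderiv ℝ H y (stdVec 1)) 0 (stdVec 1) with hw
  have hdH : SmoothNear (fun y => fderiv ℝ H y (stdVec 1)) 0 :=
    hH.fderiv_apply (SmoothNear.const _ 0)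
  have hv0 : fderiv ℝ H 0 (stdVec 1) = 0 := by simpa using hv.self_of_nhds
  have hax : DifferentiableAt ℝ axis 0 :=
    ((smoothNear_coord 0 0).vec2 (SmoothNear.const 0 0)).differentiableAt
  have hax' : fderiv ℝ axis 0 (stdVec 0) = stdVec 0 := by
    unfold axis
    rw [fderiv_vec2 (differentiableAt_coord 0 0) (differentiableAt_const 0), fderiv_coord]
    ext i; fin_cases i <;> simp [stdVec]
  have hvu : fderiv ℝ (fun y => fderiv ℝ H y (stdVec 1)) 0 (stdVec 0) = 0 := by
    have h1 := fderiv_comp_apply (f := axis) (g := fun y => fderiv ℝ H y (stdVec 1)) (x := 0)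
      (by simpa using hdH.differentiableAt) hax (stdVec 0)
    rw [hax', axis_zero] at h1
    rw [← h1, EventuallyEq.fderiv_eq (hv : (fun x => fderiv ℝ H (axis x) (stdVec 1)) =ᶠ[𝓝 0] fun _ => (0 : E3))]
    simp
  have hw0 : w 0 = 0 := by
    have h1 : (fun y => fderiv ℝ H y (stdVec 1) 0) =ᶠ[𝓝 0] fun _ => (0 : ℝ) := by
      filter_upwards [hH.eventually, hH0.eventually_nhds] with y h1 h2
      rw [← fderiv_apply_coord h1.differentiableAt,
        EventuallyEq.fderiv_eq (h2 : _ =ᶠ[𝓝 y] fun x => x 0), fderiv_coord]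
      simp [stdVec]
    rw [hw, ← fderiv_apply_coord hdH.differentiableAt, h1.fderiv_eq]
    simp
  have hdet : ∀ a b : E3, det3 a 0 b = 0 := fun a b => by simp [det3]
  have hwne : w ≠ 0 := by
    intro h0
    refine hdens (ContinuousLinearMap.ext fun v => ?_)
    conv_lhs => rw [E2_eq_sum v]
    simp only [map_add, map_smul, fderiv_areaDensity hH hY, hv0, hvu, ← hw, h0]
    simp [hdet]
  -- In the last two coordinates this is multiplication by the conjugate of w₁ + i w₂; it sends w to
  -- (0, w₁² + w₂², 0).
  let A : E3 →L[ℝ] E3 := LinearMap.toContinuousLinearMap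
    { toFun := fun y => !₂[y 0, w 1 * y 1 + w 2 * y 2, -w 2 * y 1 + w 1 * y 2]
      map_add' := fun x y => by ext i; fin_cases i <;> simp <;> ring
      map_smul' := fun c x => by ext i; fin_cases i <;> simp <;> ring }
  have hA : ∀ y, A y = !₂[y 0, w 1 * y 1 + w 2 * y 2, -w 2 * y 1 + w 1 * y 2] := fun y => rfl
  have hpos : 0 < w 1 * w 1 + w 2 * w 2 := by
    rcases eq_or_ne (w 1) 0 with h1 | h1
    · rcases eq_or_ne (w 2) 0 with h2 | h2
      · refine absurd ?_ hwne
        ext i; fin_cases i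
        · exact hw0
        · exact h1
        · exact h2
      · have := mul_self_nonneg (w 1); have := mul_self_pos.2 h2; linarith
    · have := mul_self_nonneg (w 2); have := mul_self_pos.2 h1; linarith
  have hAinj : Function.Injective A := by
    refine (injective_iff_map_eq_zero _).2 fun y hy => ?_
    rw [hA] at hy
    have h0 : y 0 = 0 := by simpa using congrArg (fun z : E3 => z 0) hy
    have h1 : w 1 * y 1 + w 2 * y 2 = 0 := by simpa using congrArg (fun z : E3 => z 1) hy
    have h2 : -w 2 * y 1 + w 1 * y 2 = 0 := by simpa using congrArg (fun z : E3 => z 2) hy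
    have h3 : (w 1 * w 1 + w 2 * w 2) * y 1 = 0 := by linear_combination w 1 * h1 - w 2 * h2
    have h4 : (w 1 * w 1 + w 2 * w 2) * y 2 = 0 := by linear_combination w 2 * h1 + w 1 * h2
    ext i; fin_cases i
    · exact h0
    · exact (mul_eq_zero.1 h3).resolve_left hpos.ne'
    · exact (mul_eq_zero.1 h4).resolve_left hpos.ne'
  have hAH : ∀ᶠ x in 𝓝 (0 : E2), ∀ v, fderiv ℝ (fun x => A (H x)) x v = A (fderiv ℝ H x v) := by
    filter_upwards [hH.eventually] with x hx v
    rw [fderiv_comp_apply A.differentiableAt hx.differentiableAt, A.fderiv]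
  have h1 : AEquivalentAt H 0 (fun x => A (H x)) 0 :=
    aEquivalentAt_of_target (isLocalDiffeomorphAt_of_injective_fderiv (A.contDiff.smoothNear _)
      (by rw [A.fderiv]; exact hAinj)) (Eventually.of_forall fun _ => rfl)
  obtain ⟨b, hb, h2⟩ := exists_cuspidalForm_of_fold (H := fun x => A (H x))
    (SmoothNear.comp 0 (A.contDiff.smoothNear _) hH)
    (by filter_upwards [hH0] with x hx; rw [hA]; simpa using hx)
    (by
      filter_upwards [hv, continuousAt_axis.eventually (axis_zero.symm ▸ hAH)] with x hx hx'
      rw [hx', hx, map_zero])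
    (by
      have e : (fun x => fderiv ℝ (fun x => A (H x)) x (stdVec 1)) =ᶠ[𝓝 0]
          fun x => A (fderiv ℝ H x (stdVec 1)) := hAH.mono fun x hx => hx _
      rw [e.fderiv_eq, fderiv_comp_apply A.differentiableAt hdH.differentiableAt, A.fderiv, ← hw,
        hA]
      simpa using hpos)
  exact ⟨b, hb, h1.trans h2⟩

theorem areaDensity_comp {F X : E2 → E3} {θ : E2 → E2} {x : E2} (A : E3 →L[ℝ] E3) (c : E3)
    (hF : DifferentiableAt ℝ F (θ x)) (hθ : DifferentiableAt ℝ θ x) :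
    areaDensity (fun y => A (F (θ y)) - c) (fun y => A (X (θ y))) x =
      det3 (A (stdVec 0)) (A (stdVec 1)) (A (stdVec 2)) *
        (fderiv ℝ θ x (stdVec 0) 0 * fderiv ℝ θ x (stdVec 1) 1 -
          fderiv ℝ θ x (stdVec 0) 1 * fderiv ℝ θ x (stdVec 1) 0) * areaDensity F X (θ x) := by
  have h : ∀ v, fderiv ℝ (fun y => A (F (θ y)) - c) x v = A (fderiv ℝ F (θ x) (fderiv ℝ θ x v)) := by
    intro v
    have hFθ := differentiableAt_comp hF hθ
    rw [fderiv_sub_const, fderiv_comp_apply (f := fun y => F (θ y)) A.differentiableAt hFθ,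
      A.fderiv, fderiv_comp_apply hF hθ]
  unfold areaDensity
  rw [h, h, det3_map, det3_map_plane, mul_assoc]

theorem fderiv_det_ne_zero_of_injective {A : E2 →L[ℝ] E2} (hA : Function.Injective A) :
    A (stdVec 0) 0 * A (stdVec 1) 1 - A (stdVec 0) 1 * A (stdVec 1) 0 ≠ 0 := by
  intro h
  -- These two vectors are the columns of the adjugate matrix up to sign; a zero determinant puts
  -- both in the kernel, so injectivity makes the entries of `A (stdVec 0)` vanish.
  have h1 : A (A (stdVec 1) 1 • stdVec 0 - A (stdVec 0) 1 • stdVec 1) = 0 := by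
    rw [map_sub, map_smul, map_smul]
    refine E2_eq_zero ?_ ?_
    · simp; linarith
    · simp; ring
  have h2 : A (A (stdVec 1) 0 • stdVec 0 - A (stdVec 0) 0 • stdVec 1) = 0 := by
    rw [map_sub, map_smul, map_smul]
    refine E2_eq_zero ?_ ?_
    · simp; ring
    · simp; linarith
  have h3 := (injective_iff_map_eq_zero _).1 hA _ h1
  have h4 := (injective_iff_map_eq_zero _).1 hA _ h2
  have e1 : A (stdVec 0) 1 = 0 := by simpa [stdVec] using congrArg (fun z : E2 => z 1) h3
  have e2 : A (stdVec 0) 0 = 0 := by simpa [stdVec] using congrArg (fun z : E2 => z 1) h4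
  have h5 := (injective_iff_map_eq_zero _).1 hA _ (E2_eq_zero e2 e1)
  simpa [stdVec] using congrArg (fun z : E2 => z 0) h5

/-- The normal form of a frontal near a non-degenerate singular point at which the null direction
is transversal to the singular curve. -/
theorem exists_cuspidalForm {F X : E2 → E3} {p : E2} (hF : SmoothNear F p) (hX : SmoothNear X p)
    (hdens0 : areaDensity F X p = 0) (hdens : fderiv ℝ (areaDensity F X) p ≠ 0)
    {γ η : ℝ → E2} (hγ : SmoothNear γ 0) (hη : SmoothNear η 0) (hγ0 : γ 0 = p)
    (hnull : ∀ᶠ t in 𝓝 (0 : ℝ), fderiv ℝ F (γ t) (η t) = 0)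
    (hind : LinearIndependent ℝ ![η 0, deriv γ 0]) :
    ∃ b, ContDiff ℝ ∞ b ∧ AEquivalentAt F p (cuspidalForm b) 0 := by
  have hη0 : η 0 ≠ 0 := hind.ne_zero 0
  have hnull0 : fderiv ℝ F p (η 0) = 0 := hγ0 ▸ hnull.self_of_nhds
  -- the combination map and its injectivity
  let θ : E2 → E2 := fun x => γ (x 0) + x 1 • η (x 0)
  have hγ0' : SmoothNear γ ((0 : E2) 0) := by simpa using hγ
  have hη0' : SmoothNear η ((0 : E2) 0) := by simpa using hη
  have hγc : SmoothNear (fun x : E2 => γ (x 0)) 0 := SmoothNear.comp 0 hγ0' (smoothNear_coord 0 0)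
  have hηc : SmoothNear (fun x : E2 => η (x 0)) 0 := SmoothNear.comp 0 hη0' (smoothNear_coord 0 0)
  have hθs : SmoothNear θ 0 := hγc.add ((smoothNear_coord 1 0).smul hηc)
  have hθ0 : θ 0 = p := by simp [θ, hγ0]
  have hdθ : ∀ v, fderiv ℝ θ 0 v = v 0 • deriv γ 0 + v 1 • η 0 := by
    intro v
    have hz : ((0 : E2) 0) = (0 : ℝ) := rfl
    have h1 : HasFDerivAt (fun x : E2 => γ (x 0)) ((fderiv ℝ γ 0).comp
        (EuclideanSpace.proj (𝕜 := ℝ) (0 : Fin 2))) 0 :=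
      HasFDerivAt.comp (0 : E2) (g := γ) (by rw [hz]; exact hγ.differentiableAt.hasFDerivAt)
        (EuclideanSpace.proj (𝕜 := ℝ) (0 : Fin 2)).hasFDerivAt
    have h2 : HasFDerivAt (fun x : E2 => x 1) (EuclideanSpace.proj (𝕜 := ℝ) (1 : Fin 2)) 0 :=
      (EuclideanSpace.proj (𝕜 := ℝ) (1 : Fin 2)).hasFDerivAt
    have h3 := h1.fun_add (h2.fun_smul hηc.differentiableAt.hasFDerivAt)
    rw [h3.fderiv]
    simp
  have hcomb : ∀ s t : ℝ, s • deriv γ 0 + t • η 0 = 0 → s = 0 ∧ t = 0 := by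
    intro s t h
    have := LinearIndependent.pair_iff.1 hind t s (by rw [add_comm]; exact h)
    exact ⟨this.2, this.1⟩
  have hθinj : Function.Injective (fderiv ℝ θ 0) := by
    refine (injective_iff_map_eq_zero _).2 fun v hv => ?_
    rw [hdθ] at hv
    exact E2_eq_zero (hcomb _ _ hv).1 (hcomb _ _ hv).2
  have hθ : IsLocalDiffeomorphAt (𝓡 2) (𝓡 2) ∞ θ 0 :=
    isLocalDiffeomorphAt_of_injective_fderiv hθs hθinj
  -- the velocity of the image of the singular curve
  set a : E3 := fderiv ℝ F p (deriv γ 0) with ha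
  -- If a vanished, dF would vanish on both γ'(0) and η(0), hence identically at p. Each term in the
  -- derivative of the density contains a column of dF, so dλ(p) would be zero.
  have ha0 : a ≠ 0 := by
    intro h0
    have hsurj : Function.Surjective (fderiv ℝ θ 0) :=
      LinearMap.surjective_of_injective (f := (fderiv ℝ θ 0).toLinearMap) hθinj
    have hF0 : ∀ v, fderiv ℝ F p v = 0 := by
      intro v
      obtain ⟨u, rfl⟩ := hsurj v
      rw [hdθ, map_add, map_smul, map_smul, ← ha, h0, hnull0]; simp
    refine hdens (ContinuousLinearMap.ext fun v => ?_)
    rw [fderiv_areaDensity hF hX, hF0, hF0]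
    simp [det3]
  have hs0 : (stdVec 0 : E3) ≠ 0 := by
    intro h; simpa [stdVec] using congrArg (fun z : E3 => z 0) h
  obtain ⟨A, hA⟩ := SeparatingDual.exists_continuousLinearEquiv_apply_eq (R := ℝ) ha0 hs0
  let c : E3 := A (F p)
  let G : E2 → E3 := fun x => A (F x) - c
  have hG : SmoothNear G p :=
    (SmoothNear.comp p (A.contDiff.smoothNear _) hF).sub (SmoothNear.const c p)
  have hdG : ∀ᶠ x in 𝓝 p, ∀ v, fderiv ℝ G x v = A (fderiv ℝ F x v) := by
    filter_upwards [hF.eventually] with x hx v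
    have := fderiv_comp_apply (g := A) (f := F) A.differentiableAt hx.differentiableAt v
    rw [A.fderiv] at this
    rw [fderiv_sub_const, this]; rfl
  have hGa : fderiv ℝ G p (deriv γ 0) = stdVec 0 := by
    rw [hdG.self_of_nhds, ← ha, hA]
  have hGη : fderiv ℝ G p (η 0) = 0 := by
    rw [hdG.self_of_nhds, hnull0, map_zero]
  have hFG : AEquivalentAt F p G p := by
    refine aEquivalentAt_of_target (Φ := fun y => A y - c) ?_ (Eventually.of_forall fun _ => rfl)
    refine isLocalDiffeomorphAt_of_injective_fderiv
      ((A.contDiff.smoothNear _).sub (SmoothNear.const c _)) ?_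
    rw [fderiv_sub_const, A.fderiv]
    exact A.injective
  -- straightening the first component
  have hGθ : SmoothNear (fun x => G (θ x)) 0 := SmoothNear.comp 0 (hθ0.symm ▸ hG) hθs
  have hGθ0 : SmoothNear (fun x => G (θ x) 0) 0 := smoothNear_euclidean.1 hGθ 0
  -- Since G has derivative e₀ along γ'(0) and 0 along η(0), its first component may replace the
  -- curve parameter as a coordinate. The second coordinate is kept, so the axis is still mapped
  -- into γ.
  let τ : E2 → E2 := fun x => !₂[G (θ x) 0, x 1]
  have hτ0 : τ 0 = 0 := by
    ext i; fin_cases i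
    · simp [τ, hθ0, G, c]
    · simp [τ]
  have hτ : IsLocalDiffeomorphAt (𝓡 2) (𝓡 2) ∞ τ 0 := by
    refine isLocalDiffeomorphAt_of_injective_fderiv (hGθ0.vec2 (smoothNear_coord 1 0)) ?_
    refine (injective_iff_map_eq_zero _).2 fun v hv => ?_
    simp only [τ] at hv
    rw [fderiv_vec2 hGθ0.differentiableAt (differentiableAt_coord 1 0), fderiv_coord,
      fderiv_apply_coord hGθ.differentiableAt, fderiv_comp_apply
        (by rw [hθ0]; exact hG.differentiableAt) hθs.differentiableAt, hdθ, hθ0, map_add, map_smul,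
      map_smul, hGa, hGη] at hv
    have h1 : v 1 = 0 := by simpa using congrArg (fun w : E2 => w 1) hv
    have h0 : v 0 = 0 := by simpa [stdVec] using congrArg (fun w : E2 => w 0) hv
    exact E2_eq_zero h0 h1
  obtain ⟨κ, hκ, hκτ, -, hr⟩ := IsLocalDiffeomorphAt.exists_inverse hτ
  rw [hτ0] at hκ hκτ hr
  have hκs := IsLocalDiffeomorphAt.smoothNear hκ
  let Θ : E2 → E2 := fun x => θ (κ x)
  have hΘ : IsLocalDiffeomorphAt (𝓡 2) (𝓡 2) ∞ Θ 0 := 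
    IsLocalDiffeomorphAt.comp (𝓡 2) E2 hκ (g := θ) (by rw [hκτ]; exact hθ)
  have hΘs := IsLocalDiffeomorphAt.smoothNear hΘ
  have hΘ0 : Θ 0 = p := by simp [Θ, hκτ, hθ0]
  have hGs : SmoothNear G (Θ 0) := hΘ0.symm ▸ hG
  have hH : SmoothNear (fun x => G (Θ x)) 0 := SmoothNear.comp 0 hGs hΘs
  have hH0 : ∀ᶠ x in 𝓝 (0 : E2), G (Θ x) 0 = x 0 := by
    filter_upwards [hr] with x hx
    exact congrArg (fun w : E2 => w 0) hx
  have hκ1 : ∀ᶠ x in 𝓝 (0 : E2), κ x 1 = x 1 := by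
    filter_upwards [hr] with x hx
    have h1 : τ (κ x) 1 = x 1 := by rw [hx]
    exact h1
  have hκax : ContinuousAt (fun x => κ (axis x) 0) 0 := by
    have h1 : ContinuousAt κ (axis 0) := by simpa using hκs.continuousAt
    exact (differentiableAt_coord 0 _).continuousAt.comp (h1.comp continuousAt_axis)
  have hκax0 : κ (axis 0) 0 = 0 := by simp [hκτ]
  have hv : ∀ᶠ x in 𝓝 (0 : E2), fderiv ℝ (fun x => G (Θ x)) (axis x) (stdVec 1) = 0 := by
    have ax : ∀ {P : E2 → Prop}, (∀ᶠ x in 𝓝 (0 : E2), P x) → ∀ᶠ x in 𝓝 (0 : E2), P (axis x) :=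
      fun h => continuousAt_axis.eventually (axis_zero.symm ▸ h)
    have tx : ∀ {P : ℝ → Prop}, (∀ᶠ t in 𝓝 (0 : ℝ), P t) →
      ∀ᶠ x in 𝓝 (0 : E2), P (κ (axis x) 0) := fun h =>
        hκax.tendsto.eventually (by rw [hκax0]; exact h)
    have hΘc : ContinuousAt Θ 0 := hΘs.continuousAt
    filter_upwards [ax hκ1, tx hnull, tx (hη.continuousAt.eventually_ne hη0),
      ax (IsLocalDiffeomorphAt.eventually_fderiv_bijective hΘ), ax hH.eventually,
      ax hΘs.eventually, ax (hΘc.eventually (hΘ0.symm ▸ hdG)),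
      ax (hΘc.eventually hGs.eventually), ax hH0.eventually_nhds]
      with x h1 h2 h3 h4 h5 h6 h7 h8 h9
    -- The null vector η is pulled back to ζ, which is killed by the derivative of G ∘ Θ. As the
    -- first component of G ∘ Θ is u, this forces ζ₀ = 0, so ζ is a nonzero multiple of ∂_v.
    obtain ⟨ζ, hζ⟩ := h4.2 (η (κ (axis x) 0))
    have hΘγ : Θ (axis x) = γ (κ (axis x) 0) := by
      have : κ (axis x) 1 = 0 := by rw [h1]; simp [axis]
      simp [Θ, θ, this]
    have hζ0 : fderiv ℝ (fun x => G (Θ x)) (axis x) ζ = 0 := by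
      rw [fderiv_comp_apply h8.differentiableAt h6.differentiableAt, hζ, h7, hΘγ, h2, map_zero]
    have hz0 : ζ 0 = 0 := by
      have := fderiv_apply_coord h5.differentiableAt ζ 0
      rw [hζ0, EventuallyEq.fderiv_eq (h9 : (fun x => G (Θ x) 0) =ᶠ[𝓝 (axis x)] fun x => x 0),
        fderiv_coord] at this
      exact this
    have hz1 : ζ 1 ≠ 0 := by
      intro hz1
      rw [E2_eq_zero hz0 hz1, map_zero] at hζ
      exact h3 hζ.symm
    rw [E2_eq_sum ζ, hz0, zero_smul, zero_add, map_smul] at hζ0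
    exact (smul_eq_zero.1 hζ0).resolve_left hz1
  have hXs : SmoothNear X (Θ 0) := hΘ0.symm ▸ hX
  have hFs : SmoothNear F (Θ 0) := hΘ0.symm ▸ hF
  have hY : SmoothNear (fun x => A (X (Θ x))) 0 :=
    SmoothNear.comp (f := fun x => X (Θ x)) 0 (A.contDiff.smoothNear _) (SmoothNear.comp 0 hXs hΘs)
  have hdensH : fderiv ℝ (areaDensity (fun x => G (Θ x)) fun x => A (X (Θ x))) 0 ≠ 0 := by
    have hbij := (IsLocalDiffeomorphAt.eventually_fderiv_bijective hΘ).self_of_nhds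
    refine (simpleZero_of_eventuallyEq_mul (x := (0 : E2)) (h := fun x => areaDensity F X (Θ x))
      (c := fun x => det3 (A (stdVec 0)) (A (stdVec 1)) (A (stdVec 2)) *
        (fderiv ℝ Θ x (stdVec 0) 0 * fderiv ℝ Θ x (stdVec 1) 1 -
          fderiv ℝ Θ x (stdVec 0) 1 * fderiv ℝ Θ x (stdVec 1) 0)) ?_ ?_ ?_ ?_ ?_).2
    · have hc : ∀ i j : Fin 2, ContinuousAt (fun x => fderiv ℝ Θ x (stdVec i) j) 0 := fun i j =>
        (smoothNear_euclidean.1 (hΘs.fderiv_apply (SmoothNear.const (stdVec i) 0)) j).continuousAt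
      exact continuousAt_const.mul (((hc 0 0).mul (hc 1 1)).sub ((hc 0 1).mul (hc 1 0)))
    · exact mul_ne_zero (det3_stdVec_ne_zero_of_leftInverse (A := (A : E3 →L[ℝ] E3))
        (B := (A.symm : E3 →L[ℝ] E3)) fun x => A.symm_apply_apply x)
        (fderiv_det_ne_zero_of_injective hbij.1)
    · filter_upwards [hΘs.eventually, hΘs.continuousAt.eventually hFs.eventually] with x h1 h2
      exact areaDensity_comp (A : E3 →L[ℝ] E3) c h2.differentiableAt h1.differentiableAt
    · rw [hΘ0]; exact hdens0
    · intro h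
      have hd : DifferentiableAt ℝ (areaDensity F X) (Θ 0) := by
        rw [hΘ0]
        by_contra hd
        exact hdens (fderiv_zero_of_not_differentiableAt hd)
      refine hdens (ContinuousLinearMap.ext fun v => ?_)
      obtain ⟨u, rfl⟩ := hbij.2 v
      rw [← hΘ0, ← fderiv_comp_apply hd hΘs.differentiableAt, h]; rfl
  obtain ⟨b, hb, hHb⟩ := exists_cuspidalForm_of_axis hH hY hH0 hv hdensH
  refine ⟨b, hb, hFG.trans (AEquivalentAt.trans ?_ hHb)⟩
  have := aEquivalentAt_comp (f := G) hΘ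
  rwa [hΘ0] at this

/-- The function `det (γ̃', D_η X, X)` for a map to `ℝ³`. -/
def flatPsi (F X : E2 → E3) (γ η : ℝ → E2) (t : ℝ) : ℝ :=
  det3 (deriv (fun s => F (γ s)) t) (fderiv ℝ X (γ t) (η t)) (X (γ t))

/-! ### The function ψ of a map equivalent to a cuspidal form -/

theorem deriv_comp_curve {W : Type*} [NormedAddCommGroup W] [NormedSpace ℝ W] {F : E2 → W}
    {γ : ℝ → E2} {t : ℝ} (hF : DifferentiableAt ℝ F (γ t)) (hγ : DifferentiableAt ℝ γ t) :
    deriv (fun s => F (γ s)) t = fderiv ℝ F (γ t) (deriv γ t) :=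
  fderiv_comp_deriv t hF hγ

theorem fderiv_clm_clm_apply {V W W' : Type*} [NormedAddCommGroup V] [NormedSpace ℝ V]
    [NormedAddCommGroup W] [NormedSpace ℝ W] [NormedAddCommGroup W'] [NormedSpace ℝ W']
    {B : V → W →L[ℝ] W' →L[ℝ] ℝ} {X : V → W} {Y : V → W'} {q v : V}
    (hB : DifferentiableAt ℝ B q) (hX : DifferentiableAt ℝ X q) (hY : DifferentiableAt ℝ Y q)
    (hBv : fderiv ℝ B q v = 0) (hYv : fderiv ℝ Y q v = 0) :
    fderiv ℝ (fun y => B y (X y) (Y y)) q v = B q (fderiv ℝ X q v) (Y q) := by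
  have h1 := hB.hasFDerivAt.clm_apply hX.hasFDerivAt
  have h2 := h1.clm_apply hY.hasFDerivAt
  rw [h2.fderiv]
  simp [hBv, hYv]

/-- Division by v on a dense set: if f were nonzero at q, the coordinate v = φ₁ would vanish near q,
contradicting surjectivity of the derivative of φ there. -/
theorem eventually_eq_zero_of_coord_mul {φ : E2 → E2} {f : E2 → ℝ} {p : E2}
    (hφ : IsLocalDiffeomorphAt (𝓡 2) (𝓡 2) ∞ φ p) (hf : SmoothNear f p)
    (h : ∀ᶠ q in 𝓝 p, φ q 1 * f q = 0) : ∀ᶠ q in 𝓝 p, f q = 0 := by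
  have hφs := IsLocalDiffeomorphAt.smoothNear hφ
  filter_upwards [hφs.eventually, IsLocalDiffeomorphAt.eventually_fderiv_bijective hφ,
    hf.eventually, h.eventually_nhds] with q h1 h2 h3 h4
  by_contra hne
  have h5 : (fun q => φ q 1) =ᶠ[𝓝 q] fun _ => (0 : ℝ) := by
    filter_upwards [h3.continuousAt.eventually_ne hne, h4] with y hy hy'
    exact (mul_eq_zero.1 hy').resolve_right hy
  obtain ⟨v, hv⟩ := h2.2 (stdVec 1)
  have h6 := fderiv_apply_coord h1.differentiableAt v 1
  rw [h5.fderiv_eq, hv] at h6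
  simp [stdVec] at h6

theorem fderiv_coord_mul_of_eq_zero {φ : E2 → E2} {f g : E2 → ℝ} {q : E2}
    (hφ : DifferentiableAt ℝ φ q) (hg : DifferentiableAt ℝ g q) (h0 : φ q 1 = 0)
    (h : ∀ᶠ y in 𝓝 q, f y = φ y 1 * g y) (v : E2) :
    f q = 0 ∧ fderiv ℝ f q v = fderiv ℝ φ q v 1 * g q := by
  refine ⟨by rw [h.self_of_nhds, h0, zero_mul], ?_⟩
  have hφ1 : DifferentiableAt ℝ (fun y => φ y 1) q := differentiableAt_euclidean.1 hφ 1
  rw [EventuallyEq.fderiv_eq (h : f =ᶠ[𝓝 q] fun y => φ y 1 * g y), fderiv_mul_apply hφ1 hg,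
    fderiv_apply_coord hφ, h0]
  ring

section CuspidalFormAlong

variable {F X : E2 → E3} {p : E2} {B : E3 → E3 →L[ℝ] E3 →L[ℝ] ℝ} {b : E2 → ℝ} {Ψ : E3 → E3}
  {φ : E2 → E2}

/-- A conormal field of a map in normal form, in coordinates in which the map is in normal form. -/
def conormal (F X : E2 → E3) (B : E3 → E3 →L[ℝ] E3 →L[ℝ] ℝ) (b : E2 → ℝ) (Ψ : E3 → E3)
    (φ : E2 → E2) (i : Fin 3) (q : E2) : ℝ :=
  B (F q) (X q) (fderiv ℝ Ψ (cuspidalForm b (φ q)) (stdVec i))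

theorem smoothNear_frame (hb : ContDiff ℝ ∞ b) (hφ : IsLocalDiffeomorphAt (𝓡 2) (𝓡 2) ∞ φ p)
    (hΨ : IsLocalDiffeomorphAt (𝓡 3) (𝓡 3) ∞ Ψ (cuspidalForm b (φ p))) (i : Fin 3) :
    SmoothNear (fun q => fderiv ℝ Ψ (cuspidalForm b (φ q)) (stdVec i)) p :=
  SmoothNear.comp (f := fun q => cuspidalForm b (φ q)) (h := fun y => fderiv ℝ Ψ y (stdVec i)) p
    ((IsLocalDiffeomorphAt.smoothNear hΨ).fderiv_apply (SmoothNear.const _ _))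
    (SmoothNear.comp p ((contDiff_cuspidalForm hb).smoothNear _)
      (IsLocalDiffeomorphAt.smoothNear hφ))

theorem smoothNear_conormal (hF : SmoothNear F p) (hX : SmoothNear X p) (hB : SmoothNear B (F p))
    (hb : ContDiff ℝ ∞ b) (hφ : IsLocalDiffeomorphAt (𝓡 2) (𝓡 2) ∞ φ p)
    (hΨ : IsLocalDiffeomorphAt (𝓡 3) (𝓡 3) ∞ Ψ (cuspidalForm b (φ p))) (i : Fin 3) :
    SmoothNear (conormal F X B b Ψ φ i) p :=
  ((SmoothNear.comp p hB hF).clm_apply hX).clm_apply (smoothNear_frame hb hφ hΨ i)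

theorem eventually_fderiv_eq (hb : ContDiff ℝ ∞ b)
    (hφ : IsLocalDiffeomorphAt (𝓡 2) (𝓡 2) ∞ φ p)
    (hΨ : IsLocalDiffeomorphAt (𝓡 3) (𝓡 3) ∞ Ψ (cuspidalForm b (φ p)))
    (heq : ∀ᶠ q in 𝓝 p, F q = Ψ (cuspidalForm b (φ q))) :
    ∀ᶠ q in 𝓝 p, ∀ v, fderiv ℝ F q v = fderiv ℝ Ψ (cuspidalForm b (φ q))
      (fderiv ℝ (cuspidalForm b) (φ q) (fderiv ℝ φ q v)) := by
  have hφs := IsLocalDiffeomorphAt.smoothNear hφ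
  have hΨs := IsLocalDiffeomorphAt.smoothNear hΨ
  have hcd : Differentiable ℝ (cuspidalForm b) :=
    (contDiff_cuspidalForm hb).differentiable (by simp)
  have hc : ContinuousAt (fun q => cuspidalForm b (φ q)) p :=
    hcd.continuous.continuousAt.comp hφs.continuousAt
  filter_upwards [heq.eventually_nhds, hφs.eventually, hc.eventually hΨs.eventually]
    with q h1 h2 h3 v
  rw [EventuallyEq.fderiv_eq (h1 : F =ᶠ[𝓝 q] fun q => Ψ (cuspidalForm b (φ q))),
    fderiv_comp_apply (f := fun q => cuspidalForm b (φ q)) h3.differentiableAt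
      (differentiableAt_comp (hcd _) h2.differentiableAt),
    fderiv_comp_apply (hcd _) h2.differentiableAt]

/-- Write n_i for the pairings of X with the image of the standard frame. Orthogonality of X to F_u
and F_v, in normalized coordinates, reads n₀ + v³ b_u n₂ = 0 and 2v n₁ + (2v⁴ b_v + 3v² b) n₂ = 0.
The second relation is divisible by v, which produces the coefficient 3/2 of b. -/
theorem eventually_conormal_eq (hF : SmoothNear F p) (hX : SmoothNear X p)
    (hB : SmoothNear B (F p)) (hnormal : ∀ᶠ q in 𝓝 p, ∀ v, B (F q) (X q) (fderiv ℝ F q v) = 0)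
    (hb : ContDiff ℝ ∞ b) (hφ : IsLocalDiffeomorphAt (𝓡 2) (𝓡 2) ∞ φ p)
    (hΨ : IsLocalDiffeomorphAt (𝓡 3) (𝓡 3) ∞ Ψ (cuspidalForm b (φ p)))
    (heq : ∀ᶠ q in 𝓝 p, F q = Ψ (cuspidalForm b (φ q))) :
    (∀ᶠ q in 𝓝 p, conormal F X B b Ψ φ 0 q =
      φ q 1 * (-(φ q 1 ^ 2 * fderiv ℝ b (fold (φ q)) (stdVec 0)) * conormal F X B b Ψ φ 2 q)) ∧
    ∀ᶠ q in 𝓝 p, conormal F X B b Ψ φ 1 q =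
      φ q 1 * (-(φ q 1 ^ 2 * fderiv ℝ b (fold (φ q)) (stdVec 1) + 3 / 2 * b (fold (φ q))) *
        conormal F X B b Ψ φ 2 q) := by
  have hφs := IsLocalDiffeomorphAt.smoothNear hφ
  have hbase : ∀ᶠ q in 𝓝 p, ∀ w : E2, fderiv ℝ (cuspidalForm b) (φ q) w 0 *
      conormal F X B b Ψ φ 0 q + fderiv ℝ (cuspidalForm b) (φ q) w 1 * conormal F X B b Ψ φ 1 q +
      fderiv ℝ (cuspidalForm b) (φ q) w 2 * conormal F X B b Ψ φ 2 q = 0 := by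
    filter_upwards [hnormal, eventually_fderiv_eq hb hφ hΨ heq,
      IsLocalDiffeomorphAt.eventually_fderiv_bijective hφ] with q h1 h2 h3 w
    obtain ⟨v, rfl⟩ := h3.2 w
    have := h1 v
    rw [h2, E3_eq_sum (fderiv ℝ (cuspidalForm b) (φ q) (fderiv ℝ φ q v))] at this
    simpa [conormal] using this
  have hf0 : ∀ x : E2, (!₂[(stdVec 0 : E2) 0, 2 * x 1 * (stdVec 0 : E2) 1] : E2) = stdVec 0 := by
    intro x; ext i; fin_cases i <;> simp [stdVec]
  have hf1 : ∀ x : E2, (!₂[(stdVec 1 : E2) 0, 2 * x 1 * (stdVec 1 : E2) 1] : E2) =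
      (2 * x 1) • stdVec 1 := by
    intro x; ext i; fin_cases i <;> simp [stdVec]
  constructor
  · filter_upwards [hbase] with q h
    have := h (stdVec 0)
    rw [fderiv_cuspidalForm hb, fderiv_fold, hf0] at this
    simp [stdVec] at this
    simp only [stdVec]
    linear_combination this
  · have key : ∀ᶠ q in 𝓝 p, φ q 1 * (conormal F X B b Ψ φ 1 q -
      φ q 1 * (-(φ q 1 ^ 2 * fderiv ℝ b (fold (φ q)) (stdVec 1) + 3 / 2 * b (fold (φ q))) *
        conormal F X B b Ψ φ 2 q)) = 0 := by
      filter_upwards [hbase] with q h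
      have := h (stdVec 1)
      rw [fderiv_cuspidalForm hb, fderiv_fold, hf1] at this
      simp [stdVec] at this
      simp only [stdVec]
      linear_combination (1 / 2) * this
    have hn := fun i => smoothNear_conormal hF hX hB hb hφ hΨ i
    have hφ1 : SmoothNear (fun q => φ q 1) p := smoothNear_euclidean.1 hφs 1
    have hfo : SmoothNear (fun q => fold (φ q)) p :=
      SmoothNear.comp p (contDiff_fold.smoothNear _) hφs
    have hbf : SmoothNear (fun q => b (fold (φ q))) p := SmoothNear.comp p (hb.smoothNear _) hfo
    have hbf' : SmoothNear (fun q => fderiv ℝ b (fold (φ q)) (stdVec 1)) p :=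
      SmoothNear.comp (h := fun y => fderiv ℝ b y (stdVec 1)) p
        ((hb.smoothNear _).fderiv_apply (SmoothNear.const _ _)) hfo
    have hneg : SmoothNear (fun q =>
        -(φ q 1 ^ 2 * fderiv ℝ b (fold (φ q)) (stdVec 1) + 3 / 2 * b (fold (φ q)))) p := by
      have := ((hφ1.pow 2).mul hbf').add ((SmoothNear.const (3 / 2 : ℝ) p).mul hbf)
      exact this.mono fun _ h => h.neg
    filter_upwards [eventually_eq_zero_of_coord_mul hφ
      ((hn 1).sub (hφ1.mul (hneg.mul (hn 2)))) key] with q hq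
    exact sub_eq_zero.1 hq

end CuspidalFormAlong

theorem fderiv_cuspidalForm_of_axis {b : E2 → ℝ} (hb : ContDiff ℝ ∞ b) {x : E2} (hx : x 1 = 0)
    (v : E2) : fderiv ℝ (cuspidalForm b) x v = v 0 • stdVec 0 := by
  rw [fderiv_cuspidalForm hb, hx]
  ext i; fin_cases i <;> simp [stdVec]

theorem fold_of_axis {x : E2} (hx : x 1 = 0) : fold x = x := by
  ext i; fin_cases i <;> simp [fold, hx]

/-- The matrix of a bilinear form with respect to the standard basis and a frame, as a linear
map. -/
def formMap (B : E3 →L[ℝ] E3 →L[ℝ] ℝ) (P : Fin 3 → E3) : E3 →L[ℝ] E3 :=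
  LinearMap.toContinuousLinearMap
    { toFun := fun x => !₂[B x (P 0), B x (P 1), B x (P 2)]
      map_add' := fun x y => by ext i; fin_cases i <;> simp
      map_smul' := fun c x => by ext i; fin_cases i <;> simp }

@[simp]
theorem formMap_apply (B : E3 →L[ℝ] E3 →L[ℝ] ℝ) (P : Fin 3 → E3) (x : E3) (i : Fin 3) :
    formMap B P x i = B x (P i) := by
  fin_cases i <;> rfl

theorem map_eq_sum_stdVec (l : E3 →L[ℝ] ℝ) (T : E3 →L[ℝ] E3) (y : E3) :
    l (T y) = y 0 * l (T (stdVec 0)) + y 1 * l (T (stdVec 1)) + y 2 * l (T (stdVec 2)) := by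
  conv_lhs => rw [E3_eq_sum y]
  simp

/-- A vector with zero pairings against a spanning frame is orthogonal to itself, hence zero by
positivity; so the map is injective. -/
theorem det3_formMap_ne_zero {B : E3 →L[ℝ] E3 →L[ℝ] ℝ} (hB : ∀ v ≠ 0, 0 < B v v)
    {T : E3 →L[ℝ] E3} (hT : Function.Surjective T) :
    det3 (formMap B (fun i => T (stdVec i)) (stdVec 0))
      (formMap B (fun i => T (stdVec i)) (stdVec 1))
      (formMap B (fun i => T (stdVec i)) (stdVec 2)) ≠ 0 := by
  have hinj : Function.Injective (formMap B fun i => T (stdVec i)) := by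
    refine (injective_iff_map_eq_zero _).2 fun x hx => ?_
    by_contra hne
    obtain ⟨y, rfl⟩ := hT x
    have h : ∀ i, B (T y) (T (stdVec i)) = 0 := fun i => by
      rw [← formMap_apply B (fun i => T (stdVec i)), hx]; rfl
    have h1 := hB _ hne
    have h2 := map_eq_sum_stdVec (B (T y)) T y
    rw [h2, h, h, h] at h1
    simp at h1
  let e := (LinearEquiv.ofInjectiveEndo (formMap B fun i => T (stdVec i)).toLinearMap
    hinj).toContinuousLinearEquiv
  exact det3_stdVec_ne_zero_of_leftInverse (A := formMap B fun i => T (stdVec i))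
    (B := (e.symm : E3 →L[ℝ] E3)) fun x => e.symm_apply_apply x

/-- Paired with the frame, the three vectors have coordinates (u B(T e₀, T e₀), *, *), (0, k, *) and
(0, 0, n). The determinant becomes triangular, at the cost of dividing by the determinant of
`formMap`. -/
theorem det3_eq_div_of_formMap {B : E3 →L[ℝ] E3 →L[ℝ] ℝ} (hB : ∀ v ≠ 0, 0 < B v v)
    {T : E3 →L[ℝ] E3} (hT : Function.Surjective T) {m x : E3} {u k n : ℝ}
    (hm0 : B m (T (stdVec 0)) = 0) (hm1 : B m (T (stdVec 1)) = k) (hx0 : B x (T (stdVec 0)) = 0)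
    (hx1 : B x (T (stdVec 1)) = 0) (hx2 : B x (T (stdVec 2)) = n) :
    det3 (u • T (stdVec 0)) m x = u * B (T (stdVec 0)) (T (stdVec 0)) * k * n /
      det3 (formMap B (fun i => T (stdVec i)) (stdVec 0))
        (formMap B (fun i => T (stdVec i)) (stdVec 1))
        (formMap B (fun i => T (stdVec i)) (stdVec 2)) := by
  rw [eq_div_iff (det3_formMap_ne_zero hB hT), mul_comm, ← det3_map]
  simp [det3, hm0, hm1, hx0, hx1, hx2]
  ring

theorem continuousAt_det3 {α : Type*} [TopologicalSpace α] {a b c : α → E3} {x : α}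
    (ha : ∀ i, ContinuousAt (fun q => a q i) x) (hb : ∀ i, ContinuousAt (fun q => b q i) x)
    (hc : ∀ i, ContinuousAt (fun q => c q i) x) :
    ContinuousAt (fun q => det3 (a q) (b q) (c q)) x := by
  unfold det3
  fun_prop

set_option synthInstance.maxHeartbeats 200000 in
/-- The criterion for a map which is in the normal form of `exists_cuspidalForm` in suitable
coordinates. -/
theorem flatPsi_simpleZero_iff {F X : E2 → E3} {p : E2} {B : E3 → E3 →L[ℝ] E3 →L[ℝ] ℝ}
    {b : E2 → ℝ} (hF : SmoothNear F p) (hX : SmoothNear X p) (hB : SmoothNear B (F p))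
    (hBpos : ∀ᶠ y in 𝓝 (F p), ∀ v ≠ 0, 0 < B y v v) (hX0 : X p ≠ 0)
    (hnormal : ∀ᶠ q in 𝓝 p, ∀ v, B (F q) (X q) (fderiv ℝ F q v) = 0)
    {γ η : ℝ → E2} (hγ : SmoothNear γ 0) (hη : SmoothNear η 0) (hγ0 : γ 0 = p)
    (hγ1 : deriv γ 0 ≠ 0) (hη0 : η 0 ≠ 0)
    (hnull : ∀ᶠ t in 𝓝 (0 : ℝ), fderiv ℝ F (γ t) (η t) = 0)
    (hb : ContDiff ℝ ∞ b) (hFb : AEquivalentAt F p (cuspidalForm b) 0) :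
    LinearIndependent ℝ ![η 0, deriv γ 0] ∧
      ((flatPsi F X γ η 0 = 0 ∧ deriv (flatPsi F X γ η) 0 ≠ 0) ↔
        (b 0 = 0 ∧ fderiv ℝ b 0 (stdVec 0) ≠ 0)) := by
  obtain ⟨φ, Φ, hφ, hφp, hΦ, hΦp, heq⟩ := hFb
  obtain ⟨Ψ, hΨ, -, hΨΦ, -⟩ := IsLocalDiffeomorphAt.exists_inverse hΦ
  rw [hΦp, ← hφp] at hΨ
  have heq' : ∀ᶠ q in 𝓝 p, F q = Ψ (cuspidalForm b (φ q)) := by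
    filter_upwards [heq, hF.continuousAt.eventually hΨΦ] with q h1 h2
    rw [h1, h2]
  have hφs := IsLocalDiffeomorphAt.smoothNear hφ
  have hγp : ∀ {P : E2 → Prop}, (∀ᶠ q in 𝓝 p, P q) → ∀ᶠ t in 𝓝 (0 : ℝ), P (γ t) := fun h =>
    hγ.continuousAt.tendsto.eventually (by rw [hγ0]; exact h)
  have hcd : Differentiable ℝ (cuspidalForm b) :=
    (contDiff_cuspidalForm hb).differentiable (by simp)
  have hT : ∀ᶠ q in 𝓝 p, Function.Bijective (fderiv ℝ Ψ (cuspidalForm b (φ q))) :=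
    (ContinuousAt.comp (f := φ) hcd.continuous.continuousAt hφs.continuousAt).eventually
      (IsLocalDiffeomorphAt.eventually_fderiv_bijective hΨ)
  have hdF := eventually_fderiv_eq hb hφ hΨ heq'
  have hbij := IsLocalDiffeomorphAt.eventually_fderiv_bijective hφ
  -- the singular curve and the null field in the normalized coordinates
  have hnullc : ∀ᶠ t in 𝓝 (0 : ℝ), φ (γ t) 1 = 0 ∧ fderiv ℝ φ (γ t) (η t) 0 = 0 ∧
      fderiv ℝ φ (γ t) (η t) 1 ≠ 0 := by
    filter_upwards [hnull, hγp hT, hγp hdF, hγp hbij, hη.continuousAt.eventually_ne hη0]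
      with t h1 h2 h3 h4 h5
    rw [h3] at h1
    have h6 := (injective_iff_map_eq_zero _).1 h2.1 _ h1
    rw [fderiv_cuspidalForm hb] at h6
    have hz0 : fderiv ℝ φ (γ t) (η t) 0 = 0 := by simpa using congrArg (fun z : E3 => z 0) h6
    have hz1 : fderiv ℝ φ (γ t) (η t) 1 ≠ 0 := fun hz1 =>
      h5 ((injective_iff_map_eq_zero _).1 h4.1 _ (E2_eq_zero hz0 hz1))
    -- The second component of the cuspidal form is v², so a null vector with nonzero v-component
    -- can exist only where v = 0: the null field places γ on the axis.
    have h7 : 2 * φ (γ t) 1 * fderiv ℝ φ (γ t) (η t) 1 = 0 := by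
      simpa using congrArg (fun z : E3 => z 1) h6
    refine ⟨?_, hz0, hz1⟩
    have := (mul_eq_zero.1 h7).resolve_right hz1
    linarith
  have hcurve : ∀ᶠ t in 𝓝 (0 : ℝ), fderiv ℝ φ (γ t) (deriv γ t) 1 = 0 := by
    filter_upwards [hnullc.eventually_nhds, hγ.eventually, hγp hφs.eventually] with t h1 h2 h3
    have h4 : (fun s => φ (γ s) 1) =ᶠ[𝓝 t] fun _ => (0 : ℝ) := h1.mono fun s hs => hs.1
    have h5 : DifferentiableAt ℝ (fun q => φ q 1) (γ t) :=
      differentiableAt_euclidean.1 h3.differentiableAt 1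
    rw [← fderiv_apply_coord h3.differentiableAt, ← deriv_comp_curve h5 h2.differentiableAt,
      h4.deriv_eq]
    simp
  obtain ⟨hv0, hη00, hη01⟩ := hnullc.self_of_nhds
  have hγ01 := hcurve.self_of_nhds
  have hinj0 := (hγp hbij).self_of_nhds.1
  have hu0 : fderiv ℝ φ (γ 0) (deriv γ 0) 0 ≠ 0 := fun h =>
    hγ1 ((injective_iff_map_eq_zero _).1 hinj0 _ (E2_eq_zero h hγ01))
  refine ⟨LinearIndependent.pair_iff.2 fun s t hst => ?_, ?_⟩
  · have h1 := congrArg (fderiv ℝ φ (γ 0)) hst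
    rw [map_add, map_smul, map_smul, map_zero] at h1
    have h2 : t * fderiv ℝ φ (γ 0) (deriv γ 0) 0 = 0 := by
      simpa [hη00] using congrArg (fun z : E2 => z 0) h1
    have h3 : s * fderiv ℝ φ (γ 0) (η 0) 1 = 0 := by
      simpa [hγ01] using congrArg (fun z : E2 => z 1) h1
    exact ⟨(mul_eq_zero.1 h3).resolve_right hη01, (mul_eq_zero.1 h2).resolve_right hu0⟩
  let P : Fin 3 → E2 → E3 := fun i q => fderiv ℝ Ψ (cuspidalForm b (φ q)) (stdVec i)
  let n : E2 → ℝ := conormal F X B b Ψ φ 2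
  let D : E2 → ℝ := fun q => det3 (formMap (B (F q)) (fun i => P i q) (stdVec 0))
    (formMap (B (F q)) (fun i => P i q) (stdVec 1)) (formMap (B (F q)) (fun i => P i q) (stdVec 2))
  let ρ : ℝ → ℝ := fun t => fderiv ℝ φ (γ t) (deriv γ t) 0 *
    B (F (γ t)) (P 0 (γ t)) (P 0 (γ t)) * (-(3 / 2) * fderiv ℝ φ (γ t) (η t) 1 * n (γ t)) *
      n (γ t) / D (γ t)
  have hPs : ∀ i, SmoothNear (P i) p := fun i => smoothNear_frame hb hφ hΨ i
  have hns : ∀ i, SmoothNear (conormal F X B b Ψ φ i) p := fun i =>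
    smoothNear_conormal hF hX hB hb hφ hΨ i
  have hBF : SmoothNear (fun q => B (F q)) p := SmoothNear.comp p hB hF
  obtain ⟨hc0, hc1⟩ := eventually_conormal_eq hF hX hB hnormal hb hφ hΨ heq'
  have hφ1 : SmoothNear (fun q => φ q 1) p := smoothNear_euclidean.1 hφs 1
  have hfo : SmoothNear (fun q => fold (φ q)) p :=
    SmoothNear.comp p (contDiff_fold.smoothNear _) hφs
  have hbf : SmoothNear (fun q => b (fold (φ q))) p := SmoothNear.comp p (hb.smoothNear _) hfo
  have hbf' : ∀ i, SmoothNear (fun q => fderiv ℝ b (fold (φ q)) (stdVec i)) p := fun i =>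
    SmoothNear.comp (h := fun y => fderiv ℝ b y (stdVec i)) p
      ((hb.smoothNear _).fderiv_apply (SmoothNear.const _ _)) hfo
  have hg0 : SmoothNear (fun q => -(φ q 1 ^ 2 * fderiv ℝ b (fold (φ q)) (stdVec 0)) *
      conormal F X B b Ψ φ 2 q) p :=
    SmoothNear.mul (((hφ1.pow 2).mul (hbf' 0)).mono fun _ h => h.neg) (hns 2)
  have hg1 : SmoothNear (fun q => -(φ q 1 ^ 2 * fderiv ℝ b (fold (φ q)) (stdVec 1) +
      3 / 2 * b (fold (φ q))) * conormal F X B b Ψ φ 2 q) p :=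
    SmoothNear.mul ((((hφ1.pow 2).mul (hbf' 1)).add
      ((SmoothNear.const (3 / 2 : ℝ) p).mul hbf)).mono fun _ h => h.neg) (hns 2)
  have hΨe : ∀ᶠ q in 𝓝 p, SmoothNear Ψ (cuspidalForm b (φ q)) :=
    (ContinuousAt.comp (f := φ) hcd.continuous.continuousAt hφs.continuousAt).eventually
      (IsLocalDiffeomorphAt.smoothNear hΨ).eventually
  -- the formula for `ψ`
  have hpsi : ∀ᶠ t in 𝓝 (0 : ℝ), flatPsi F X γ η t = ρ t * b (φ (γ t)) := by
    filter_upwards [hnullc, hcurve, hnull, hγp hT, hγp hdF, hγp hbij, hγ.eventually,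
      hγp hF.eventually, hγp hX.eventually, hγp hφs.eventually, hγp hBF.eventually,
      hγp (eventually_all.2 fun i => (hPs i).eventually), hγp hc0.eventually_nhds,
      hγp hc1.eventually_nhds, hγp hg0.eventually, hγp hg1.eventually,
      hγp (hF.continuousAt.eventually hBpos), hγp (hF.continuousAt.eventually hB.eventually),
      hγp hΨe]
      with t ⟨hx1, hz0, hz1⟩ hcu hnu hTt hdFt hbijt hγt hFt hXt hφt hBFt hPt h0 h1 hg0t hg1t
        hpos hBt hΨt
    have hderiv : deriv (fun s => F (γ s)) t =
        fderiv ℝ φ (γ t) (deriv γ t) 0 • fderiv ℝ Ψ (cuspidalForm b (φ (γ t))) (stdVec 0) := by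
      rw [deriv_comp_curve hFt.differentiableAt hγt.differentiableAt, hdFt,
        fderiv_cuspidalForm_of_axis hb hx1, map_smul]
    -- The metric and the frame depend on q only through F and through the cuspidal form, both of
    -- which have zero derivative along η. Differentiating a conormal component along η therefore
    -- differentiates X alone.
    have hBη : fderiv ℝ (fun q => B (F q)) (γ t) (η t) = 0 := by
      rw [fderiv_comp_apply hBt.differentiableAt hFt.differentiableAt, hnu, map_zero]
    have hPη : ∀ i, fderiv ℝ (P i) (γ t) (η t) = 0 := by
      intro i
      change fderiv ℝ (fun q => (fun y => fderiv ℝ Ψ y (stdVec i)) (cuspidalForm b (φ q))) (γ t)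
        (η t) = 0
      rw [fderiv_comp_apply (g := fun y => fderiv ℝ Ψ y (stdVec i))
          (f := fun q => cuspidalForm b (φ q))
          (hΨt.fderiv_apply (SmoothNear.const _ _)).differentiableAt
          (differentiableAt_comp (hcd _) hφt.differentiableAt),
        fderiv_comp_apply (hcd _) hφt.differentiableAt, fderiv_cuspidalForm_of_axis hb hx1, hz0,
        zero_smul, map_zero]
    have hnη : ∀ i, fderiv ℝ (conormal F X B b Ψ φ i) (γ t) (η t) =
        B (F (γ t)) (fderiv ℝ X (γ t) (η t)) (P i (γ t)) := fun i =>
      fderiv_clm_clm_apply hBFt.differentiableAt hXt.differentiableAt (hPt i).differentiableAt hBη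
        (hPη i)
    obtain ⟨e0, d0⟩ := fderiv_coord_mul_of_eq_zero hφt.differentiableAt hg0t.differentiableAt hx1
      h0 (η t)
    obtain ⟨e1, d1⟩ := fderiv_coord_mul_of_eq_zero hφt.differentiableAt hg1t.differentiableAt hx1
      h1 (η t)
    rw [hnη] at d0 d1
    -- On the axis, differentiating the conormal relations along η only hits the outer factor v.
    -- Thus D_η X pairs to 0 with the first frame vector, and with the second to -(3/2) · (dφ η)₁ ·
    -- n₂ · b.
    have hfin := det3_eq_div_of_formMap hpos hTt.2 (m := fderiv ℝ X (γ t) (η t)) (x := X (γ t))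
      (u := fderiv ℝ φ (γ t) (deriv γ t) 0)
      (k := -(3 / 2) * fderiv ℝ φ (γ t) (η t) 1 * n (γ t) * b (φ (γ t))) (n := n (γ t))
      (d0.trans (by simp [hx1])) (d1.trans (by simp [hx1, fold_of_axis, n]; ring)) e0 e1 rfl
    unfold flatPsi
    rw [hderiv, hfin]
    simp only [ρ, D, P]
    ring
  -- the factor does not vanish
  have hcont : ∀ {f : E2 → ℝ}, ContinuousAt f p → ContinuousAt (fun t => f (γ t)) 0 := fun h =>
    ContinuousAt.comp (by rw [hγ0]; exact h) hγ.continuousAt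
  have hBPc : ∀ {Y Z : E2 → E3}, SmoothNear Y p → SmoothNear Z p →
      ContinuousAt (fun q => B (F q) (Y q) (Z q)) p := fun hY hZ =>
    ((hBF.clm_apply hY).clm_apply hZ).continuousAt
  have hDc : ContinuousAt D p := by
    have h : ∀ i j, ContinuousAt (fun q => formMap (B (F q)) (fun i => P i q) (stdVec i) j) p :=
      fun i j => by
        simp only [formMap_apply]
        exact hBPc (SmoothNear.const _ _) (hPs j)
    exact continuousAt_det3 (h 0) (h 1) (h 2)
  have hposp := (hBpos.self_of_nhds : ∀ v ≠ 0, 0 < B (F p) v v)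
  have hTp := hT.self_of_nhds
  have hD0 : D p ≠ 0 := det3_formMap_ne_zero hposp hTp.2
  have hdφc : ∀ {ζ : ℝ → E2}, ContinuousAt ζ 0 → ∀ i,
      ContinuousAt (fun t => fderiv ℝ φ (γ t) (ζ t) i) 0 := by
    intro ζ hζ i
    have h1 : ContinuousAt (fun t => fderiv ℝ φ (γ t)) 0 :=
      ContinuousAt.comp (by rw [hγ0]; exact hφs.fderiv.continuousAt) hγ.continuousAt
    exact (differentiableAt_coord i _).continuousAt.comp (h1.clm_apply hζ)
  have hγd : ContinuousAt (deriv γ) 0 := by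
    have := (hγ.fderiv_apply (SmoothNear.const (1 : ℝ) 0)).continuousAt
    simpa using this
  have hρc : ContinuousAt ρ 0 :=
    ((((hdφc hγd 0).mul (hcont (hBPc (hPs 0) (hPs 0)))).mul
      ((continuousAt_const.mul (hdφc hη.continuousAt 1)).mul (hcont (hns 2).continuousAt))).mul
        (hcont (hns 2).continuousAt)).div (hcont hDc) (by rw [hγ0]; exact hD0)
  have hx1 : φ p 1 = 0 := by rw [hφp]; rfl
  -- The other two conormal components vanish at p; if this one did as well, X(p) would be
  -- orthogonal to itself.
  have hn0 : n p ≠ 0 := by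
    intro h
    have e0 : conormal F X B b Ψ φ 0 p = 0 := by rw [hc0.self_of_nhds, hx1, zero_mul]
    have e1 : conormal F X B b Ψ φ 1 p = 0 := by rw [hc1.self_of_nhds, hx1, zero_mul]
    obtain ⟨y, hy⟩ := hTp.2 (X p)
    have h1 := hposp _ hX0
    have h2 : B (F p) (X p) (X p) = y 0 * conormal F X B b Ψ φ 0 p +
        y 1 * conormal F X B b Ψ φ 1 p + y 2 * conormal F X B b Ψ φ 2 p := by
      exact (congrArg (B (F p) (X p)) hy.symm).trans (map_eq_sum_stdVec _ _ y)
    rw [h2, e0, e1] at h1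
    simp [n] at h
    simp [h] at h1
  have hP0 : P 0 p ≠ 0 := fun h => by
    have := (injective_iff_map_eq_zero _).1 hTp.1 _ h
    simpa [stdVec] using congrArg (fun z : E3 => z 0) this
  have hρ0 : ρ 0 ≠ 0 := by
    simp only [ρ]
    rw [hγ0] at hu0 hη01 ⊢
    exact div_ne_zero (mul_ne_zero (mul_ne_zero (mul_ne_zero hu0 (hposp _ hP0).ne')
      (mul_ne_zero (mul_ne_zero (by norm_num) hη01) hn0)) hn0) hD0
  have hb' := hb.differentiable (by simp)
  have hφγ : φ (γ 0) = 0 := by rw [hγ0, hφp]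
  have hbγ : deriv (fun t => b (φ (γ t))) 0 =
      fderiv ℝ φ (γ 0) (deriv γ 0) 0 * fderiv ℝ b 0 (stdVec 0) := by
    have hφd : DifferentiableAt ℝ φ (γ 0) := by rw [hγ0]; exact hφs.differentiableAt
    rw [deriv_comp_curve (F := fun q => b (φ q)) (differentiableAt_comp (hb' _) hφd)
      hγ.differentiableAt, fderiv_comp_apply (hb' _) hφd, hφγ,
      E2_eq_sum (fderiv ℝ φ (γ 0) (deriv γ 0)), hγ01]
    simp [stdVec]
  rw [← fderiv_ne_zero_iff_deriv_ne_zero, simpleZero_iff_of_eventuallyEq_mul hρc hρ0 hpsi,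
    fderiv_ne_zero_iff_deriv_ne_zero, hbγ, hφγ, mul_ne_zero_iff]
  exact ⟨fun h => ⟨h.1, h.2.2⟩, fun h => ⟨h.1, hu0, h.2⟩⟩

section Coordinates

variable {N : Type*} [TopologicalSpace N] [ChartedSpace E3 N] [IsManifold (𝓡 3) ∞ N]

/-! ### Coordinates on the tangent spaces -/

theorem coordComp_eq_mfderiv {y₀ y : N} (hy : y ∈ (chartAt E3 y₀).source)
    (v : TangentSpace (𝓡 3) y) :
    coordComp y₀ y v = mfderiv (𝓡 3) 𝓘(ℝ, E3) (extChartAt (𝓡 3) y₀) y v := by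
  unfold coordComp
  rw [TangentBundle.continuousLinearMapAt_trivializationAt hy]
  rfl

theorem coordComp_symmL {y₀ y : N} (hy : y ∈ (chartAt E3 y₀).source) (x : E3) :
    coordComp y₀ y ((trivializationAt E3 (TangentSpace (𝓡 3)) y₀).symmL ℝ y x) = x :=
  (trivializationAt E3 (TangentSpace (𝓡 3)) y₀).continuousLinearMapAt_symmL hy x

theorem symmL_coordComp {y₀ y : N} (hy : y ∈ (chartAt E3 y₀).source)
    (v : TangentSpace (𝓡 3) y) :
    (trivializationAt E3 (TangentSpace (𝓡 3)) y₀).symmL ℝ y (coordComp y₀ y v) = v :=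
  (trivializationAt E3 (TangentSpace (𝓡 3)) y₀).symmL_continuousLinearMapAt hy v

theorem coordComp_coordVec {y₀ y : N} (hy : y ∈ (chartAt E3 y₀).source) (i : Fin 3) :
    coordComp y₀ y (coordVec y₀ y i) = stdVec i :=
  coordComp_symmL hy _

theorem coordComp_ne_zero {y₀ y : N} (hy : y ∈ (chartAt E3 y₀).source)
    {v : TangentSpace (𝓡 3) y} (hv : v ≠ 0) : coordComp y₀ y v ≠ 0 := fun h => hv <| by
  rw [← symmL_coordComp hy v, h, map_zero]

theorem sum_coordComp_smul_coordVec {y₀ y : N} (hy : y ∈ (chartAt E3 y₀).source)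
    (v : TangentSpace (𝓡 3) y) : ∑ i, coordComp y₀ y v i • coordVec y₀ y i = v := by
  conv_rhs => rw [← symmL_coordComp hy v, E3_eq_sum (coordComp y₀ y v)]
  simp [Fin.sum_univ_three, coordVec, map_add, map_smul]

/-- The coordinate vector fields of a chart, as a basis of a tangent space. -/
def coordBasis {y₀ y : N} (hy : y ∈ (chartAt E3 y₀).source) :
    Module.Basis (Fin 3) ℝ (TangentSpace (𝓡 3) y) :=
  (EuclideanSpace.basisFun (Fin 3) ℝ).toBasis.map
    ((trivializationAt E3 (TangentSpace (𝓡 3)) y₀).linearEquivAt ℝ y hy).symm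

theorem coordBasis_apply {y₀ y : N} (hy : y ∈ (chartAt E3 y₀).source) (i : Fin 3) :
    coordBasis hy i = coordVec y₀ y i := by
  simp only [coordBasis, coordVec, stdVec, Module.Basis.map_apply,
    OrthonormalBasis.coe_toBasis, EuclideanSpace.basisFun_apply]
  rw [LinearEquiv.symm_apply_eq]
  exact (coordComp_symmL hy _).symm.trans
    ((trivializationAt E3 (TangentSpace (𝓡 3)) y₀).continuousLinearMapAt_apply_of_mem ℝ hy _)

theorem coordBasis_repr {y₀ y : N} (hy : y ∈ (chartAt E3 y₀).source)
    (v : TangentSpace (𝓡 3) y) (i : Fin 3) : (coordBasis hy).repr v i = coordComp y₀ y v i := by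
  conv_lhs => rw [← sum_coordComp_smul_coordVec hy v]
  simp_rw [← coordBasis_apply hy]
  simp [Finsupp.single_apply]

theorem fderiv_extChartAt_comp {f : E2 → N} {y₀ : N} {q : E2}
    (hf : MDifferentiableAt (𝓡 2) (𝓡 3) f q) (hq : f q ∈ (chartAt E3 y₀).source) (w : E2) :
    fderiv ℝ (fun q' => extChartAt (𝓡 3) y₀ (f q')) q w =
      coordComp y₀ (f q) (mfderiv (𝓡 2) (𝓡 3) f q w) := by
  rw [coordComp_eq_mfderiv hq, ← mfderiv_eq_fderiv]
  have := mfderiv_comp q (mdifferentiableAt_extChartAt (I := 𝓡 3) hq) hf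
  exact DFunLike.congr_fun this w

theorem deriv_extChartAt_comp {c : ℝ → N} {y₀ : N} {t : ℝ}
    (hc : MDifferentiableAt 𝓘(ℝ, ℝ) (𝓡 3) c t) (ht : c t ∈ (chartAt E3 y₀).source) :
    deriv (fun s => extChartAt (𝓡 3) y₀ (c s)) t =
      coordComp y₀ (c t) (mfderiv 𝓘(ℝ, ℝ) (𝓡 3) c t (1 : ℝ)) := by
  rw [coordComp_eq_mfderiv ht, ← fderiv_apply_one_eq_deriv, ← mfderiv_eq_fderiv]
  have := mfderiv_comp t (mdifferentiableAt_extChartAt (I := 𝓡 3) ht) hc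
  exact DFunLike.congr_fun this 1

theorem isLocalDiffeomorphAt_extChartAt (y₀ : N) :
    IsLocalDiffeomorphAt (𝓡 3) (𝓡 3) ∞ (extChartAt (𝓡 3) y₀ : N → E3) y₀ := by
  refine ⟨{ toPartialEquiv := extChartAt (𝓡 3) y₀
            open_source := isOpen_extChartAt_source y₀
            open_target := isOpen_extChartAt_target y₀
            contMDiffOn_toFun := ?_
            contMDiffOn_invFun := contMDiffOn_extChartAt_symm y₀ },
    mem_extChartAt_source y₀, fun _ _ => rfl⟩
  have h : ContMDiffOn (𝓡 3) (𝓡 3) ∞ (extChartAt (𝓡 3) y₀) (chartAt E3 y₀).source :=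
    contMDiffOn_extChartAt
  simpa using h

theorem smoothNear_extChartAt_comp {f : E2 → N} {p : E2} {U : Set E2}
    (hU : U ∈ 𝓝 p) {y₀ : N} (hf : ContMDiffOn (𝓡 2) (𝓡 3) ∞ f U) (hy : f p ∈ (chartAt E3 y₀).source) :
    SmoothNear (fun q => extChartAt (𝓡 3) y₀ (f q)) p := by
  have hc : ContinuousAt f p := (hf.contMDiffAt hU).continuousAt
  filter_upwards [eventually_eventually_nhds.2 hU,
    hc.eventually ((chartAt E3 y₀).open_source.mem_nhds hy)] with q h1 h2
  exact ((contMDiffAt_extChartAt' h2).comp q (hf.contMDiffAt h1)).contDiffAt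

theorem smoothNear_coordComp {f : E2 → N} {X : ∀ q, TangentSpace (𝓡 3) (f q)} {p : E2}
    {U : Set E2} (hU : U ∈ 𝓝 p) {y₀ : N}
    (hX : ContMDiffOn (𝓡 2) (𝓡 3).tangent ∞ (fun q => (⟨f q, X q⟩ : TangentBundle (𝓡 3) N)) U)
    (hy : f p ∈ (chartAt E3 y₀).source) :
    SmoothNear (fun q => coordComp y₀ (f q) (X q)) p := by
  have hc : ContinuousAt f p :=
    ((Bundle.contMDiff_proj _).contMDiffAt.comp p (hX.contMDiffAt hU)).continuousAt
  filter_upwards [eventually_eventually_nhds.2 hU, hc.eventually_mem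
    ((chartAt E3 y₀).open_source.mem_nhds hy), hc.eventually
    ((chartAt E3 y₀).open_source.eventually_mem hy) |>.eventually_nhds] with q h1 h2 h3
  have h4 := (((trivializationAt E3 (TangentSpace (𝓡 3)) y₀).contMDiffAt_iff (IB := 𝓡 3)
    (f := fun q => (⟨f q, X q⟩ : TangentBundle (𝓡 3) N)) (x₀ := q) (n := ∞)
    (by simpa [Trivialization.mem_source] using h2)).1 (hX.contMDiffAt h1)).2.contDiffAt
  refine h4.congr_of_eventuallyEq ?_
  filter_upwards [h3] with q' hq'
  exact (trivializationAt E3 (TangentSpace (𝓡 3)) y₀).continuousLinearMapAt_apply_of_mem ℝ hq' _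

end Coordinates

section Metric

variable {N : Type*} [TopologicalSpace N] [ChartedSpace E3 N] [IsManifold (𝓡 3) ∞ N]
  [RiemannianBundle (fun y : N => TangentSpace (𝓡 3) y)]

/-! ### The metric in coordinates -/

/-- The Riemannian metric in the chart at `y₀`, as a bilinear form depending on the coordinates. -/
def metricForm (y₀ : N) (x : E3) : E3 →L[ℝ] E3 →L[ℝ] ℝ :=
  ∑ i, ∑ j, metricMatrix y₀ x i j •
    (EuclideanSpace.proj i : E3 →L[ℝ] ℝ).smulRight (EuclideanSpace.proj j : E3 →L[ℝ] ℝ)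

theorem contDiffAt_smul_const {V W : Type*} [NormedAddCommGroup V] [NormedSpace ℝ V]
    [NormedAddCommGroup W] [NormedSpace ℝ W] {f : V → ℝ} {x : V} (hf : ContDiffAt ℝ ∞ f x)
    (w : W) : ContDiffAt ℝ ∞ (fun y => f y • w) x :=
  hf.smul contDiffAt_const

theorem metricForm_apply (y₀ : N) (x v w : E3) :
    metricForm y₀ x v w = ∑ i, ∑ j, metricMatrix y₀ x i j * (v i * w j) := by
  simp [metricForm]

theorem metricForm_coordComp {y₀ y : N} (hy : y ∈ (chartAt E3 y₀).source)
    (v w : TangentSpace (𝓡 3) y) :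
    metricForm y₀ (extChartAt (𝓡 3) y₀ y) (coordComp y₀ y v) (coordComp y₀ y w) =
      inner ℝ v w := by
  have hs : (extChartAt (𝓡 3) y₀).symm (extChartAt (𝓡 3) y₀ y) = y :=
    (extChartAt (𝓡 3) y₀).left_inv (by rwa [extChartAt_source])
  conv_rhs => rw [← sum_coordComp_smul_coordVec hy v, ← sum_coordComp_smul_coordVec hy w]
  rw [metricForm_apply, sum_inner]
  refine Finset.sum_congr rfl fun i _ => ?_
  rw [inner_sum]
  refine Finset.sum_congr rfl fun j _ => ?_
  rw [inner_smul_left, inner_smul_right, metricMatrix, Matrix.of_apply, hs]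
  simp; ring

theorem metricForm_pos {y₀ : N} {x : E3} (hx : x ∈ (extChartAt (𝓡 3) y₀).target) {v : E3}
    (hv : v ≠ 0) : 0 < metricForm y₀ x v v := by
  set y := (extChartAt (𝓡 3) y₀).symm x with hy'
  have hy : y ∈ (chartAt E3 y₀).source := by
    rw [← extChartAt_source (𝓡 3)]; exact (extChartAt (𝓡 3) y₀).map_target hx
  have hxy : extChartAt (𝓡 3) y₀ y = x := (extChartAt (𝓡 3) y₀).right_inv hx
  have h := metricForm_coordComp hy
    ((trivializationAt E3 (TangentSpace (𝓡 3)) y₀).symmL ℝ y v)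
    ((trivializationAt E3 (TangentSpace (𝓡 3)) y₀).symmL ℝ y v)
  rw [coordComp_symmL hy, hxy] at h
  rw [h]
  refine real_inner_self_pos.2 fun h0 => hv ?_
  rw [← coordComp_symmL hy v, h0]
  exact map_zero _

theorem smoothNear_metricMatrix [IsContMDiffRiemannianBundle (𝓡 3) ∞ E3
    (fun y : N => TangentSpace (𝓡 3) y)] (y₀ : N) (i j : Fin 3) {x : E3}
    (hx : x ∈ (extChartAt (𝓡 3) y₀).target) :
    SmoothNear (fun x => metricMatrix y₀ x i j) x := by
  filter_upwards [(isOpen_extChartAt_target y₀).mem_nhds hx] with z hz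
  have hz' : (extChartAt (𝓡 3) y₀).symm z ∈ (chartAt E3 y₀).source := by
    rw [← extChartAt_source (𝓡 3)]; exact (extChartAt (𝓡 3) y₀).map_target hz
  have hsymm : ContMDiffAt 𝓘(ℝ, E3) (𝓡 3) ∞ (extChartAt (𝓡 3) y₀).symm z :=
    (contMDiffOn_extChartAt_symm y₀).contMDiffAt ((isOpen_extChartAt_target y₀).mem_nhds hz)
  have hframe : ∀ i, ContMDiffAt (𝓡 3) (𝓡 3).tangent ∞
      (fun y => (⟨y, coordVec y₀ y i⟩ : TangentBundle (𝓡 3) N)) ((extChartAt (𝓡 3) y₀).symm z) := by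
    intro i
    have h := contMDiffAt_localFrame_of_mem (I := 𝓡 3) ∞
      (trivializationAt E3 (TangentSpace (𝓡 3)) y₀) (EuclideanSpace.basisFun (Fin 3) ℝ).toBasis i
      hz'
    refine h.congr_of_eventuallyEq ?_
    filter_upwards [(chartAt E3 y₀).open_source.mem_nhds hz'] with y hy
    rw [Trivialization.localFrame_apply_of_mem_baseSet _ _ hy, ← coordBasis_apply hy]
    rfl
  have h := ContMDiffAt.inner_bundle (IB := 𝓡 3) (IM := 𝓘(ℝ, E3)) (n := ∞)
    ((hframe i).comp z hsymm) ((hframe j).comp z hsymm)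
  exact h.contDiffAt

set_option synthInstance.maxHeartbeats 200000 in
theorem smoothNear_metricForm [IsContMDiffRiemannianBundle (𝓡 3) ∞ E3
    (fun y : N => TangentSpace (𝓡 3) y)] (y₀ : N) {x : E3}
    (hx : x ∈ (extChartAt (𝓡 3) y₀).target) : SmoothNear (metricForm y₀) x := by
  have h : ∀ᶠ z in 𝓝 x, ∀ i j, ContDiffAt ℝ ∞ (fun x => metricMatrix y₀ x i j) z :=
    eventually_all.2 fun i => eventually_all.2 fun j => smoothNear_metricMatrix y₀ i j hx
  filter_upwards [h] with z hz
  unfold metricForm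
  exact ContDiffAt.sum fun i _ => ContDiffAt.sum fun j _ => contDiffAt_smul_const (hz i j) _

/-! ### The volume element in coordinates -/

theorem volumeElement_eq (o : ManifoldOrientation N) {y₀ y : N}
    (hy : y ∈ (chartAt E3 y₀).source) (a b c : TangentSpace (𝓡 3) y) :
    volumeElement o y a b c =
      volumeElement o y (coordVec y₀ y 0) (coordVec y₀ y 1) (coordVec y₀ y 2) *
        det3 (coordComp y₀ y a) (coordComp y₀ y b) (coordComp y₀ y c) := by
  unfold volumeElement
  rw [(o.at' y).volumeForm.eq_smul_basis_det (coordBasis hy)]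
  have h0 : ![coordVec y₀ y 0, coordVec y₀ y 1, coordVec y₀ y 2] = coordBasis hy := by
    ext i; fin_cases i <;> simp [coordBasis_apply]
  rw [h0, AlternatingMap.smul_apply, AlternatingMap.smul_apply, Module.Basis.det_self,
    Module.Basis.det_apply, Matrix.det_fin_three]
  simp [Module.Basis.toMatrix_apply, coordBasis_repr, det3]
  left; ring

/-- The metric matrix is the Gram matrix TᵀT, with T the matrix of the coordinate frame in an
oriented orthonormal basis, and the volume of the frame is det T. -/
theorem volumeElement_coordVec_sq (o : ManifoldOrientation N) {y₀ y : N}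
    (hy : y ∈ (chartAt E3 y₀).source) :
    volumeElement o y (coordVec y₀ y 0) (coordVec y₀ y 1) (coordVec y₀ y 2) ^ 2 =
      (metricMatrix y₀ (extChartAt (𝓡 3) y₀ y)).det := by
  have hs : (extChartAt (𝓡 3) y₀).symm (extChartAt (𝓡 3) y₀ y) = y :=
    (extChartAt (𝓡 3) y₀).left_inv (by rwa [extChartAt_source])
  let b := (o.at' y).finOrthonormalBasis (by norm_num) (finrank_tangentSpace y).out
  have hb : b.toBasis.orientation = o.at' y := Orientation.finOrthonormalBasis_orientation _ _ _
  have hM : metricMatrix y₀ (extChartAt (𝓡 3) y₀ y) =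
      (b.toBasis.toMatrix (coordBasis hy)).transpose * b.toBasis.toMatrix (coordBasis hy) := by
    ext i j
    rw [metricMatrix, Matrix.of_apply, hs, Matrix.mul_apply, ← coordBasis_apply hy,
      ← coordBasis_apply hy, ← b.sum_inner_mul_inner]
    refine Finset.sum_congr rfl fun k _ => ?_
    rw [Matrix.transpose_apply, Module.Basis.toMatrix_apply, Module.Basis.toMatrix_apply,
      OrthonormalBasis.coe_toBasis_repr_apply, OrthonormalBasis.coe_toBasis_repr_apply,
      OrthonormalBasis.repr_apply_apply, OrthonormalBasis.repr_apply_apply, real_inner_comm]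
  have h0 : ![coordVec y₀ y 0, coordVec y₀ y 1, coordVec y₀ y 2] = coordBasis hy := by
    ext i; fin_cases i <;> simp [coordBasis_apply]
  rw [hM, Matrix.det_mul, Matrix.det_transpose, volumeElement, h0,
    (o.at' y).volumeForm_robust b hb, Module.Basis.det_apply, sq]

theorem volumeElement_coordVec_pos_iff (o : ManifoldOrientation N) {y₀ y : N}
    (hy : y ∈ (chartAt E3 y₀).source) :
    0 < volumeElement o y (coordVec y₀ y 0) (coordVec y₀ y 1) (coordVec y₀ y 2) ↔
      (EuclideanSpace.basisFun (Fin 3) ℝ).toBasis.orientation = Orientation.map (Fin 3)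
        ((trivializationAt E3 (TangentSpace (𝓡 3)) y₀).linearEquivAt ℝ y hy) (o.at' y) := by
  let b := (o.at' y).finOrthonormalBasis (by norm_num) (finrank_tangentSpace y).out
  have hb : b.toBasis.orientation = o.at' y := Orientation.finOrthonormalBasis_orientation _ _ _
  have h0 : ![coordVec y₀ y 0, coordVec y₀ y 1, coordVec y₀ y 2] = coordBasis hy := by
    ext i; fin_cases i <;> simp [coordBasis_apply]
  rw [volumeElement, h0, (o.at' y).volumeForm_robust b hb,
    ← Module.Basis.orientation_eq_iff_det_pos, hb, ← (Orientation.map (Fin 3)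
      ((trivializationAt E3 (TangentSpace (𝓡 3)) y₀).linearEquivAt ℝ y hy)).injective.eq_iff,
    ← Module.Basis.orientation_map, eq_comm, coordBasis]
  have : ((EuclideanSpace.basisFun (Fin 3) ℝ).toBasis.map
      ((trivializationAt E3 (TangentSpace (𝓡 3)) y₀).linearEquivAt ℝ y hy).symm).map
      ((trivializationAt E3 (TangentSpace (𝓡 3)) y₀).linearEquivAt ℝ y hy) =
      (EuclideanSpace.basisFun (Fin 3) ℝ).toBasis := by
    ext i : 1; simp
  rw [this]

/-- The square of the function is det g, which is continuous at y₀. Its sign is constant near y₀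
because the orientation is locally constant in the chart, so it is √(det g) or -√(det g) throughout
a neighbourhood. -/
theorem continuousAt_volumeElement_coordVec [IsContMDiffRiemannianBundle (𝓡 3) ∞ E3
    (fun y : N => TangentSpace (𝓡 3) y)] (o : ManifoldOrientation N) (y₀ : N) :
    ContinuousAt (fun y => volumeElement o y (coordVec y₀ y 0) (coordVec y₀ y 1)
      (coordVec y₀ y 2)) y₀ := by
  have hmem : ∀ᶠ y in 𝓝 y₀, y ∈ (chartAt E3 y₀).source :=
    (chartAt E3 y₀).open_source.mem_nhds (mem_chart_source E3 y₀)
  have hcont : ContinuousAt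
      (fun y => √(metricMatrix y₀ (extChartAt (𝓡 3) y₀ y)).det) y₀ := by
    have h : ContinuousAt (metricMatrix y₀) (extChartAt (𝓡 3) y₀ y₀) :=
      continuousAt_pi.2 fun i => continuousAt_pi.2 fun j =>
        (smoothNear_metricMatrix y₀ i j (mem_extChartAt_target y₀)).continuousAt
    exact (Continuous.matrix_det continuous_id).continuousAt.comp
      (h.comp (continuousAt_extChartAt y₀)) |>.sqrt
  obtain ⟨o₀, ho⟩ := o.locally_constant y₀
  by_cases h : (EuclideanSpace.basisFun (Fin 3) ℝ).toBasis.orientation = o₀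
  · refine hcont.congr ?_
    filter_upwards [hmem, ho] with y hy hoy
    have h1 := (volumeElement_coordVec_pos_iff o hy).2 (h.trans (hoy hy).symm)
    rw [← volumeElement_coordVec_sq o hy, Real.sqrt_sq h1.le]
  · refine hcont.neg.congr ?_
    filter_upwards [hmem, ho] with y hy hoy
    have h1 := mt (volumeElement_coordVec_pos_iff o hy).1 fun h2 => h (h2.trans (hoy hy))
    rw [Pi.neg_apply, ← volumeElement_coordVec_sq o hy, ← neg_sq, Real.sqrt_sq (by linarith), neg_neg]

theorem volumeElement_coordVec_ne_zero (o : ManifoldOrientation N) (y₀ : N) :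
    volumeElement o y₀ (coordVec y₀ y₀ 0) (coordVec y₀ y₀ 1) (coordVec y₀ y₀ 2) ≠ 0 := by
  have hy := mem_chart_source E3 y₀
  have h0 : ![coordVec y₀ y₀ 0, coordVec y₀ y₀ 1, coordVec y₀ y₀ 2] = coordBasis hy := by
    ext i; fin_cases i <;> simp [coordBasis_apply]
  let b := (o.at' y₀).finOrthonormalBasis (by norm_num) (finrank_tangentSpace y₀).out
  have hb : b.toBasis.orientation = o.at' y₀ := Orientation.finOrthonormalBasis_orientation _ _ _
  rw [volumeElement, h0, (o.at' y₀).volumeForm_robust b hb]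
  exact (b.toBasis.isUnit_det _).ne_zero

end Metric

section Reduction

variable {N : Type*} [TopologicalSpace N] [ChartedSpace E3 N] [IsManifold (𝓡 3) ∞ N]

/-! ### Reduction to maps into Euclidean space -/

theorem coordComp_eq_coordChangeL {y₀ y₁ y : N} (h₀ : y ∈ (chartAt E3 y₀).source)
    (h₁ : y ∈ (chartAt E3 y₁).source) (v : TangentSpace (𝓡 3) y) :
    coordComp y₀ y v = (trivializationAt E3 (TangentSpace (𝓡 3)) y₁).coordChangeL ℝ
      (trivializationAt E3 (TangentSpace (𝓡 3)) y₀) y (coordComp y₁ y v) := by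
  rw [Trivialization.coordChangeL_apply _ _ ⟨h₁, h₀⟩]
  have h := (trivializationAt E3 (TangentSpace (𝓡 3)) y₀).continuousLinearMapAt_apply_of_mem ℝ h₀
    ((trivializationAt E3 (TangentSpace (𝓡 3)) y₁).symm y (coordComp y₁ y v))
  refine Eq.trans ?_ h
  rw [← Trivialization.symmL_apply (R := ℝ) _ h₁]
  exact congrArg (coordComp y₀ y) (symmL_coordComp h₁ v).symm

variable [RiemannianBundle (fun y : N => TangentSpace (𝓡 3) y)]

set_option synthInstance.maxHeartbeats 200000 in
/-- In null directions of `df`, covariant differentiation along `f` is differentiation of the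
components in any chart. -/
theorem coordComp_covDerivAlong {f : E2 → N} {X : ∀ q, TangentSpace (𝓡 3) (f q)} {U : Set E2}
    {q w : E2} {y₀ : N} (hU : U ∈ 𝓝 q) (hf : ContMDiffOn (𝓡 2) (𝓡 3) ∞ f U)
    (hX : ContMDiffOn (𝓡 2) (𝓡 3).tangent ∞ (fun q => (⟨f q, X q⟩ : TangentBundle (𝓡 3) N)) U)
    (hy : f q ∈ (chartAt E3 y₀).source) (hw : mfderiv (𝓡 2) (𝓡 3) f q w = 0) :
    coordComp y₀ (f q) (covDerivAlong f X q w) =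
      fderiv ℝ (fun q' => coordComp y₀ (f q') (X q')) q w := by
  have hq := mem_chart_source E3 (f q)
  have hfq : MDifferentiableAt (𝓡 2) (𝓡 3) f q := (hf.contMDiffAt hU).mdifferentiableAt (by simp)
  have hξ := smoothNear_coordComp hU hX hq
  have hF := (smoothNear_extChartAt_comp hU hf hq).differentiableAt
  have hcov : covDerivAlong f X q w =
      ∑ k, fderiv ℝ (fun q' => coordComp (f q) (f q') (X q')) q w k • coordVec (f q) (f q) k := by
    unfold covDerivAlong
    refine Finset.sum_congr rfl fun k _ => ?_
    -- Every Christoffel term contains a component of df(w), which is zero.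
    have h0 : ∀ i, fderiv ℝ (fun q' => extChartAt (𝓡 3) (f q) (f q') i) q w = 0 := fun i => by
      rw [fderiv_apply_coord hF, fderiv_extChartAt_comp hfq hq, hw]
      simp [coordComp]
    simp only [h0, mul_zero, Finset.sum_const_zero, add_zero]
    rw [fderiv_apply_coord hξ.differentiableAt]
  have hcomp : coordComp (f q) (f q) (covDerivAlong f X q w) =
      fderiv ℝ (fun q' => coordComp (f q) (f q') (X q')) q w := by
    rw [hcov]
    conv_rhs => rw [E3_eq_sum (fderiv ℝ (fun q' => coordComp (f q) (f q') (X q')) q w)]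
    simp only [← coordComp_coordVec hq, coordComp, Fin.sum_univ_three, map_add, map_smul]
  let A : N → E3 →L[ℝ] E3 := fun y =>
    ((trivializationAt E3 (TangentSpace (𝓡 3)) (f q)).coordChangeL ℝ
      (trivializationAt E3 (TangentSpace (𝓡 3)) y₀) y : E3 →L[ℝ] E3)
  have hA : MDifferentiableAt (𝓡 3) 𝓘(ℝ, E3 →L[ℝ] E3) A (f q) :=
    (contMDiffAt_coordChangeL (n := ∞) hq hy).mdifferentiableAt (by simp)
  have hAf : DifferentiableAt ℝ (fun q' => A (f q')) q :=
    (MDifferentiableAt.comp q hA hfq).differentiableAt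
  -- The transition matrix depends on q' only through f, so it is stationary along the null
  -- direction w. This makes differentiation of components independent of the chart.
  have hdA : fderiv ℝ (fun q' => A (f q')) q w = 0 := by
    rw [← mfderiv_eq_fderiv]
    have h := DFunLike.congr_fun (mfderiv_comp q hA hfq) w
    refine h.trans ?_
    change mfderiv (𝓡 3) 𝓘(ℝ, E3 →L[ℝ] E3) A (f q) (mfderiv (𝓡 2) (𝓡 3) f q w) = 0
    rw [hw, map_zero]
  have hev : (fun q' => coordComp y₀ (f q') (X q')) =ᶠ[𝓝 q]
      fun q' => A (f q') (coordComp (f q) (f q') (X q')) := by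
    filter_upwards [hfq.continuousAt.eventually_mem ((chartAt E3 (f q)).open_source.mem_nhds hq),
      hfq.continuousAt.eventually_mem ((chartAt E3 y₀).open_source.mem_nhds hy)] with q' h1 h2
    exact coordComp_eq_coordChangeL h2 h1 _
  rw [hev.fderiv_eq, fderiv_clm_apply hAf hξ.differentiableAt, coordComp_eq_coordChangeL hy hq,
    hcomp]
  simp [hdA, A]

theorem signedAreaDensity_eq (o : ManifoldOrientation N) {f : E2 → N}
    {ν : ∀ q, TangentSpace (𝓡 3) (f q)} {q : E2} {y₀ : N}
    (hf : MDifferentiableAt (𝓡 2) (𝓡 3) f q) (hy : f q ∈ (chartAt E3 y₀).source) :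
    signedAreaDensity o f ν q =
      volumeElement o (f q) (coordVec y₀ (f q) 0) (coordVec y₀ (f q) 1) (coordVec y₀ (f q) 2) *
        areaDensity (fun q' => extChartAt (𝓡 3) y₀ (f q'))
          (fun q' => coordComp y₀ (f q') (ν q')) q := by
  rw [signedAreaDensity, volumeElement_eq o hy, areaDensity, fderiv_extChartAt_comp hf hy,
    fderiv_extChartAt_comp hf hy]

theorem psi_eq (o : ManifoldOrientation N) {f : E2 → N} {ν : ∀ q, TangentSpace (𝓡 3) (f q)}
    {U : Set E2} (hf : IsFrontalOn f ν U) {γ η : ℝ → E2} {t : ℝ} {y₀ : N} (hU : U ∈ 𝓝 (γ t))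
    (hγ : DifferentiableAt ℝ γ t) (hη : mfderiv (𝓡 2) (𝓡 3) f (γ t) (η t) = 0)
    (hy : f (γ t) ∈ (chartAt E3 y₀).source) :
    psi o f ν γ η t =
      volumeElement o (f (γ t)) (coordVec y₀ (f (γ t)) 0) (coordVec y₀ (f (γ t)) 1)
          (coordVec y₀ (f (γ t)) 2) *
        flatPsi (fun q' => extChartAt (𝓡 3) y₀ (f q'))
          (fun q' => coordComp y₀ (f q') (ν q')) γ η t := by
  have hc : MDifferentiableAt 𝓘(ℝ, ℝ) (𝓡 3) (fun s => f (γ s)) t :=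
    MDifferentiableAt.comp t ((hf.smooth.contMDiffAt hU).mdifferentiableAt (by simp))
      hγ.mdifferentiableAt
  rw [psi, volumeElement_eq o hy, flatPsi, deriv_extChartAt_comp hc hy,
    coordComp_covDerivAlong hU hf.smooth hf.smooth_normal hy hη]

end Reduction

theorem smoothNear_of_contDiffOn_Ioo {γ : ℝ → E2} {ε : ℝ} (hε : 0 < ε)
    (hγ : ContDiffOn ℝ ∞ γ (Ioo (-ε) ε)) : SmoothNear γ 0 := by
  filter_upwards [Ioo_mem_nhds (neg_lt_zero.2 hε) hε] with t ht
  exact hγ.contDiffAt (isOpen_Ioo.mem_nhds ht)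

end CuspidalCrossCap

end

/-! ### The criterion for cuspidal cross caps -/

open CuspidalCrossCap in
theorem mainTheorem7
    {N : Type*} [TopologicalSpace N] [ChartedSpace CuspidalCrossCap.E3 N]
    [IsManifold (𝓡 3) ∞ N]
    [RiemannianBundle (fun y : N => TangentSpace (𝓡 3) y)]
    [IsContMDiffRiemannianBundle (𝓡 3) ∞ CuspidalCrossCap.E3
      (fun y : N => TangentSpace (𝓡 3) y)]
    (o : CuspidalCrossCap.ManifoldOrientation N)
    (U : Set CuspidalCrossCap.E2) (hU : IsOpen U)
    (f : CuspidalCrossCap.E2 → N)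
    (ν : ∀ q : CuspidalCrossCap.E2, TangentSpace (𝓡 3) (f q))
    (hf : CuspidalCrossCap.IsFrontalOn f ν U)
    (p : CuspidalCrossCap.E2) (hpU : p ∈ U)
    (hp : CuspidalCrossCap.IsNondegenerateSingularPoint o f ν p)
    (ε : ℝ) (γ : ℝ → CuspidalCrossCap.E2)
    (hγ : CuspidalCrossCap.IsSingularCurve o f ν U p ε γ)
    (η : ℝ → CuspidalCrossCap.E2)
    (hη : CuspidalCrossCap.IsNullField f ε γ η) :
    CuspidalCrossCap.IsCuspidalCrossCapAt f p ↔
      (LinearIndependent ℝ ![η 0, deriv γ 0] ∧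
        (CuspidalCrossCap.psi o f ν γ η 0 = 0 ∧
          deriv (CuspidalCrossCap.psi o f ν γ η) 0 ≠ 0)) := by
  have hI : Ioo (-ε) ε ∈ 𝓝 (0 : ℝ) := Ioo_mem_nhds (neg_lt_zero.2 hγ.pos) hγ.pos
  have h0I : (0 : ℝ) ∈ Ioo (-ε) ε := mem_of_mem_nhds hI
  have hUp : U ∈ 𝓝 p := hU.mem_nhds hpU
  have hyp := mem_chart_source E3 (f p)
  have hfc : ContinuousAt f p := (hf.smooth.contMDiffAt hUp).continuousAt
  let F : E2 → E3 := fun q => extChartAt (𝓡 3) (f p) (f q)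
  let X : E2 → E3 := fun q => coordComp (f p) (f q) (ν q)
  let c : N → ℝ := fun y =>
    volumeElement o y (coordVec (f p) y 0) (coordVec (f p) y 1) (coordVec (f p) y 2)
  have hF : SmoothNear F p := smoothNear_extChartAt_comp hUp hf.smooth hyp
  have hX : SmoothNear X p := smoothNear_coordComp hUp hf.smooth_normal hyp
  have hc : ContinuousAt c (f p) := continuousAt_volumeElement_coordVec o (f p)
  have hc0 : c (f p) ≠ 0 := volumeElement_coordVec_ne_zero o (f p)
  have hgood : ∀ᶠ q in 𝓝 p, q ∈ U ∧ f q ∈ (chartAt E3 (f p)).source :=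
    (hU.eventually_mem hpU).and
      (hfc.eventually_mem ((chartAt E3 (f p)).open_source.mem_nhds hyp))
  have hfd : ∀ {q}, q ∈ U → MDifferentiableAt (𝓡 2) (𝓡 3) f q := fun hq =>
    (hf.smooth.contMDiffAt (hU.mem_nhds hq)).mdifferentiableAt (by simp)
  have hγs : SmoothNear γ 0 := smoothNear_of_contDiffOn_Ioo hγ.pos hγ.smooth
  have hηs : SmoothNear η 0 := smoothNear_of_contDiffOn_Ioo hγ.pos hη.smooth
  have hγgood : ∀ᶠ t in 𝓝 (0 : ℝ), γ t ∈ U ∧ f (γ t) ∈ (chartAt E3 (f p)).source :=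
    hγs.continuousAt.tendsto.eventually (by rw [hγ.base]; exact hgood)
  have hnull : ∀ᶠ t in 𝓝 (0 : ℝ), fderiv ℝ F (γ t) (η t) = 0 := by
    filter_upwards [hγgood, hI] with t ⟨h1, h2⟩ h3
    rw [fderiv_extChartAt_comp (hfd h1) h2, hη.null t h3]
    simp [coordComp]
  have hnormal : ∀ᶠ q in 𝓝 p, ∀ v, metricForm (f p) (F q) (X q) (fderiv ℝ F q v) = 0 := by
    filter_upwards [hgood] with q ⟨h1, h2⟩ v
    rw [fderiv_extChartAt_comp (hfd h1) h2, metricForm_coordComp h2, real_inner_comm]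
    exact hf.normal q h1 v
  have hX0 : X p ≠ 0 := coordComp_ne_zero hyp fun h => by
    have := hf.unit p hpU
    simp [h] at this
  -- Non-degeneracy passes to the chart because the two densities differ by the volume of the
  -- coordinate frame, a continuous nonvanishing factor.
  have hdens : areaDensity F X p = 0 ∧ fderiv ℝ (areaDensity F X) p ≠ 0 := by
    refine (simpleZero_iff_of_eventuallyEq_mul (hc.comp hfc) hc0 ?_).1 hp
    filter_upwards [hgood] with q ⟨h1, h2⟩
    exact signedAreaDensity_eq o (hfd h1) h2
  have hpsi : (psi o f ν γ η 0 = 0 ∧ deriv (psi o f ν γ η) 0 ≠ 0) ↔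
      (flatPsi F X γ η 0 = 0 ∧ deriv (flatPsi F X γ η) 0 ≠ 0) := by
    rw [← fderiv_ne_zero_iff_deriv_ne_zero, ← fderiv_ne_zero_iff_deriv_ne_zero]
    refine simpleZero_iff_of_eventuallyEq_mul (c := fun t => c (f (γ t))) ?_ ?_ ?_
    · refine ContinuousAt.comp (g := fun q => c (f q)) ?_ hγs.continuousAt
      rw [hγ.base]; exact hc.comp hfc
    · rw [hγ.base]; exact hc0
    · filter_upwards [hγgood, hI, hγs.eventually] with t ⟨h1, h2⟩ h3 h4
      exact psi_eq o hf (hU.mem_nhds h1) h4.differentiableAt (hη.null t h3) h2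
  have hFf : AEquivalentAt F p f p := by
    have h := isLocalDiffeomorphAt_extChartAt (f p)
    exact aEquivalentAt_of_target (h.localInverse_isLocalDiffeomorphAt)
      ((hfc.eventually h.localInverse_eventuallyEq_left).mono fun _ hx => hx.symm)
  have hfF : AEquivalentAt f p F p :=
    aEquivalentAt_of_target (isLocalDiffeomorphAt_extChartAt (f p)) (Eventually.of_forall fun _ => rfl)
  -- This serves both implications: with b = u for a given cuspidal cross cap, and with the b of the
  -- normal form for the converse.
  have key : ∀ {b : E2 → ℝ}, ContDiff ℝ ∞ b → AEquivalentAt F p (cuspidalForm b) 0 → _ :=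
    fun hb hFb => flatPsi_simpleZero_iff hF hX
      (smoothNear_metricForm (f p) (mem_extChartAt_target (f p)))
      (((isOpen_extChartAt_target (f p)).eventually_mem (mem_extChartAt_target (f p))).mono
        fun _ hy _ hv => metricForm_pos hy hv)
      hX0 hnormal hγs hηs hγ.base (hγ.regular 0 h0I) (hη.ne_zero 0 h0I) hnull hb hFb
  rw [hpsi]
  constructor
  · intro h
    have hb : ContDiff ℝ ∞ fun y : E2 => y 0 := contDiff_euclidean.1 contDiff_id 0
    have h1 := hFf.trans h
    rw [fCCR_eq_cuspidalForm] at h1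
    obtain ⟨h2, h3⟩ := key hb h1
    -- For b = u both b(0) = 0 and b_u(0) = 1 are immediate.
    refine ⟨h2, h3.2 ⟨rfl, ?_⟩⟩
    rw [fderiv_coord]
    simp [stdVec]
  · rintro ⟨hind, hψ⟩
    obtain ⟨b, hb, hFb⟩ := exists_cuspidalForm hF hX hdens.1 hdens.2 hγs hηs hγ.base hnull hind
    have h1 := (key hb hFb).2.1 hψ
    exact (hfF.trans hFb).trans (aEquivalentAt_fCCR_of_cuspidalForm hb h1.1 h1.2)
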